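/- Let $n\ge 2$, let $TS^{n-1}=\{(x,\xi)\in\mathbb R^n\times\mathbb R^n:\ |\xi|=1,\ \langle x,\xi\rangle=0\}$, and let $\mathcal S(\mathbb R^n;S^2\mathbb R^n)$ be the Schwartz space of complex symmetric tensor fields $f=(f_{ij})$ of rank $2$. For $k=0,1,2$ the momentum ray transforms of such a field are $$(I^kf)(x,\xi)=\int_{-\infty}^{\infty}t^k\sum_{i,j}f_{ij}(x+t\xi)\,\xi_i\xi_j\,dt,\qquad (x,\xi)\in TS^{n-1}.$$ Fourier transforms are $\hat u(y)=(2\pi)^{-n/2}\int_{\mathbb R^n}e^{-i\langle y,x\rangle}u(x)\,dx$ on $\mathbb R^n$ and $\hat\varphi(y,\xi)=(2\pi)^{-(n-1)/2}\int_{\xi^\perp}e^{-i\langle y,x\rangle}\varphi(x,\xi)\,dx$ on $TS^{n-1}$. Put $$\|u\|^2_{H^s_t(\mathbb R^n)}=\int_{\mathbb R^n}|y|^{2t}(1+|y|^2)^{s-t}|\hat u(y)|^2\,dy,\qquad \|f\|^2_{H^s_t(\mathbb R^n;S^2\mathbb R^n)}=\sum_{i,j}\|f_{ij}\|^2_{H^s_t(\mathbb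 R^n)},$$ $$\|\varphi\|^2_{H^s_t}=\|\varphi\|^2_{H^s_t(TS^{n-1})}=\frac1{2\pi}\int_{S^{n-1}}\int_{\xi^\perp}|y|^{2t}(1+|y|^2)^{s-t}|\hat\varphi(y,\xi)|^2\,dy\,d\xi,$$ and let $H^s_t(\mathbb R^n;S^2\mathbb R^n)$ be the completion of $\mathcal S(\mathbb R^n;S^2\mathbb R^n)$ in its norm. Let $\Xi_i$ be the restriction to $TS^{n-1}$ of the (tangent) vector field $\frac{\partial}{\partial\xi_i}-x_i\sum_p\xi_p\frac{\partial}{\partial x_p}-\xi_i\sum_p\xi_p\frac{\partial}{\partial\xi_p}$, and let $Z$ be the operator given by $\widehat{Z\varphi}(y,\xi)=\sum_i\frac{y_i}{|y|}(\Xi_i\hat\varphi)(y,\xi)$. For $f\in\mathcal S(\mathbb R^n;S^2\mathbb R^n)$ set $$\begin{aligned}B^s_t(f)={}&\|I^2f\|^2_{H^{s+5/2}_{t+5/2}}+\sum_i\|\Xi_i(I^1f)\|^2_{H^{s+3/2}_{t+3/2}}+\|I^1f\|^2_{H^{s+3/2}_{t+3/2}}+\|Z(I^1f)\|^2_{H^{s+3/2}_{t+3/2}}\\&+\sum_i\|x_iI^0f\|^2_{H^{s+3/2}_{t+3/2}}+\sum_{i,j}\|\Xi_i\Xi_j(I^0f)\|^2_{H^{s+1/2}_{t+1/2}}+\|I^0f\|^2_{H^{s+1/2}_{t+1/2}}+\sum_i\|\Xi_i(I^0f)\|^2_{H^{s+1/2}_{t+1/2}}.\end{aligned}$$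 There is a constant $b_n$ depending only on $n$ such that, for every $s\in\mathbb R$ and every $t>-n/2$: (1) for every $f\in\mathcal S(\mathbb R^n;S^2\mathbb R^n)$ the quantity $B^s_t(f)$ is finite and $\|f\|^2_{H^s_t(\mathbb R^n;S^2\mathbb R^n)}\le b_n\,B^s_t(f)$; (2) for every $f\in H^s_t(\mathbb R^n;S^2\mathbb R^n)$, $\|f\|^2_{H^s_t(\mathbb R^n;S^2\mathbb R^n)}\le b_n\,B^s_t(f)$, where $B^s_t$ is extended to the completion by approximation: $B^s_t(f)\in[0,\infty]$ is the infimum of $\liminf_{k\to\infty}B^s_t(g_k)$ over all sequences $g_k\in\mathcal S(\mathbb R^n;S^2\mathbb R^n)$ converging to $f$ in $H^s_t(\mathbb R^n;S^2\mathbb R^n)$. -/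

import Mathlib

open MeasureTheory Filter Topology
open scoped ENNReal NNReal SchwartzMap RealInnerProductSpace

noncomputable section

namespace MomentumRay

/-- Euclidean space `ℝⁿ`. -/
abbrev E (n : ℕ) := EuclideanSpace ℝ (Fin n)

/-- The manifold `TSⁿ⁻¹ = {(x, ξ) ∈ ℝⁿ × ℝⁿ : |ξ| = 1, ⟨x, ξ⟩ = 0}`. -/
def TS (n : ℕ) : Type := {p : E n × E n // ‖p.2‖ = 1 ∧ ⟪p.1, p.2⟫ = 0}

/-- The point of `TSⁿ⁻¹` given by a unit vector `ξ` and `x ∈ ξ^⊥`. -/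
def TS.mk {n : ℕ} (ξ : Metric.sphere (0 : E n) 1) (x : (ℝ ∙ (ξ : E n))ᗮ) : TS n :=
  ⟨((x : E n), (ξ : E n)), by
    refine ⟨by simp, ?_⟩
    have h := Submodule.mem_orthogonal_singleton_iff_inner_right.mp x.2
    rw [real_inner_comm]
    exact h⟩

/-- `(x, ξ) ↦ (x - (⟨ξ, x⟩ / |ξ|²) ξ, ξ / |ξ|)`, the retraction of `ℝⁿ × (ℝⁿ \ {0})` onto
`TSⁿ⁻¹`. -/
def TS.proj {n : ℕ} (p : E n × E n) (h : p.2 ≠ 0) : TS n :=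
  ⟨(p.1 - (⟪p.2, p.1⟫ / ‖p.2‖ ^ 2) • p.2, ‖p.2‖⁻¹ • p.2), by
    have h0 : ‖p.2‖ ≠ 0 := norm_ne_zero_iff.mpr h
    refine ⟨by simp [norm_smul, h0], ?_⟩
    simp only [inner_sub_left, inner_smul_left, inner_smul_right,
      real_inner_self_eq_norm_sq, real_inner_comm p.1 p.2]
    simp only [conj_trivial]
    field_simp
    ring⟩

/-- The Lebesgue measure on the hyperplane `ξ^⊥` (the one in which the cube spanned by an
orthonormal basis has measure one). -/
def perpMeasure {n : ℕ} (ξ : Metric.sphere (0 : E n) 1) : Measure (ℝ ∙ (ξ : E n))ᗮ :=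
  @volume _ measureSpaceOfInnerProductSpace

/-- The surface measure of the unit sphere. -/
def sphereMeasure (n : ℕ) : Measure (Metric.sphere (0 : E n) 1) :=
  (volume : Measure (E n)).toSphere

/-! ### Fourier transforms -/

/-- `û(y) = (2π)^{-n/2} ∫ e^{-i⟨y, x⟩} u(x) dx` on `ℝⁿ`. -/
def fourierRn {n : ℕ} (u : E n → ℂ) (y : E n) : ℂ :=
  (((2 * Real.pi) ^ (-(n : ℝ) / 2) : ℝ) : ℂ) *
    ∫ x : E n, Complex.exp (-Complex.I * ((⟪y, x⟫ : ℝ) : ℂ)) * u x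

/-- `φ̂(y, ξ) = (2π)^{-(n-1)/2} ∫_{ξ^⊥} e^{-i⟨y, x⟩} φ(x, ξ) dx` on `TSⁿ⁻¹`. -/
def fourierTS {n : ℕ} (φ : TS n → ℂ) (q : TS n) : ℂ :=
  let ξ : Metric.sphere (0 : E n) 1 := ⟨q.1.2, by simpa using q.2.1⟩
  (((2 * Real.pi) ^ (-((n : ℝ) - 1) / 2) : ℝ) : ℂ) *
    ∫ x : (ℝ ∙ (ξ : E n))ᗮ,
      Complex.exp (-Complex.I * ((⟪q.1.1, (x : E n)⟫ : ℝ) : ℂ)) * φ (TS.mk ξ x) ∂(perpMeasure ξ)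

/-! ### Sobolev norms

All norms depend on a function only through its Fourier transform. The functionals
`weightedSq` and `weightedSqTS` take the Fourier transform as their argument. -/

/-- The weight `r^{2t} (1 + r²)^{s-t}`, as a function of `r = |y|`. -/
def weight (s t r : ℝ) : ℝ≥0∞ := ENNReal.ofReal (r ^ (2 * t) * (1 + r ^ 2) ^ (s - t))

/-- `∫_{ℝⁿ} |y|^{2t} (1 + |y|²)^{s-t} |v(y)|² dy`. -/
def weightedSq {n : ℕ} (s t : ℝ) (v : E n → ℂ) : ℝ≥0∞ :=
  ∫⁻ y : E n, weight s t ‖y‖ * ‖v y‖ₑ ^ 2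

/-- `(2π)⁻¹ ∫_{Sⁿ⁻¹} ∫_{ξ^⊥} |y|^{2t} (1 + |y|²)^{s-t} |v(y, ξ)|² dy dξ`. -/
def weightedSqTS {n : ℕ} (s t : ℝ) (v : TS n → ℂ) : ℝ≥0∞ :=
  ENNReal.ofReal (2 * Real.pi)⁻¹ *
    ∫⁻ ξ : Metric.sphere (0 : E n) 1, ∫⁻ y : (ℝ ∙ (ξ : E n))ᗮ,
      weight s t ‖(y : E n)‖ * ‖v (TS.mk ξ y)‖ₑ ^ 2 ∂(perpMeasure ξ) ∂(sphereMeasure n)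

/-- The squared norm `‖u‖²_{H^s_t(ℝⁿ)}`. -/
def normSq {n : ℕ} (s t : ℝ) (u : E n → ℂ) : ℝ≥0∞ := weightedSq s t (fourierRn u)

/-- The squared norm `‖φ‖²_{H^s_t(TSⁿ⁻¹)}`. -/
def normSqTS {n : ℕ} (s t : ℝ) (φ : TS n → ℂ) : ℝ≥0∞ := weightedSqTS s t (fourierTS φ)

/-! ### Operators on `TSⁿ⁻¹` -/

/-- The extension of a function on `TSⁿ⁻¹` to `ℝⁿ × (ℝⁿ \ {0})` along the retraction. -/
def extendTS {n : ℕ} (φ : TS n → ℂ) (p : E n × E n) : ℂ :=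
  open Classical in if h : p.2 ≠ 0 then φ (TS.proj p h) else 0

/-- The vector field
`Ξ̃ᵢ = ∂/∂ξⁱ - xᵢ ξᵖ ∂/∂xᵖ - ξᵢ ξᵖ ∂/∂ξᵖ`, written as a vector `(x-part, ξ-part)`. -/
def xiField {n : ℕ} (i : Fin n) (p : E n × E n) : E n × E n :=
  (-(p.1 i) • p.2, EuclideanSpace.single i (1 : ℝ) - (p.2 i) • p.2)

/-- The operator `Ξᵢ`. The field `Ξ̃ᵢ` is tangent to `TSⁿ⁻¹`, so that any smooth extension of
`φ` may be used. -/
def Xi {n : ℕ} (i : Fin n) (φ : TS n → ℂ) (q : TS n) : ℂ :=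
  fderiv ℝ (extendTS φ) q.1 (xiField i q.1)

/-- Multiplication by the coordinate `xᵢ`. -/
def mulX {n : ℕ} (i : Fin n) (φ : TS n → ℂ) (q : TS n) : ℂ := ((q.1.1 i : ℝ) : ℂ) * φ q

/-- The Fourier transform of `Zφ`, that is `(y, ξ) ↦ (yⁱ / |y|) (Ξᵢ φ̂)(y, ξ)`. The function `Zφ`
itself need not be integrable on `ξ^⊥`, so `Z` is given by its action on Fourier transforms. -/
def fourierZ {n : ℕ} (φ : TS n → ℂ) (q : TS n) : ℂ :=
  ∑ i : Fin n, ((q.1.1 i / ‖q.1.1‖ : ℝ) : ℂ) * Xi i (fourierTS φ) q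

/-- The squared norm `‖Zφ‖²_{H^s_t(TSⁿ⁻¹)}`. -/
def normSqZ {n : ℕ} (s t : ℝ) (φ : TS n → ℂ) : ℝ≥0∞ := weightedSqTS s t (fourierZ φ)

/-! ### Symmetric tensor fields of rank two and their momentum ray transforms -/

/-- The Schwartz space `𝒮(ℝⁿ; S²ℝⁿ)` of complex symmetric tensor fields of rank two. -/
structure SchwartzTensor (n : ℕ) where
  comp : Fin n → Fin n → 𝓢(E n, ℂ)
  symm : ∀ i j, comp i j = comp j i

/-- `(Iᵏf)(x, ξ) = ∫ tᵏ f_{ij}(x + tξ) ξⁱ ξʲ dt`. -/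
def rayTransform {n : ℕ} (k : ℕ) (f : SchwartzTensor n) (q : TS n) : ℂ :=
  ∫ τ : ℝ, ((τ ^ k : ℝ) : ℂ) *
    ∑ i, ∑ j, f.comp i j (q.1.1 + τ • q.1.2) * ((q.1.2 i * q.1.2 j : ℝ) : ℂ)

/-- `‖f‖²_{H^s_t(ℝⁿ; S²ℝⁿ)}` for a Schwartz field. -/
def SchwartzTensor.normSq {n : ℕ} (s t : ℝ) (f : SchwartzTensor n) : ℝ≥0∞ :=
  ∑ i, ∑ j, MomentumRay.normSq s t (f.comp i j)

/-- The sum of squared norms of the momentum data `(I⁰f, I¹f, I²f)` of a Schwartz field. -/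
def dataNormSq {n : ℕ} (s t : ℝ) (f : SchwartzTensor n) : ℝ≥0∞ :=
  normSqTS (s + 5 / 2) (t + 5 / 2) (rayTransform 2 f)
    + ∑ i, normSqTS (s + 3 / 2) (t + 3 / 2) (Xi i (rayTransform 1 f))
    + normSqTS (s + 3 / 2) (t + 3 / 2) (rayTransform 1 f)
    + normSqZ (s + 3 / 2) (t + 3 / 2) (rayTransform 1 f)
    + ∑ i, normSqTS (s + 3 / 2) (t + 3 / 2) (mulX i (rayTransform 0 f))
    + ∑ i, ∑ j, normSqTS (s + 1 / 2) (t + 1 / 2) (Xi i (Xi j (rayTransform 0 f)))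
    + normSqTS (s + 1 / 2) (t + 1 / 2) (rayTransform 0 f)
    + ∑ i, normSqTS (s + 1 / 2) (t + 1 / 2) (Xi i (rayTransform 0 f))

/-! ### The completed space -/

/-- The measure `|y|^{2t} (1 + |y|²)^{s-t} dy`. -/
def sobolevMeasure (n : ℕ) (s t : ℝ) : Measure (E n) :=
  volume.withDensity fun y => weight s t ‖y‖

/-- The space `H^s_t(ℝⁿ; S²ℝⁿ)`. For `t > -n/2` the Fourier transform identifies the completion
of the Schwartz space in the norm `H^s_t(ℝⁿ)` with the weighted `L²` space of
`sobolevMeasure n s t`; an element is given by the Fourier transforms of its components. -/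
structure SobolevTensor (n : ℕ) (s t : ℝ) where
  hat : Fin n → Fin n → Lp ℂ 2 (sobolevMeasure n s t)
  symm : ∀ i j, hat i j = hat j i

/-- `‖f‖²_{H^s_t(ℝⁿ; S²ℝⁿ)}`. -/
def SobolevTensor.normSq {n : ℕ} {s t : ℝ} (f : SobolevTensor n s t) : ℝ≥0∞ :=
  ∑ i, ∑ j, ‖f.hat i j‖ₑ ^ 2

/-- Convergence of a sequence of Schwartz fields to `f` in `H^s_t(ℝⁿ; S²ℝⁿ)`. -/
def ConvergesTo {n : ℕ} {s t : ℝ} (g : ℕ → SchwartzTensor n) (f : SobolevTensor n s t) : Prop :=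
  Tendsto (fun k => ∑ i, ∑ j,
    weightedSq s t (fun y => fourierRn ((g k).comp i j) y - f.hat i j y)) atTop (𝓝 0)

/-- The sum of squared norms of the momentum data of `f ∈ H^s_t(ℝⁿ; S²ℝⁿ)`. The momentum ray
transforms are extended from Schwartz fields by approximation: the value is the infimum of
`liminf dataNormSq (g k)` over all sequences of Schwartz fields `g k → f` in `H^s_t`, and it is
infinite when no sequence with bounded data converges to `f`. -/
def SobolevTensor.dataNormSq {n : ℕ} {s t : ℝ} (f : SobolevTensor n s t) : ℝ≥0∞ :=
  ⨅ (g : ℕ → SchwartzTensor n) (_ : ConvergesTo g f),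
    liminf (fun k => MomentumRay.dataNormSq s t (g k)) atTop

end MomentumRay

end

/-! Everything happens on the Fourier side. Let `Φ(y, ξ) = ∑ ξᵢ ξⱼ f̂ᵢⱼ(y)`, a smooth function on
all of `ℝⁿ × ℝⁿ` (`dataSymbol`). By the Fourier slice theorem (`fourierTS_ray`) the transform of
`I⁰f` is `√(2π) Φ` restricted to `y ⟂ ξ`. Along a line `t = ⟨z, ξ⟩`, so a further factor `t` becomes
`i` times the `y`-derivative in the direction `ξ` (`dirY`), which is transverse to `ξ^⊥`. The fields
`Ξᵢ` commute with the Fourier transform (`IsSymbol.fourSym_xiSymbol`), and `xᵢ` becomes a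
`y`-derivative tangent to `ξ^⊥`. Hence all the data are derivatives of `Φ` at points of `TSⁿ⁻¹`
(`dataNormSq_eq_tsInt`).

At such a point `∑ yₖ Ξₖ` is the derivative along `(-|y|² ξ, y)`. Adding `|y|²` times `dirY` leaves
the pure `ξ`-derivative along `y`, which polarizes the quadratic form: the result is `2 f̂(y, ξ)`
(`quadSym_recon_one`). The second-order version gives `2 f̂(y, y)` (`quadSym_recon_two`). After
division by powers of `|y|`, the components of `f̂(y)` on the pair `(y/|y|, ξ)` are bounded
pointwise by the data (`framePart_le_dataDensity`).

For fixed `y`, letting `ξ` range over unit vectors orthogonal to `y` recovers every entry of `f̂(y)`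
by polarization. Averaging over the orthogonal group makes this an integral inequality
(`lintegral_tensor_le`). The radial densities are `r^(n-1)` on `ℝⁿ` and `r^(n-2)` on the bundle; the
missing factor `r` is the shift of the Sobolev orders by `1/2`. The same weight stands on both
sides, so the constant depends on `n` only.

The data are finite because `Φ` and its derivatives decay rapidly in `y`, uniformly for `|ξ| = 1`,
while near `y = 0` the radial density is `r^(2t+n-1)`, integrable exactly when `t > -n/2`. The
estimate passes to the completion because the norm on the left is lower semicontinuous under `H^s_t`
convergence (`le_liminf_of_convergesTo`). -/

noncomputable section

namespace MomentumRay

variable {n : ℕ}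

/-! ### Integration over hyperplanes -/

section

/-- The unit sphere of `ℝⁿ`. -/
abbrev Sph (n : ℕ) := Metric.sphere (0 : E n) 1

instance (ξ : Sph n) : SigmaFinite (perpMeasure ξ) := by
  unfold perpMeasure; infer_instance

/-- The splitting of `ℝⁿ` into the hyperplane `ξ^⊥` and the line spanned by `ξ`. -/
def perpSplit (ξ : Sph n) : (ℝ ∙ (ξ : E n))ᗮ × ℝ → E n := fun p => (p.1 : E n) + p.2 • (ξ : E n)

lemma measurePreserving_perpSplit (ξ : Sph n) :
    MeasurePreserving (perpSplit ξ) ((perpMeasure ξ).prod volume) volume := by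
  have hξ : ‖(ξ : E n)‖ = 1 := by simp
  let _ : MeasureSpace (ℝ ∙ (ξ : E n))ᗮ := measureSpaceOfInnerProductSpace
  let _ : MeasureSpace (ℝ ∙ (ξ : E n)) := measureSpaceOfInnerProductSpace
  have h1 := (LinearIsometryEquiv.toSpanUnitSingleton (𝕜 := ℝ) (ξ : E n) hξ).measurePreserving
  have h2 := (ℝ ∙ (ξ : E n)).orthogonalDecomposition.symm.measurePreserving
  have h3 := WithLp.volume_preserving_toLp (ℝ ∙ (ξ : E n)) (ℝ ∙ (ξ : E n))ᗮ
  have h4 := h1.prod (MeasurePreserving.id (volume : Measure (ℝ ∙ (ξ : E n))ᗮ))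
  have h5 : MeasurePreserving Prod.swap ((perpMeasure ξ).prod (volume : Measure ℝ))
      ((volume : Measure ℝ).prod (volume : Measure (ℝ ∙ (ξ : E n))ᗮ)) :=
    Measure.measurePreserving_swap
  have h6 := (h2.comp h3).comp (h4.comp h5)
  convert! h6 using 1
  ext1 p
  simp [perpSplit, add_comm]

lemma lintegral_perpSplit (ξ : Sph n) {h : E n → ℝ≥0∞} (hh : Measurable h) :
    ∫⁻ z, h z = ∫⁻ y, ∫⁻ τ : ℝ, h ((y : E n) + τ • (ξ : E n)) ∂(volume) ∂(perpMeasure ξ) := by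
  rw [← (measurePreserving_perpSplit ξ).lintegral_comp hh, lintegral_prod]
  · rfl
  · exact (hh.comp (measurePreserving_perpSplit ξ).measurable).aemeasurable

lemma measurableEmbedding_perpSplit (ξ : Sph n) : MeasurableEmbedding (perpSplit ξ) := by
  have hξ : ‖(ξ : E n)‖ = 1 := by simp
  refine (measurePreserving_perpSplit ξ).measurable.measurableEmbedding ?_
  rintro ⟨y, a⟩ ⟨z, b⟩ h
  have hy := Submodule.mem_orthogonal_singleton_iff_inner_right.mp y.2
  have hz := Submodule.mem_orthogonal_singleton_iff_inner_right.mp z.2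
  have h' : (y : E n) + a • (ξ : E n) = z + b • (ξ : E n) := h
  have hab : a = b := by
    have := congrArg (fun v => ⟪(ξ : E n), v⟫) h'
    simpa [inner_add_right, inner_smul_right, hy, hz, hξ] using this
  subst hab
  simpa using h'

lemma integral_perpSplit (ξ : Sph n) {g : E n → ℂ} (hg : Integrable g) :
    ∫ y, ∫ τ : ℝ, g ((y : E n) + τ • (ξ : E n)) ∂(volume) ∂(perpMeasure ξ) = ∫ z, g z := by
  have h := measurePreserving_perpSplit ξ
  rw [← h.integral_comp (measurableEmbedding_perpSplit ξ), integral_prod]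
  · rfl
  · exact (h.integrable_comp_emb (measurableEmbedding_perpSplit ξ)).2 hg

/-- The integral over `ξ^⊥` of a function of `(y, ξ)`, written as an integral over `ℝⁿ`. -/
def perpInt (h : E n × E n → ℝ≥0∞) (ξ : E n) : ℝ≥0∞ :=
  ∫⁻ z : E n, (Set.Ico (0 : ℝ) 1).indicator 1 ⟪z, ξ⟫ * h (z - ⟪z, ξ⟫ • ξ, ξ)

lemma measurable_perpInt {h : E n × E n → ℝ≥0∞} (hh : Measurable h) : Measurable (perpInt h) := by
  unfold perpInt
  apply Measurable.lintegral_prod_right' (f := fun p : E n × E n =>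
    (Set.Ico (0 : ℝ) 1).indicator 1 ⟪p.2, p.1⟫ * h (p.2 - ⟪p.2, p.1⟫ • p.1, p.1))
  refine Measurable.mul ?_ ?_
  · exact (measurable_one.indicator measurableSet_Ico).comp (by fun_prop)
  · exact hh.comp (by fun_prop)

/-- The domain `ξ^⊥` varies with `ξ`, which obscures measurability in `ξ`. Thickening the hyperplane
to the slab `0 ≤ ⟨z, ξ⟩ < 1` of unit width replaces it by the fixed domain `ℝⁿ`. -/
lemma lintegral_perp_eq_perpInt {h : E n × E n → ℝ≥0∞} (hh : Measurable h) (ξ : Sph n) :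
    ∫⁻ y : (ℝ ∙ (ξ : E n))ᗮ, h ((y : E n), (ξ : E n)) ∂(perpMeasure ξ) = perpInt h ξ := by
  have hξ : ‖(ξ : E n)‖ = 1 := by simp
  unfold perpInt
  rw [lintegral_perpSplit ξ]
  · refine lintegral_congr fun y => ?_
    have hy : ⟪(y : E n), (ξ : E n)⟫ = 0 := by
      rw [real_inner_comm]; exact Submodule.mem_orthogonal_singleton_iff_inner_right.mp y.2
    simp only [inner_add_left, inner_smul_left, hy, real_inner_self_eq_norm_sq, hξ]
    simp only [conj_trivial, one_pow, mul_one, zero_add, add_sub_cancel_right]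
    rw [lintegral_mul_const _ (measurable_one.indicator measurableSet_Ico),
      lintegral_indicator measurableSet_Ico]
    simp
  · refine Measurable.mul ?_ ?_
    · exact (measurable_one.indicator measurableSet_Ico).comp (by fun_prop)
    · exact hh.comp (by fun_prop)

end

/-! ### Averages over the orthogonal group -/

section

/-- The orthogonal group of `ℝⁿ`. -/
abbrev Rot (n : ℕ) : Type := ↥(unitary (E n →L[ℝ] E n))

instance : ContinuousStar (E n →L[ℝ] E n) :=
  ⟨(ContinuousLinearMap.adjoint (𝕜 := ℝ) (E := E n) (F := E n)).continuous⟩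

instance : MeasurableSpace (Rot n) := borel _
instance : BorelSpace (Rot n) := ⟨rfl⟩

lemma Rot.norm_map (A : Rot n) (x : E n) : ‖(A : E n →L[ℝ] E n) x‖ = ‖x‖ :=
  (Unitary.linearIsometryEquiv A).norm_map x

lemma Rot.inner_map (A : Rot n) (x y : E n) :
    ⟪(A : E n →L[ℝ] E n) x, (A : E n →L[ℝ] E n) y⟫ = ⟪x, y⟫ :=
  (Unitary.linearIsometryEquiv A).inner_map_map x y

instance : CompactSpace (Rot n) := by
  suffices h : IsCompact (unitary (E n →L[ℝ] E n) : Set (E n →L[ℝ] E n)) from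
    isCompact_iff_compactSpace.mp h
  refine Metric.isCompact_of_isClosed_isBounded isClosed_unitary ?_
  refine (Metric.isBounded_closedBall (x := (0 : E n →L[ℝ] E n)) (r := 1)).subset fun A hA => ?_
  rw [mem_closedBall_zero_iff]
  exact ContinuousLinearMap.opNorm_le_bound _ zero_le_one fun x => by
    rw [one_mul]; exact (Rot.norm_map ⟨A, hA⟩ x).le

/-- The right invariant probability measure on the orthogonal group. -/
def rotMeasure (n : ℕ) : Measure (Rot n) := (Measure.haarMeasure ⊤).inv

instance : (rotMeasure n).IsMulRightInvariant := by unfold rotMeasure; infer_instance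

instance : IsProbabilityMeasure (rotMeasure n) := ⟨by
  rw [rotMeasure, Measure.inv_apply, Set.inv_univ]
  exact Measure.haarMeasure_self (K₀ := (⊤ : TopologicalSpace.PositiveCompacts (Rot n)))⟩

lemma measurable_rot_apply : Measurable fun p : Rot n × E n => (p.1 : E n →L[ℝ] E n) p.2 := by
  have : Continuous fun p : Rot n × E n => (p.1 : E n →L[ℝ] E n) p.2 := by fun_prop
  exact this.measurable

/-- The reflection in the hyperplane `(u - v)^⊥` exchanges vectors of equal length and fixes
everything orthogonal to `u - v`. -/
lemma exists_rot_map {u v : E n} (h : ‖u‖ = ‖v‖) :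
    ∃ B : Rot n, (B : E n →L[ℝ] E n) u = v ∧
      ∀ x, ⟪x, u⟫ = ⟪x, v⟫ → (B : E n →L[ℝ] E n) x = x := by
  refine ⟨Unitary.linearIsometryEquiv.symm (Submodule.reflection (ℝ ∙ (u - v))ᗮ), ?_, fun x hx => ?_⟩
  · simpa using Submodule.reflection_sub h
  · simp only [Unitary.coe_symm_linearIsometryEquiv_apply]
    refine Submodule.reflection_mem_subspace_eq_self ?_
    rw [Submodule.mem_orthogonal_singleton_iff_inner_left, inner_sub_right, hx, sub_self]

/-- The average of `h (A u, A w)` over the orthogonal group. -/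
def rotAvg (h : E n × E n → ℝ≥0∞) (u w : E n) : ℝ≥0∞ :=
  ∫⁻ A : Rot n, h ((A : E n →L[ℝ] E n) u, (A : E n →L[ℝ] E n) w) ∂(rotMeasure n)

lemma rotAvg_map (h : E n × E n → ℝ≥0∞) (u w : E n) (B : Rot n) :
    rotAvg h ((B : E n →L[ℝ] E n) u) ((B : E n →L[ℝ] E n) w) = rotAvg h u w := by
  unfold rotAvg
  exact lintegral_mul_right_eq_self (μ := rotMeasure n) (fun A : Rot n =>
    h ((A : E n →L[ℝ] E n) u, (A : E n →L[ℝ] E n) w)) B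

/-- The orthogonal group is transitive on orthogonal pairs with prescribed lengths. One reflection
takes `u` to `u'`; a second corrects the other vector and fixes `u'`, because both candidates are
orthogonal to it. -/
lemma rotAvg_congr (h : E n × E n → ℝ≥0∞) {u w u' w' : E n} (hu : ‖u‖ = ‖u'‖) (hw : ‖w‖ = ‖w'‖)
    (huw : ⟪u, w⟫ = 0) (huw' : ⟪u', w'⟫ = 0) : rotAvg h u w = rotAvg h u' w' := by
  obtain ⟨B, hB, -⟩ := exists_rot_map hu
  obtain ⟨C, hC, hC'⟩ := exists_rot_map (u := (B : E n →L[ℝ] E n) w) (v := w')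
    (by rw [Rot.norm_map, hw])
  rw [← rotAvg_map h u w B, ← rotAvg_map h _ _ C, hC, hB, hC']
  rw [huw', ← hB, Rot.inner_map, huw]

lemma measurable_rotAvg {h : E n × E n → ℝ≥0∞} (hh : Measurable h) :
    Measurable fun p : E n × E n => rotAvg h p.1 p.2 := by
  unfold rotAvg
  refine Measurable.lintegral_prod_right' (f := fun p : (E n × E n) × Rot n =>
    h ((p.2 : E n →L[ℝ] E n) p.1.1, (p.2 : E n →L[ℝ] E n) p.1.2)) ?_
  refine hh.comp (Measurable.prodMk ?_ ?_)
  · exact measurable_rot_apply.comp (f := fun p : (E n × E n) × Rot n => (p.2, p.1.1)) (by fun_prop)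
  · exact measurable_rot_apply.comp (f := fun p : (E n × E n) × Rot n => (p.2, p.1.2)) (by fun_prop)

/-- The action of the orthogonal group on the unit sphere. -/
def Rot.onSphere (A : Rot n) (ξ : Sph n) : Sph n :=
  ⟨(A : E n →L[ℝ] E n) ξ, by simp [Rot.norm_map]⟩

lemma Rot.inv_apply_self (A : Rot n) (x : E n) :
    ((A⁻¹ : Rot n) : E n →L[ℝ] E n) ((A : E n →L[ℝ] E n) x) = x :=
  (Unitary.linearIsometryEquiv A).symm_apply_apply x

lemma Rot.apply_inv_self (A : Rot n) (x : E n) :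
    (A : E n →L[ℝ] E n) (((A⁻¹ : Rot n) : E n →L[ℝ] E n) x) = x :=
  (Unitary.linearIsometryEquiv A).apply_symm_apply x

lemma Rot.measurePreserving (A : Rot n) :
    MeasurePreserving (A : E n →L[ℝ] E n) :=
  (Unitary.linearIsometryEquiv A).measurePreserving

open scoped Pointwise in
lemma Rot.measurePreserving_onSphere (A : Rot n) :
    MeasurePreserving A.onSphere (sphereMeasure n) (sphereMeasure n) := by
  have hm : Measurable A.onSphere := by
    have : Continuous A.onSphere := by unfold Rot.onSphere; fun_prop
    exact this.measurable
  refine ⟨hm, Measure.ext fun s hs => ?_⟩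
  rw [Measure.map_apply hm hs, sphereMeasure, Measure.toSphere_apply' _ hs,
    Measure.toSphere_apply' _ (hm hs)]
  congr 1
  rw [← (Unitary.linearIsometryEquiv A).measurePreserving.measure_preimage_equiv
    (f := (Unitary.linearIsometryEquiv A).toHomeomorph.toMeasurableEquiv)
    (Set.Ioo (0 : ℝ) 1 • ((Subtype.val : Sph n → E n) '' s))]
  congr 1
  ext x
  change _ ↔ (A : E n →L[ℝ] E n) x ∈ Set.Ioo (0 : ℝ) 1 • ((Subtype.val : Sph n → E n) '' s)
  simp only [Set.mem_smul, Set.mem_image, Set.mem_preimage, Subtype.exists]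
  constructor
  · rintro ⟨r, hr, _, ⟨ξ, hξ, hs, rfl⟩, rfl⟩
    exact ⟨r, hr, _, ⟨(A : E n →L[ℝ] E n) ξ,
      (A.onSphere ⟨ξ, hξ⟩).2, hs, rfl⟩, (map_smul (A : E n →L[ℝ] E n) r ξ).symm⟩
  · rintro ⟨r, hr, _, ⟨ξ, hξ, hs, rfl⟩, hx⟩
    refine ⟨r, hr, _, ⟨((A⁻¹ : Rot n) : E n →L[ℝ] E n) ξ, ?_, ?_, rfl⟩, ?_⟩
    · simpa [Rot.norm_map] using hξ
    · have : A.onSphere ⟨((A⁻¹ : Rot n) : E n →L[ℝ] E n) ξ, by simpa [Rot.norm_map] using hξ⟩ =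
        ⟨ξ, hξ⟩ := Subtype.ext (A.apply_inv_self ξ)
      rw [this]; exact hs
    · have h2 := congrArg ((A⁻¹ : Rot n) : E n →L[ℝ] E n) hx
      rw [map_smul] at h2
      rw [h2]; exact A.inv_apply_self x

lemma lintegral_rot_apply_const (g : E n → ℝ≥0∞) {u v : E n} (h : ‖u‖ = ‖v‖) :
    ∫⁻ A : Rot n, g ((A : E n →L[ℝ] E n) u) ∂(rotMeasure n) =
      ∫⁻ A : Rot n, g ((A : E n →L[ℝ] E n) v) ∂(rotMeasure n) := by
  obtain ⟨B, hB, -⟩ := exists_rot_map h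
  rw [← hB]
  exact (lintegral_mul_right_eq_self (μ := rotMeasure n) (fun A : Rot n =>
    g ((A : E n →L[ℝ] E n) u)) B).symm

/-- Averaging the integral over all rotations changes nothing, by invariance of the surface measure.
After Tonelli the inner average no longer depends on the point of the sphere. -/
lemma lintegral_sphere_eq_rot {k : E n → ℝ≥0∞} (hk : Measurable k) (w : Sph n) :
    ∫⁻ ξ : Sph n, k ξ ∂(sphereMeasure n) =
      sphereMeasure n Set.univ * ∫⁻ A : Rot n, k ((A : E n →L[ℝ] E n) w) ∂(rotMeasure n) := by
  have hfin : IsFiniteMeasure (sphereMeasure n) := by unfold sphereMeasure; infer_instance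
  calc ∫⁻ ξ : Sph n, k ξ ∂(sphereMeasure n)
      = ∫⁻ A : Rot n, ∫⁻ ξ : Sph n, k ((A : E n →L[ℝ] E n) ξ) ∂(sphereMeasure n)
          ∂(rotMeasure n) := by
        have h (A : Rot n) : ∫⁻ ξ : Sph n, k ((A : E n →L[ℝ] E n) ξ) ∂(sphereMeasure n) =
            ∫⁻ ξ : Sph n, k ξ ∂(sphereMeasure n) :=
          (Rot.measurePreserving_onSphere A).lintegral_comp (f := fun ξ : Sph n => k ξ)
            (hk.comp measurable_subtype_coe)
        simp_rw [h, lintegral_const, measure_univ, mul_one]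
    _ = ∫⁻ ξ : Sph n, ∫⁻ A : Rot n, k ((A : E n →L[ℝ] E n) ξ) ∂(rotMeasure n)
          ∂(sphereMeasure n) := by
        rw [lintegral_lintegral_swap]
        refine Measurable.aemeasurable (hk.comp (measurable_rot_apply.comp
          (f := fun p : Rot n × Sph n => (p.1, (p.2 : E n))) (by fun_prop)))
    _ = ∫⁻ _ : Sph n, ∫⁻ A : Rot n, k ((A : E n →L[ℝ] E n) w) ∂(rotMeasure n)
          ∂(sphereMeasure n) := by
        refine lintegral_congr fun ξ => lintegral_rot_apply_const k (by simp)
    _ = _ := by rw [lintegral_const, mul_comm]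

lemma lintegral_eq_lintegral_rot {g : E n → ℝ≥0∞} (hg : Measurable g) :
    ∫⁻ y, g y = ∫⁻ y, ∫⁻ A : Rot n, g ((A : E n →L[ℝ] E n) y) ∂(rotMeasure n) := by
  rw [lintegral_lintegral_swap]
  · calc ∫⁻ y, g y = ∫⁻ _ : Rot n, (∫⁻ y, g y) ∂(rotMeasure n) := by simp
      _ = _ := lintegral_congr fun A => (A.measurePreserving.lintegral_comp hg).symm
  · exact Measurable.aemeasurable (hg.comp (measurable_rot_apply.comp
          (f := fun p : E n × Rot n => (p.2, p.1)) (by fun_prop)))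

/-- The substitution `z ↦ A z` carries the slab around `w^⊥` to the one around `(A w)^⊥`, so the
rotation acts on the integrand alone. -/
lemma lintegral_rot_perpInt {h : E n × E n → ℝ≥0∞} (hh : Measurable h) (w : Sph n) :
    ∫⁻ A : Rot n, perpInt h ((A : E n →L[ℝ] E n) w) ∂(rotMeasure n) =
      perpInt (fun p => rotAvg h p.1 p.2) w := by
  have hσ : Measurable ((Set.Ico (0 : ℝ) 1).indicator (1 : ℝ → ℝ≥0∞)) :=
    measurable_one.indicator measurableSet_Ico
  have h1 : ∀ A : Rot n, perpInt h ((A : E n →L[ℝ] E n) w) =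
      ∫⁻ z : E n, (Set.Ico (0 : ℝ) 1).indicator 1 ⟪z, (w : E n)⟫ *
        h ((A : E n →L[ℝ] E n) (z - ⟪z, (w : E n)⟫ • (w : E n)), (A : E n →L[ℝ] E n) w) := by
    intro A
    unfold perpInt
    rw [← A.measurePreserving.lintegral_comp]
    · refine lintegral_congr fun z => ?_
      rw [A.inner_map, map_sub, map_smul]
    · exact (hσ.comp (by fun_prop)).mul (hh.comp (by fun_prop))
  simp_rw [h1]
  rw [lintegral_lintegral_swap]
  · unfold perpInt rotAvg
    refine lintegral_congr fun z => ?_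
    rw [lintegral_const_mul]
    refine hh.comp (Measurable.prodMk ?_ ?_)
    · exact measurable_rot_apply.comp (f := fun p : Rot n => (p, _)) (by fun_prop)
    · exact measurable_rot_apply.comp (f := fun p : Rot n => (p, _)) (by fun_prop)
  · refine Measurable.aemeasurable ((hσ.comp (by fun_prop)).mul (hh.comp (Measurable.prodMk ?_ ?_)))
    · exact measurable_rot_apply.comp
        (f := fun p : Rot n × E n => (p.1, p.2 - ⟪p.2, (w : E n)⟫ • (w : E n))) (by fun_prop)
    · exact measurable_rot_apply.comp (f := fun p : Rot n × E n => (p.1, (w : E n))) (by fun_prop)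

lemma lintegral_norm_addHaar {V : Type*} [NormedAddCommGroup V] [NormedSpace ℝ V]
    [FiniteDimensional ℝ V] [MeasurableSpace V] [BorelSpace V] [Nontrivial V]
    (μ : Measure V) [μ.IsAddHaarMeasure] {f : ℝ → ℝ≥0∞} (hf : Measurable f) :
    ∫⁻ x, f ‖x‖ ∂μ = μ.toSphere Set.univ *
      ∫⁻ r in Set.Ioi (0 : ℝ), ENNReal.ofReal (r ^ (Module.finrank ℝ V - 1)) * f r := by
  calc ∫⁻ x, f ‖x‖ ∂μ = ∫⁻ x : ({(0)}ᶜ : Set V), f ‖x.1‖ ∂(μ.comap (↑)) := by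
        rw [lintegral_subtype_comap (measurableSet_singleton _).compl fun x ↦ f (‖x‖),
          restrict_compl_singleton]
    _ = ∫⁻ x, f x.2 ∂μ.toSphere.prod (.volumeIoiPow (Module.finrank ℝ V - 1)) := by
        have hm : Measurable fun x : Metric.sphere (0 : V) 1 × Set.Ioi (0 : ℝ) => f x.2 :=
          hf.comp (measurable_subtype_coe.comp measurable_snd)
        rw [← μ.measurePreserving_homeomorphUnitSphereProd.lintegral_comp hm]
        simp
    _ = μ.toSphere Set.univ *
        ∫⁻ x : Set.Ioi (0 : ℝ), f x ∂.volumeIoiPow (Module.finrank ℝ V - 1) := by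
        have hm : Measurable fun x : Metric.sphere (0 : V) 1 × Set.Ioi (0 : ℝ) => f x.2 :=
          hf.comp (measurable_subtype_coe.comp measurable_snd)
        rw [lintegral_prod _ hm.aemeasurable]
        simp [mul_comm]
    _ = _ := by
        have hm : Measurable fun x : Set.Ioi (0 : ℝ) => f x := hf.comp measurable_subtype_coe
        rw [Measure.volumeIoiPow, lintegral_withDensity_eq_lintegral_mul _ (by fun_prop) hm]
        simp only [Pi.mul_apply]
        rw [lintegral_subtype_comap measurableSet_Ioi
          (fun x : ℝ => ENNReal.ofReal (x ^ (Module.finrank ℝ V - 1)) * f x)]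

end

/-! ### Frames and weighted norms of tensor fields -/

section

/-- The total mass of the surface measure of the unit sphere of `ξ^⊥`. -/
def perpSphereMass (ξ : Sph n) : ℝ≥0∞ := (perpMeasure ξ).toSphere Set.univ

instance (ξ : Sph n) : (perpMeasure ξ).IsAddHaarMeasure := by
  unfold perpMeasure; infer_instance

lemma finrank_perp (ξ : Sph n) : Module.finrank ℝ (ℝ ∙ (ξ : E n))ᗮ = n - 1 := by
  have hξ : (ξ : E n) ≠ 0 := by
    intro h
    have : ‖(ξ : E n)‖ = 1 := by simp
    rw [h] at this; simp at this
  have h := (ℝ ∙ (ξ : E n)).finrank_add_finrank_orthogonal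
  rw [finrank_span_singleton hξ, finrank_euclideanSpace_fin] at h
  omega

lemma nontrivial_perp (hn : 2 ≤ n) (ξ : Sph n) : Nontrivial (ℝ ∙ (ξ : E n))ᗮ :=
  Module.nontrivial_of_finrank_pos (R := ℝ) (by rw [finrank_perp]; omega)

lemma perpSphereMass_ne_zero (hn : 2 ≤ n) (ξ : Sph n) : perpSphereMass ξ ≠ 0 := by
  have := nontrivial_perp hn ξ
  unfold perpSphereMass
  rw [Ne, Measure.measure_univ_eq_zero]
  exact Measure.toSphere_ne_zero _

lemma perpSphereMass_ne_top (ξ : Sph n) : perpSphereMass ξ ≠ ∞ := measure_ne_top _ _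

lemma sphereMeasure_univ_ne_top : sphereMeasure n Set.univ ≠ ∞ := by
  unfold sphereMeasure; exact measure_ne_top _ _

lemma lintegral_perp_norm (hn : 2 ≤ n) (ξ : Sph n) {f : ℝ → ℝ≥0∞} (hf : Measurable f) :
    ∫⁻ y : (ℝ ∙ (ξ : E n))ᗮ, f ‖(y : E n)‖ ∂(perpMeasure ξ) =
      perpSphereMass ξ * ∫⁻ r in Set.Ioi (0 : ℝ), ENNReal.ofReal (r ^ (n - 2)) * f r := by
  have := nontrivial_perp hn ξ
  have h := lintegral_norm_addHaar (perpMeasure ξ) hf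
  rw [finrank_perp, Nat.sub_sub] at h
  exact h

/-- Polar coordinates on the bundle of pairs `y ⟂ ξ`. -/
lemma lintegral_sphere_perp (hn : 2 ≤ n) {h : E n × E n → ℝ≥0∞} (hh : Measurable h)
    (u w : Sph n) (huw : ⟪(u : E n), (w : E n)⟫ = 0) :
    ∫⁻ ξ : Sph n, ∫⁻ y : (ℝ ∙ (ξ : E n))ᗮ, h ((y : E n), (ξ : E n)) ∂(perpMeasure ξ)
      ∂(sphereMeasure n) =
    sphereMeasure n Set.univ * (perpSphereMass w * ∫⁻ r in Set.Ioi (0 : ℝ),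
      ENNReal.ofReal (r ^ (n - 2)) * rotAvg h (r • (u : E n)) w) := by
  have hm : Measurable fun r : ℝ => rotAvg h (r • (u : E n)) w :=
    (measurable_rotAvg hh).comp (f := fun r : ℝ => (r • (u : E n), (w : E n))) (by fun_prop)
  simp_rw [lintegral_perp_eq_perpInt hh]
  -- The outer integral becomes a rotation average at `w`, which moves inside. The average is then a
  -- radial function on `w^⊥`, so only polar coordinates on one hyperplane are needed.
  rw [lintegral_sphere_eq_rot (measurable_perpInt hh) w, lintegral_rot_perpInt hh,
    ← lintegral_perp_eq_perpInt (measurable_rotAvg hh), ← lintegral_perp_norm hn w hm]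
  congr 1
  refine lintegral_congr fun y => rotAvg_congr h ?_ rfl ?_ ?_
  · simp [norm_smul]
  · rw [real_inner_comm]; exact Submodule.mem_orthogonal_singleton_iff_inner_right.mp y.2
  · rw [inner_smul_left, huw, mul_zero]

lemma lintegral_polar (hn : 2 ≤ n) {g : E n → ℝ≥0∞} (hg : Measurable g) (u w : Sph n) :
    ∫⁻ y, g y = sphereMeasure n Set.univ * ∫⁻ r in Set.Ioi (0 : ℝ),
      ENNReal.ofReal (r ^ (n - 1)) * rotAvg (fun p => g p.1) (r • (u : E n)) w := by
  have : Nontrivial (E n) :=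
    Module.nontrivial_of_finrank_pos (R := ℝ) (by rw [finrank_euclideanSpace_fin]; omega)
  have hm : Measurable fun r : ℝ => rotAvg (fun p => g p.1) (r • (u : E n)) w :=
    (measurable_rotAvg (hg.comp measurable_fst)).comp
      (f := fun r : ℝ => (r • (u : E n), (w : E n))) (by fun_prop)
  have h := lintegral_norm_addHaar (volume : Measure (E n)) hm
  rw [finrank_euclideanSpace_fin] at h
  rw [sphereMeasure, ← h, lintegral_eq_lintegral_rot hg]
  refine lintegral_congr fun y => ?_
  exact lintegral_rot_apply_const g (by simp [norm_smul])

/-- The bilinear form `∑ Mᵢⱼ aᵢ bⱼ`. -/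
def bil (M : Fin n → Fin n → ℂ) (a b : E n) : ℂ := ∑ i, ∑ j, ((a i * b j : ℝ) : ℂ) * M i j

/-- Parseval for a real orthonormal basis, applied to the real and imaginary parts of `c`. -/
lemma sum_norm_sq_orthonormal (b : OrthonormalBasis (Fin n) ℝ (E n)) (c : Fin n → ℂ) :
    ∑ k, ‖∑ i, ((b k i : ℝ) : ℂ) * c i‖ ^ 2 = ∑ i, ‖c i‖ ^ 2 := by
  have key (v : Fin n → ℝ) : ∑ k, (∑ i, b k i * v i) ^ 2 = ∑ i, v i ^ 2 := by
    have h := b.sum_sq_norm_inner_right (WithLp.toLp 2 v)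
    rw [EuclideanSpace.norm_sq_eq] at h
    simpa [PiLp.inner_apply, mul_comm] using h
  have h1 := key fun i => (c i).re
  have h2 := key fun i => (c i).im
  simp only [← Complex.normSq_eq_norm_sq, Complex.normSq_apply, Finset.sum_add_distrib, ← pow_two]
  rw [← h1, ← h2]
  simp

/-- The Hilbert–Schmidt norm does not depend on the orthonormal basis; Parseval is used once in each
index. -/
lemma sum_norm_sq_bil (b : OrthonormalBasis (Fin n) ℝ (E n)) (M : Fin n → Fin n → ℂ) :
    ∑ k, ∑ l, ‖bil M (b k) (b l)‖ ^ 2 = ∑ i, ∑ j, ‖M i j‖ ^ 2 := by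
  have h1 (k l) : bil M (b k) (b l) = ∑ j, ((b l j : ℝ) : ℂ) * ∑ i, ((b k i : ℝ) : ℂ) * M i j := by
    unfold bil
    rw [Finset.sum_comm]
    refine Finset.sum_congr rfl fun j _ => ?_
    rw [Finset.mul_sum]
    refine Finset.sum_congr rfl fun i _ => ?_
    push_cast; ring
  simp_rw [h1, sum_norm_sq_orthonormal b]
  rw [Finset.sum_comm]
  simp_rw [sum_norm_sq_orthonormal b]
  rw [Finset.sum_comm]

lemma bil_add_left (M : Fin n → Fin n → ℂ) (a a' b : E n) :
    bil M (a + a') b = bil M a b + bil M a' b := by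
  simp only [bil, ← Finset.sum_add_distrib]
  refine Finset.sum_congr rfl fun i _ => Finset.sum_congr rfl fun j _ => ?_
  simp only [PiLp.add_apply]; push_cast; ring

lemma bil_smul_left (M : Fin n → Fin n → ℂ) (c : ℝ) (a b : E n) :
    bil M (c • a) b = c * bil M a b := by
  simp only [bil, Finset.mul_sum]
  refine Finset.sum_congr rfl fun i _ => Finset.sum_congr rfl fun j _ => ?_
  simp only [PiLp.smul_apply, smul_eq_mul]; push_cast; ring

lemma bil_comm {M : Fin n → Fin n → ℂ} (hM : ∀ i j, M i j = M j i) (a b : E n) :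
    bil M a b = bil M b a := by
  unfold bil
  rw [Finset.sum_comm]
  refine Finset.sum_congr rfl fun i _ => Finset.sum_congr rfl fun j _ => ?_
  rw [hM j i, mul_comm (a j)]

/-- The part of a quadratic form seen from a pair of orthonormal vectors. -/
def framePart (M : Fin n → Fin n → ℂ) (a b : E n) : ℝ :=
  ‖bil M a a‖ ^ 2 + ‖bil M a b‖ ^ 2 + ‖bil M b b‖ ^ 2

lemma framePart_nonneg (M : Fin n → Fin n → ℂ) (a b : E n) : 0 ≤ framePart M a b := by
  unfold framePart; positivity

/-- Polarization with the unit-normalized sum: for `c = (a + b)/√2`, `M(a, b) = M(c, c) - M(a, a)/2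
- M(b, b)/2`. The vector `v` only pads the right-hand side with nonnegative terms, and the factor
`4` is generous. -/
lemma norm_sq_bil_polar_le {M : Fin n → Fin n → ℂ} (hM : ∀ i j, M i j = M j i) (v a b : E n) :
    ‖bil M a b‖ ^ 2 ≤ 4 * (framePart M v a + framePart M v b +
      framePart M v ((Real.sqrt 2)⁻¹ • (a + b))) := by
  set x := bil M ((Real.sqrt 2)⁻¹ • (a + b)) ((Real.sqrt 2)⁻¹ • (a + b)) with hx
  have hs : ((Real.sqrt 2)⁻¹ * (Real.sqrt 2)⁻¹ : ℝ) = 1 / 2 := by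
    rw [← mul_inv, Real.mul_self_sqrt (by norm_num)]; norm_num
  have hs' : (((Real.sqrt 2)⁻¹ : ℝ) : ℂ) * (((Real.sqrt 2)⁻¹ : ℝ) : ℂ) = 1 / 2 := by
    rw [← Complex.ofReal_mul, hs]; norm_num
  have h1 : bil M a b = x - 1 / 2 * bil M a a - 1 / 2 * bil M b b := by
    rw [hx, bil_smul_left, bil_comm hM _ (_ • _), bil_smul_left, ← mul_assoc, hs', bil_add_left,
      bil_comm hM a (a + b), bil_comm hM b (a + b), bil_add_left, bil_add_left, bil_comm hM b a]
    ring
  have h2 : ‖bil M a b‖ ≤ ‖x‖ + 1 / 2 * ‖bil M a a‖ + 1 / 2 * ‖bil M b b‖ := by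
    rw [h1]
    refine (norm_sub_le _ _).trans (add_le_add ((norm_sub_le _ _).trans_eq ?_) (le_of_eq ?_)) <;>
      simp
  have h3 : ‖bil M a b‖ ^ 2 ≤ (‖x‖ + 1 / 2 * ‖bil M a a‖ + 1 / 2 * ‖bil M b b‖) ^ 2 := by gcongr
  unfold framePart
  rw [← hx]
  nlinarith [sq_nonneg (‖x‖ - ‖bil M a a‖), sq_nonneg (‖x‖ - ‖bil M b b‖),
    sq_nonneg (‖bil M b b‖ - ‖bil M a a‖), sq_nonneg ‖bil M v v‖, sq_nonneg ‖bil M v a‖,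
    sq_nonneg ‖bil M v b‖, sq_nonneg ‖bil M v ((Real.sqrt 2)⁻¹ • (a + b))‖]

/-- Every entry of a symmetric form in an orthonormal basis is controlled by three of its frame
parts. -/
lemma exists_frames (k₀ k₁ : Fin n) (h01 : k₀ ≠ k₁) (k l : Fin n) :
    ∃ w : Fin 3 → E n, (∀ m, ‖w m‖ = 1 ∧ ⟪EuclideanSpace.single k₀ (1 : ℝ), w m⟫ = 0) ∧
      ∀ (A : Rot n) (M : Fin n → Fin n → ℂ), (∀ i j, M i j = M j i) →
        ‖bil M ((A : E n →L[ℝ] E n) (EuclideanSpace.single k 1))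
          ((A : E n →L[ℝ] E n) (EuclideanSpace.single l 1))‖ ^ 2 ≤
        4 * ∑ m, framePart M ((A : E n →L[ℝ] E n) (EuclideanSpace.single k₀ 1))
          ((A : E n →L[ℝ] E n) (w m)) := by
  set e : Fin n → E n := fun k => EuclideanSpace.single k (1 : ℝ) with he
  have hne (k) : ‖e k‖ = 1 := by simp [he]
  have hin (k l) (h : k ≠ l) : ⟪e k, e l⟫ = 0 := by
    simp [he, EuclideanSpace.inner_single_left, h]
  have key (M : Fin n → Fin n → ℂ) (a b : E n) :
      ‖bil M a a‖ ^ 2 ≤ 4 * ∑ _m : Fin 3, framePart M a b ∧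
      ‖bil M a b‖ ^ 2 ≤ 4 * ∑ _m : Fin 3, framePart M a b ∧
      ‖bil M b b‖ ^ 2 ≤ 4 * ∑ _m : Fin 3, framePart M a b := by
    simp only [Finset.sum_const, Finset.card_univ, Fintype.card_fin, framePart, nsmul_eq_mul]
    push_cast
    have h1 := sq_nonneg ‖bil M a a‖
    have h2 := sq_nonneg ‖bil M a b‖
    have h3 := sq_nonneg ‖bil M b b‖
    exact ⟨by linarith, by linarith, by linarith⟩
  -- The vector `e k₀` plays the role of `y/|y|`. An entry involving it, or a diagonal entry, is
  -- read off a single frame; an off-diagonal entry orthogonal to it needs polarization. The vectors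
  -- `w` do not depend on `A` or `M`, so the bound can later be averaged over `A`.
  by_cases hk : k = k₀
  · by_cases hl : l = k₀
    · refine ⟨fun _ => e k₁, fun m => ⟨hne _, hin _ _ h01⟩, fun A M hM => ?_⟩
      rw [hk, hl]
      exact (key M _ _).1
    · refine ⟨fun _ => e l, fun m => ⟨hne _, hin _ _ (Ne.symm hl)⟩, fun A M hM => ?_⟩
      rw [hk]
      exact (key M _ _).2.1
  · by_cases hl : l = k₀
    · refine ⟨fun _ => e k, fun m => ⟨hne _, hin _ _ (Ne.symm hk)⟩, fun A M hM => ?_⟩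
      rw [hl, bil_comm hM]
      exact (key M _ _).2.1
    · by_cases hkl : k = l
      · refine ⟨fun _ => e k, fun m => ⟨hne _, hin _ _ (Ne.symm hk)⟩, fun A M hM => ?_⟩
        rw [← hkl]
        exact (key M _ _).2.2
      · refine ⟨![e k, e l, (Real.sqrt 2)⁻¹ • (e k + e l)], fun m => ?_, fun A M hM => ?_⟩
        · have hs : ‖e k + e l‖ = Real.sqrt 2 := by
            rw [← Real.sqrt_sq (norm_nonneg (e k + e l)), norm_add_sq_real, hin k l hkl, hne, hne]
            norm_num
          fin_cases m
          · exact ⟨hne _, hin _ _ (Ne.symm hk)⟩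
          · exact ⟨hne _, hin _ _ (Ne.symm hl)⟩
          · refine ⟨?_, ?_⟩
            · change ‖(Real.sqrt 2)⁻¹ • (e k + e l)‖ = 1
              rw [norm_smul, hs, norm_inv, Real.norm_of_nonneg (by positivity)]
              exact inv_mul_cancel₀ (by positivity)
            · change ⟪e k₀, (Real.sqrt 2)⁻¹ • (e k + e l)⟫ = 0
              rw [inner_smul_right, inner_add_right, hin _ _ (Ne.symm hk), hin _ _ (Ne.symm hl)]
              simp
        · have := norm_sq_bil_polar_le hM ((A : E n →L[ℝ] E n) (EuclideanSpace.single k₀ 1))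
            ((A : E n →L[ℝ] E n) (EuclideanSpace.single k 1)) ((A : E n →L[ℝ] E n) (EuclideanSpace.single l 1))
          rw [Fin.sum_univ_three]
          simpa [he] using this

lemma sum_norm_sq_le_frames (k₀ k₁ : Fin n) (h01 : k₀ ≠ k₁) :
    ∃ w : Fin n → Fin n → Fin 3 → E n,
      (∀ k l m, ‖w k l m‖ = 1 ∧ ⟪EuclideanSpace.single k₀ (1 : ℝ), w k l m⟫ = 0) ∧
      ∀ (A : Rot n) (M : Fin n → Fin n → ℂ), (∀ i j, M i j = M j i) →
        ∑ i, ∑ j, ‖M i j‖ ^ 2 ≤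
          4 * ∑ k, ∑ l, ∑ m, framePart M ((A : E n →L[ℝ] E n) (EuclideanSpace.single k₀ 1))
            ((A : E n →L[ℝ] E n) (w k l m)) := by
  choose w hw hle using exists_frames k₀ k₁ h01
  refine ⟨w, hw, fun A M hM => ?_⟩
  rw [← sum_norm_sq_bil ((EuclideanSpace.basisFun (Fin n) ℝ).map (Unitary.linearIsometryEquiv A)) M,
    Finset.mul_sum]
  refine Finset.sum_le_sum fun k _ => ?_
  rw [Finset.mul_sum]
  refine Finset.sum_le_sum fun l _ => ?_
  simp only [OrthonormalBasis.map_apply, EuclideanSpace.basisFun_apply]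
  exact hle k l A M hM

lemma continuous_bil : Continuous fun p : (Fin n → Fin n → ℂ) × E n × E n => bil p.1 p.2.1 p.2.2 := by
  unfold bil; fun_prop

/-- The frame part of `G(y)` at `(y / |y|, ξ)`. -/
def frameDensity (G : Fin n → Fin n → E n → ℂ) (p : E n × E n) : ℝ≥0∞ :=
  ENNReal.ofReal (framePart (fun i j => G i j p.1) (‖p.1‖⁻¹ • p.1) p.2)

lemma measurable_frameDensity {G : Fin n → Fin n → E n → ℂ} (hG : ∀ i j, Measurable (G i j)) :
    Measurable (frameDensity G) := by
  have hM : Measurable fun p : E n × E n => fun i j => G i j p.1 :=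
    measurable_pi_lambda _ fun i => measurable_pi_lambda _ fun j => (hG i j).comp measurable_fst
  have hy : Measurable fun p : E n × E n => ‖p.1‖⁻¹ • p.1 := by fun_prop
  have h {f g : E n × E n → E n} (hf : Measurable f) (hg : Measurable g) :
      Measurable fun p : E n × E n => ‖bil (fun i j => G i j p.1) (f p) (g p)‖ ^ 2 :=
    (continuous_bil.measurable.comp (hM.prodMk (hf.prodMk hg))).norm.pow_const 2
  exact (((h hy hy).add (h hy measurable_snd)).add (h measurable_snd measurable_snd)).ennreal_ofReal

lemma enorm_sq_eq_ofReal (z : ℂ) : ‖z‖ₑ ^ 2 = ENNReal.ofReal (‖z‖ ^ 2) := by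
  rw [ENNReal.ofReal_pow (norm_nonneg _), ofReal_norm]

/-- The weighted `L²` norm of a symmetric tensor field is controlled by the frame parts, integrated
over the bundle of pairs `y ⟂ ξ`. -/
lemma lintegral_tensor_le (hn : 2 ≤ n) : ∃ C : ℝ≥0, ∀ (G : Fin n → Fin n → E n → ℂ),
    (∀ i j, Measurable (G i j)) → (∀ i j, G i j = G j i) →
    ∀ ω : ℝ → ℝ≥0∞, Measurable ω →
    ∫⁻ y, ω ‖y‖ * ∑ i, ∑ j, ‖G i j y‖ₑ ^ 2 ≤
      C * ∫⁻ ξ : Sph n, ∫⁻ y : (ℝ ∙ (ξ : E n))ᗮ, ω ‖(y : E n)‖ * ENNReal.ofReal ‖(y : E n)‖ *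
        frameDensity G ((y : E n), (ξ : E n)) ∂(perpMeasure ξ) ∂(sphereMeasure n) := by
  set k₀ : Fin n := ⟨0, by omega⟩
  set k₁ : Fin n := ⟨1, by omega⟩
  have h01 : k₀ ≠ k₁ := by simp [k₀, k₁]
  set u : Sph n := ⟨EuclideanSpace.single k₀ 1, by simp⟩ with hu
  set w₀ : Sph n := ⟨EuclideanSpace.single k₁ 1, by simp⟩ with hw₀
  have huw : ⟪(u : E n), (w₀ : E n)⟫ = 0 := by
    simp [hu, hw₀, EuclideanSpace.inner_single_left, h01]
  obtain ⟨w, hw, hle⟩ := sum_norm_sq_le_frames k₀ k₁ h01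
  have hP0 := perpSphereMass_ne_zero hn w₀
  have hPt := perpSphereMass_ne_top w₀
  -- The number `12 n²` is the factor `4` times three frames for each of the `n²` entries. The
  -- sphere mass occurs on both sides, so only the mass of the sphere in one hyperplane has to be
  -- divided out.
  refine ⟨((12 : ℝ≥0∞) * n ^ 2 * (perpSphereMass w₀)⁻¹).toNNReal, fun G hG hsym ω hω => ?_⟩
  rw [ENNReal.coe_toNNReal (by finiteness)]
  set h : E n × E n → ℝ≥0∞ := fun p => ω ‖p.1‖ * ENNReal.ofReal ‖p.1‖ * frameDensity G p with hh
  have hhm : Measurable h :=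
    ((hω.comp (by fun_prop)).mul (by fun_prop)).mul (measurable_frameDensity hG)
  have hgm : Measurable fun y => ω ‖y‖ * ∑ i, ∑ j, ‖G i j y‖ₑ ^ 2 := by
    refine (hω.comp (by fun_prop)).mul ?_
    exact Finset.measurable_fun_sum _ fun i _ => Finset.measurable_fun_sum _ fun j _ =>
      ((hG i j).enorm).pow_const 2
  rw [lintegral_sphere_perp hn hhm u w₀ huw, lintegral_polar hn hgm u w₀]
  have key : ∀ r ∈ Set.Ioi (0 : ℝ), ENNReal.ofReal (r ^ (n - 1)) *
      rotAvg (fun p => ω ‖p.1‖ * ∑ i, ∑ j, ‖G i j p.1‖ₑ ^ 2) (r • (u : E n)) w₀ ≤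
      (12 * n ^ 2) * (ENNReal.ofReal (r ^ (n - 2)) * rotAvg h (r • (u : E n)) w₀) := by
    intro r hr
    have hr0 : (0 : ℝ) < r := hr
    -- The factor `r` is the quotient of the radial densities `r^(n-1)` and `r^(n-2)`.
    have h1 : ENNReal.ofReal r * rotAvg (fun p => ω ‖p.1‖ * ∑ i, ∑ j, ‖G i j p.1‖ₑ ^ 2)
        (r • (u : E n)) w₀ ≤ 4 * ∑ k, ∑ l, ∑ m, rotAvg h (r • (u : E n)) (w k l m) := by
      have hm (v : E n) : Measurable fun A : Rot n =>
          h ((A : E n →L[ℝ] E n) (r • (u : E n)), (A : E n →L[ℝ] E n) v) :=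
        hhm.comp ((measurable_rot_apply.comp (f := fun p : Rot n => (p, _)) (by fun_prop)).prodMk
          (measurable_rot_apply.comp (f := fun p : Rot n => (p, _)) (by fun_prop)))
      unfold rotAvg
      simp_rw [← lintegral_finsetSum Finset.univ fun m _ => hm _]
      simp_rw [← lintegral_finsetSum Finset.univ fun l _ =>
        Finset.measurable_fun_sum Finset.univ fun m _ => hm _]
      rw [← lintegral_finsetSum Finset.univ fun k _ => Finset.measurable_fun_sum Finset.univ fun l _ =>
        Finset.measurable_fun_sum Finset.univ fun m _ => hm _]
      rw [← lintegral_const_mul' _ _ (by simp), ← lintegral_const_mul' _ _ (by simp)]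
      refine lintegral_mono fun A => ?_
      have hnorm : ‖(A : E n →L[ℝ] E n) (r • (u : E n))‖ = r := by
        rw [A.norm_map, norm_smul]; simp [hr0.le]
      have hdir : r⁻¹ • (A : E n →L[ℝ] E n) (r • (u : E n)) = (A : E n →L[ℝ] E n) u := by
        rw [map_smul, smul_smul, inv_mul_cancel₀ hr0.ne', one_smul]
      have h2 := ENNReal.ofReal_le_ofReal
        (hle A (fun i j => G i j ((A : E n →L[ℝ] E n) (r • (u : E n))))
        (fun i j => by rw [hsym i j]))
      simp only [hh, frameDensity, hnorm, hdir, ← Finset.mul_sum]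
      rw [ENNReal.ofReal_sum_of_nonneg (fun i _ => by positivity)] at h2
      simp_rw [ENNReal.ofReal_sum_of_nonneg
        (fun j (_ : j ∈ Finset.univ) => sq_nonneg ‖G _ j _‖), ← enorm_sq_eq_ofReal] at h2
      rw [ENNReal.ofReal_mul (by norm_num), ENNReal.ofReal_sum_of_nonneg (fun i _ =>
        Finset.sum_nonneg fun j _ => Finset.sum_nonneg fun m _ => framePart_nonneg _ _ _)] at h2
      simp_rw [ENNReal.ofReal_sum_of_nonneg (fun j (_ : j ∈ Finset.univ) =>
        Finset.sum_nonneg fun m (_ : m ∈ Finset.univ) => framePart_nonneg _ _ _)] at h2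
      simp_rw [ENNReal.ofReal_sum_of_nonneg (fun j (_ : j ∈ Finset.univ) =>
        framePart_nonneg _ _ _)] at h2
      calc _ = ω r * ENNReal.ofReal r * ∑ i, ∑ j, ‖G i j ((A : E n →L[ℝ] E n) (r • (u : E n)))‖ₑ ^ 2 := by
            ring
        _ ≤ _ := mul_le_mul_right h2 _
        _ = _ := by rw [ENNReal.ofReal_ofNat]; ring
    -- All frames are orthogonal pairs of the same lengths, so their averages coincide.
    have h3 : ∀ k l m, rotAvg h (r • (u : E n)) (w k l m) = rotAvg h (r • (u : E n)) w₀ := by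
      intro k l m
      refine rotAvg_congr h rfl (by rw [(hw k l m).1]; simp) ?_ ?_
      · rw [inner_smul_left, (hw k l m).2, mul_zero]
      · rw [inner_smul_left, huw, mul_zero]
    simp_rw [h3] at h1
    simp only [Finset.sum_const, Finset.card_univ, Fintype.card_fin, nsmul_eq_mul] at h1
    have h4 : r ^ (n - 1) = r ^ (n - 2) * r := by
      rw [← pow_succ]; congr 1; omega
    rw [h4, ENNReal.ofReal_mul (by positivity), mul_assoc]
    refine (mul_le_mul_right h1 _).trans_eq ?_
    push_cast; ring
  calc _ ≤ sphereMeasure n Set.univ * ∫⁻ r in Set.Ioi (0 : ℝ), (12 * n ^ 2) *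
        (ENNReal.ofReal (r ^ (n - 2)) * rotAvg h (r • (u : E n)) w₀) :=
      mul_le_mul_right (setLIntegral_mono' measurableSet_Ioi key) _
    _ = _ := by
      rw [lintegral_const_mul' _ _ (by finiteness)]
      calc _ = 12 * n ^ 2 * ((perpSphereMass w₀)⁻¹ * perpSphereMass w₀) *
          (sphereMeasure n Set.univ * ∫⁻ r in Set.Ioi (0 : ℝ),
            (ENNReal.ofReal (r ^ (n - 2)) * rotAvg h (r • (u : E n)) w₀)) := by
            rw [ENNReal.inv_mul_cancel hP0 hPt, mul_one]; ring
        _ = _ := by ring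

end

/-! ### Fourier transforms and line integrals of Schwartz functions -/

section

open scoped LineDeriv FourierTransform

/-- The scaling `y ↦ y / 2π`. -/
def scaleEquiv (n : ℕ) : E n ≃L[ℝ] E n :=
  ContinuousLinearEquiv.smulLeft (Units.mk0 ((2 * Real.pi)⁻¹ : ℝ) (by positivity))

lemma scaleEquiv_apply (y : E n) : scaleEquiv n y = (2 * Real.pi)⁻¹ • y := rfl

/-- The Fourier transform `fourierRn` on the Schwartz space. -/
def fourS (h : 𝓢(E n, ℂ)) : 𝓢(E n, ℂ) :=
  (((2 * Real.pi) ^ (-(n : ℝ) / 2) : ℝ) : ℂ) •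
    SchwartzMap.compCLMOfContinuousLinearEquiv ℂ (scaleEquiv n) (𝓕 h)

lemma fourS_apply_eq (h : 𝓢(E n, ℂ)) (y : E n) :
    fourS h y = (((2 * Real.pi) ^ (-(n : ℝ) / 2) : ℝ) : ℂ) * (𝓕 h) ((2 * Real.pi)⁻¹ • y) := rfl

/-- The kernel of `𝓕` is `e^(-2πi⟨x, y⟩)`; evaluating at `y / 2π` removes the `2π`. -/
lemma fourS_apply (h : 𝓢(E n, ℂ)) (y : E n) : fourS h y = fourierRn h y := by
  rw [fourS_apply_eq, fourierRn, SchwartzMap.fourier_coe, Real.fourier_eq']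
  congr 1
  refine integral_congr_ae (ae_of_all _ fun x => ?_)
  simp only [smul_eq_mul]
  congr 2
  rw [inner_smul_right, real_inner_comm]
  have : (Real.pi : ℂ) ≠ 0 := by exact_mod_cast Real.pi_ne_zero
  push_cast
  field_simp

/-- Multiplication by `⟨·, a⟩` on the Schwartz space. -/
def mulInner (a : E n) (h : 𝓢(E n, ℂ)) : 𝓢(E n, ℂ) :=
  SchwartzMap.smulLeftCLM ℂ (fun z : E n => ⟪z, a⟫) h

lemma mulInner_apply (a : E n) (h : 𝓢(E n, ℂ)) (z : E n) :
    mulInner a h z = (⟪z, a⟫ : ℝ) * h z := by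
  have : (inner ℝ · a : E n → ℝ).HasTemperateGrowth := by fun_prop
  rw [mulInner, SchwartzMap.smulLeftCLM_apply_apply this, Complex.real_smul]

lemma lineDeriv_apply (b : E n) (h : 𝓢(E n, ℂ)) (z : E n) : (∂_{b} h) z = fderiv ℝ h z b :=
  SchwartzMap.lineDerivOp_apply_eq_fderiv b h z

lemma fourS_lineDeriv (b : E n) (h : 𝓢(E n, ℂ)) (y : E n) :
    fourS (∂_{b} h) y = Complex.I * (⟪y, b⟫ : ℝ) * fourS h y := by
  have : (inner ℝ · b : E n → ℝ).HasTemperateGrowth := by fun_prop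
  rw [fourS_apply_eq, fourS_apply_eq, SchwartzMap.fourier_lineDerivOp_eq]
  simp only [smul_apply, SchwartzMap.smulLeftCLM_apply_apply this, smul_eq_mul,
    Complex.real_smul, inner_smul_left]
  have : (Real.pi : ℂ) ≠ 0 := by exact_mod_cast Real.pi_ne_zero
  simp only [conj_trivial]
  push_cast
  field_simp

lemma fourS_mulInner (a : E n) (h : 𝓢(E n, ℂ)) (y : E n) :
    fourS (mulInner a h) y = Complex.I * fderiv ℝ (fourS h) y a := by
  have h1 : fderiv ℝ (fourS h) y a = (((2 * Real.pi) ^ (-(n : ℝ) / 2) : ℝ) : ℂ) *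
      ((2 * Real.pi)⁻¹ * (∂_{a} (𝓕 h)) ((2 * Real.pi)⁻¹ • y)) := by
    have h0 (g : 𝓢(E n, ℂ)) (c : ℂ) : HasFDerivAt (fun y : E n => c * g ((2 * Real.pi)⁻¹ • y))
        (c • ((fderiv ℝ g ((2 * Real.pi)⁻¹ • y)).comp (scaleEquiv n : E n →L[ℝ] E n))) y :=
      ((g.hasFDerivAt (scaleEquiv n y)).comp y (scaleEquiv n).hasFDerivAt).const_mul c
    have hd := h0 (𝓕 h) (((2 * Real.pi) ^ (-(n : ℝ) / 2) : ℝ) : ℂ)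
    rw [funext (fourS_apply_eq h), hd.fderiv, lineDeriv_apply]
    simp [scaleEquiv_apply]
  rw [h1, SchwartzMap.lineDerivOp_fourier_eq, fourS_apply_eq]
  have h2 : 𝓕 (-(2 * Real.pi * Complex.I) • SchwartzMap.smulLeftCLM ℂ (inner ℝ · a) h) =
      -(2 * Real.pi * Complex.I) • 𝓕 (mulInner a h) := FourierTransform.fourier_smul _ _
  rw [h2]
  simp only [smul_apply, smul_eq_mul]
  have : (Real.pi : ℂ) ≠ 0 := by exact_mod_cast Real.pi_ne_zero
  generalize (𝓕 (mulInner a h)) ((2 * Real.pi)⁻¹ • y) = X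
  generalize (((2 * Real.pi) ^ (-(n : ℝ) / 2) : ℝ) : ℂ) = c
  push_cast
  field_simp
  linear_combination (c * X) * Complex.I_sq

/-- This is the rule behind the invariance of `Ξᵢ`: multiplication along `a` and differentiation
along `b` exchange roles, with a commutator `⟨a, b⟩` that vanishes for `a = ξ` and `b` tangent to
the sphere. -/
lemma fourS_mulInner_lineDeriv (a b : E n) (h : 𝓢(E n, ℂ)) (y : E n) :
    fourS (mulInner a (∂_{b} h)) y =
      -(⟪a, b⟫ : ℝ) * fourS h y - (⟪y, b⟫ : ℝ) * fderiv ℝ (fourS h) y a := by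
  have h1 : (fourS (∂_{b} h) : E n → ℂ) = fun y => Complex.I * (⟪y, b⟫ : ℝ) * fourS h y :=
    funext fun y => fourS_lineDeriv b h y
  have h2 : HasFDerivAt (fun y : E n => ((⟪y, b⟫ : ℝ) : ℂ))
      (Complex.ofRealCLM.comp ((innerSL ℝ).flip b)) y :=
    Complex.ofRealCLM.hasFDerivAt.comp y ((innerSL ℝ).flip b).hasFDerivAt
  have h3 : HasFDerivAt (fun y : E n => Complex.I * (⟪y, b⟫ : ℝ) * fourS h y) _ y :=
    (h2.const_mul Complex.I).mul ((fourS h).hasFDerivAt y)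
  rw [fourS_mulInner, h1, h3.fderiv]
  have h4 : innerSL ℝ b a = ⟪a, b⟫ := real_inner_comm a b
  simp [h4]
  linear_combination ((⟪y, b⟫ : ℝ) * fderiv ℝ (fourS h) y a + fourS h y * (⟪a, b⟫ : ℝ)) * Complex.I_sq

/-- Schwartz functions decay along lines, locally uniformly in the line. -/
lemma schwartz_line_bound {F : Type*} [NormedAddCommGroup F] [NormedSpace ℝ F] (g : 𝓢(E n, F))
    (x₀ ξ₀ : E n) (hξ₀ : ‖ξ₀‖ = 1) : ∃ C, ∀ x ξ : E n, ‖x - x₀‖ ≤ 1 / 2 → ‖ξ - ξ₀‖ ≤ 1 / 2 →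
      ∀ τ : ℝ, (1 + |τ|) * ‖g (x + τ • ξ)‖ ≤ C * (1 + τ ^ 2)⁻¹ := by
  -- Cubic decay is needed: one power of `τ` is lost when differentiating `x + τ ξ` in `ξ`, and two
  -- make the bound integrable in `τ`. The condition `‖ξ - ξ₀‖ ≤ 1/2` keeps `ξ` away from `0`, so
  -- that `|τ|` is controlled by the distance along the line.
  set C := 2 ^ 3 * ((Finset.Iic (3, 0)).sup fun m => SchwartzMap.seminorm ℝ m.1 m.2) g
  have hC (z : E n) : (1 + ‖z‖) ^ 3 * ‖g z‖ ≤ C := by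
    have := SchwartzMap.one_add_le_sup_seminorm_apply (𝕜 := ℝ) (m := (3, 0)) (k := 3) (n := 0)
      le_rfl le_rfl g z
    simpa using this
  refine ⟨(3 + 2 * ‖x₀‖) ^ 3 * C, fun x ξ hx hξ τ => ?_⟩
  set z := x + τ • ξ with hz
  have h1 : 1 / 2 ≤ ‖ξ‖ := by
    have := norm_sub_norm_le ξ₀ ξ
    rw [norm_sub_rev] at this; linarith
  have h2 : ‖x‖ ≤ ‖x₀‖ + 1 / 2 := by
    have := norm_sub_norm_le x x₀; linarith
  have h3 : |τ| * ‖ξ‖ ≤ ‖z‖ + ‖x‖ := by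
    have : τ • ξ = z - x := by rw [hz]; abel
    rw [← Real.norm_eq_abs, ← norm_smul, this]
    exact norm_sub_le _ _
  have h4 : 1 + |τ| ≤ (3 + 2 * ‖x₀‖) * (1 + ‖z‖) := by
    nlinarith [abs_nonneg τ, norm_nonneg z, norm_nonneg x₀, mul_nonneg (norm_nonneg z) (norm_nonneg x₀)]
  have h5 : (1 + |τ|) ^ 3 * ‖g z‖ ≤ (3 + 2 * ‖x₀‖) ^ 3 * C := by
    calc (1 + |τ|) ^ 3 * ‖g z‖ ≤ ((3 + 2 * ‖x₀‖) * (1 + ‖z‖)) ^ 3 * ‖g z‖ := by gcongr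
      _ = (3 + 2 * ‖x₀‖) ^ 3 * ((1 + ‖z‖) ^ 3 * ‖g z‖) := by ring
      _ ≤ _ := by gcongr; exact hC z
  have h6 : 1 + τ ^ 2 ≤ (1 + |τ|) ^ 2 := by
    rw [← sq_abs]; nlinarith [abs_nonneg τ]
  rw [← div_eq_mul_inv, le_div_iff₀ (by positivity)]
  refine le_trans ?_ h5
  calc (1 + |τ|) * ‖g z‖ * (1 + τ ^ 2) ≤ (1 + |τ|) * ‖g z‖ * (1 + |τ|) ^ 2 := by gcongr
    _ = _ := by ring

lemma integrable_line {F : Type*} [NormedAddCommGroup F] [NormedSpace ℝ F] (g : 𝓢(E n, F))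
    (x ξ : E n) (hξ : ‖ξ‖ = 1) : Integrable fun τ : ℝ => g (x + τ • ξ) := by
  obtain ⟨C, hC⟩ := schwartz_line_bound g x ξ hξ
  refine (integrable_inv_one_add_sq.const_mul C).mono' ?_ (ae_of_all _ fun τ => ?_)
  · exact (g.continuous.comp (by fun_prop)).aestronglyMeasurable
  · refine le_trans ?_ (hC x ξ (by simp) (by simp) τ)
    nlinarith [abs_nonneg τ, norm_nonneg (g (x + τ • ξ)), mul_nonneg (abs_nonneg τ) (norm_nonneg (g (x + τ • ξ)))]

/-- The derivative of `p ↦ h (p.1 + τ p.2)`. -/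
def lineFDeriv (h : 𝓢(E n, ℂ)) (p : E n × E n) (τ : ℝ) : E n × E n →L[ℝ] ℂ :=
  (fderiv ℝ h (p.1 + τ • p.2)).comp
    (ContinuousLinearMap.fst ℝ (E n) (E n) + τ • ContinuousLinearMap.snd ℝ (E n) (E n))

lemma norm_lineFDeriv_le (h : 𝓢(E n, ℂ)) (p : E n × E n) (τ : ℝ) :
    ‖lineFDeriv h p τ‖ ≤ (1 + |τ|) * ‖fderiv ℝ h (p.1 + τ • p.2)‖ := by
  rw [mul_comm]
  refine (ContinuousLinearMap.opNorm_comp_le _ _).trans ?_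
  gcongr
  refine (norm_add_le _ _).trans (add_le_add (ContinuousLinearMap.norm_fst_le ..) ?_)
  rw [norm_smul, Real.norm_eq_abs]
  exact mul_le_of_le_one_right (abs_nonneg _) (ContinuousLinearMap.norm_snd_le ..)

lemma continuous_lineFDeriv (h : 𝓢(E n, ℂ)) (p : E n × E n) : Continuous (lineFDeriv h p) := by
  have : Continuous (fderiv ℝ h) := (h.smooth 1).continuous_fderiv (by simp)
  unfold lineFDeriv
  refine Continuous.clm_comp (this.comp (by fun_prop)) (by fun_prop)

lemma integrable_lineFDeriv (h : 𝓢(E n, ℂ)) (p : E n × E n) (hp : ‖p.2‖ = 1) :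
    Integrable (lineFDeriv h p) := by
  obtain ⟨C, hC⟩ := schwartz_line_bound (SchwartzMap.fderivCLM ℝ (E n) ℂ h) p.1 p.2 hp
  refine (integrable_inv_one_add_sq.const_mul C).mono'
    (continuous_lineFDeriv h p).aestronglyMeasurable (ae_of_all _ fun τ => ?_)
  exact (norm_lineFDeriv_le h p τ).trans (hC p.1 p.2 (by simp) (by simp) τ)

lemma hasFDerivAt_line_integral (h : 𝓢(E n, ℂ)) (p : E n × E n) (hp : ‖p.2‖ = 1) :
    HasFDerivAt (fun p : E n × E n => ∫ τ : ℝ, h (p.1 + τ • p.2)) (∫ τ, lineFDeriv h p τ) p := by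
  obtain ⟨C, hC⟩ := schwartz_line_bound (SchwartzMap.fderivCLM ℝ (E n) ℂ h) p.1 p.2 hp
  refine (hasFDerivAt_integral_of_dominated_of_fderiv_le (Metric.ball_mem_nhds p one_half_pos)
    (bound := fun τ => C * (1 + τ ^ 2)⁻¹) (F' := lineFDeriv h) ?_ (integrable_line h p.1 p.2 hp)
    (continuous_lineFDeriv h p).aestronglyMeasurable ?_ (integrable_inv_one_add_sq.const_mul C) ?_)
  · exact .of_forall fun q => (h.continuous.comp (by fun_prop)).aestronglyMeasurable
  · refine ae_of_all _ fun τ q hq => (norm_lineFDeriv_le h q τ).trans ?_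
    rw [Metric.mem_ball, dist_eq_norm, Prod.norm_def, max_lt_iff] at hq
    exact hC q.1 q.2 hq.1.le hq.2.le τ
  · refine ae_of_all _ fun τ q _ => ?_
    have h1 : HasFDerivAt (fun p : E n × E n => p.1 + τ • p.2)
      (ContinuousLinearMap.fst ℝ (E n) (E n) + τ • ContinuousLinearMap.snd ℝ (E n) (E n)) q :=
      hasFDerivAt_fst.add (hasFDerivAt_snd.const_smul τ)
    exact (h.hasFDerivAt (q.1 + τ • q.2)).comp q h1

lemma integral_line_deriv_eq_zero (h : 𝓢(E n, ℂ)) (x ξ : E n) (hξ : ‖ξ‖ = 1) :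
    ∫ τ : ℝ, fderiv ℝ h (x + τ • ξ) ξ = 0 := by
  refine integral_eq_zero_of_hasDerivAt_of_integrable (f := fun τ : ℝ => h (x + τ • ξ))
    (fun τ => ?_) ?_ (integrable_line h x ξ hξ)
  · have h1 : HasDerivAt (fun τ : ℝ => x + τ • ξ) ξ τ := by
      simpa using ((hasDerivAt_id τ).smul_const ξ).const_add x
    exact (h.hasFDerivAt _).comp_hasDerivAt τ h1
  · exact integrable_line (∂_{ξ} h) x ξ hξ

/-- The derivative of the ray integral along the field `xiField`, at a point of `TSⁿ⁻¹`. -/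
lemma integral_lineFDeriv_apply (h : 𝓢(E n, ℂ)) (x ξ v : E n) (c : ℝ) (hξ : ‖ξ‖ = 1)
    (hx : ⟪x, ξ⟫ = 0) : (∫ τ, lineFDeriv h (x, ξ) τ) (c • ξ, v) =
      ∫ τ : ℝ, mulInner ξ (∂_{v} h) (x + τ • ξ) := by
  rw [ContinuousLinearMap.integral_apply (integrable_lineFDeriv h (x, ξ) hξ)]
  -- The component along `ξ` is a total derivative in `τ` and integrates to zero. In the other one
  -- the factor `τ` equals `⟨x + τ ξ, ξ⟩`, hence is multiplication by a function of the point.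
  have h1 (τ : ℝ) : lineFDeriv h (x, ξ) τ (c • ξ, v) =
      c • fderiv ℝ h (x + τ • ξ) ξ + mulInner ξ (∂_{v} h) (x + τ • ξ) := by
    rw [mulInner_apply, lineDeriv_apply, inner_add_left, inner_smul_left, hx,
      real_inner_self_eq_norm_sq, hξ]
    simp [lineFDeriv]
  simp_rw [h1]
  rw [integral_add, integral_smul, integral_line_deriv_eq_zero h x ξ hξ, smul_zero, zero_add]
  · exact (integrable_line (∂_{ξ} h) x ξ hξ).smul c
  · exact integrable_line (mulInner ξ (∂_{v} h)) x ξ hξ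

end

/-! ### Symbols -/

section

open scoped LineDeriv FourierTransform ContDiff

/-- Finite sums of products of a smooth function of `ξ` and a Schwartz function of `z`, as functions
of `(z, ξ)`. -/
inductive IsSymbol : (E n × E n → ℂ) → Prop
  | gen (P : E n → ℂ) (hP : ContDiff ℝ ∞ P) (h : 𝓢(E n, ℂ)) : IsSymbol fun p => P p.2 * h p.1
  | add (H K : E n × E n → ℂ) : IsSymbol H → IsSymbol K → IsSymbol fun p => H p + K p

/-- The integral of a symbol along the line `x + ℝ ξ`. -/
def lineInt (H : E n × E n → ℂ) (p : E n × E n) : ℂ := ∫ τ : ℝ, H (p.1 + τ • p.2, p.2)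

/-- The ray transform of a symbol. -/
def ray (H : E n × E n → ℂ) (q : TS n) : ℂ := lineInt H q.1

/-- The Fourier transform in the first variable. -/
def fourSym (H : E n × E n → ℂ) (p : E n × E n) : ℂ := fourierRn (fun z => H (z, p.2)) p.1

lemma fourierRn_add (g h : 𝓢(E n, ℂ)) (y : E n) :
    fourierRn (fun z => g z + h z) y = fourierRn g y + fourierRn h y := by
  have hint (g : 𝓢(E n, ℂ)) :
      Integrable fun x : E n => Complex.exp (-Complex.I * ((⟪y, x⟫ : ℝ) : ℂ)) * g x := by
    refine g.integrable.norm.mono' (by fun_prop) (ae_of_all _ fun x => ?_)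
    rw [norm_mul, neg_mul, mul_comm Complex.I, ← neg_mul, ← Complex.ofReal_neg,
      Complex.norm_exp_ofReal_mul_I, one_mul]
  unfold fourierRn
  simp_rw [mul_add]
  rw [integral_add (hint g) (hint h), mul_add]

lemma fourierRn_const_mul (c : ℂ) (h : E n → ℂ) (y : E n) :
    fourierRn (fun z => c * h z) y = c * fourierRn h y := by
  unfold fourierRn
  simp_rw [mul_left_comm _ c]
  rw [integral_const_mul, mul_left_comm]

/-! ### Closure of symbols under Fourier transform, multiplication and differentiation -/

namespace IsSymbol

variable {H K : E n × E n → ℂ}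

lemma slice (hH : IsSymbol H) (ξ : E n) : ∃ h : 𝓢(E n, ℂ), ∀ z, H (z, ξ) = h z := by
  induction hH with
  | gen P hP h => exact ⟨P ξ • h, fun z => rfl⟩
  | add H K _ _ h1 h2 =>
    obtain ⟨f, hf⟩ := h1
    obtain ⟨g, hg⟩ := h2
    exact ⟨f + g, fun z => congrArg₂ (· + ·) (hf z) (hg z)⟩

lemma contDiff (hH : IsSymbol H) : ContDiff ℝ ∞ H := by
  induction hH with
  | gen P hP h => exact (hP.comp contDiff_snd).mul ((h.smooth ⊤).comp contDiff_fst)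
  | add H K _ _ h1 h2 => exact h1.add h2

lemma differentiable (hH : IsSymbol H) : Differentiable ℝ H :=
  hH.contDiff.differentiable (by simp)

lemma fourSym_gen (P : E n → ℂ) (h : 𝓢(E n, ℂ)) :
    fourSym (fun p => P p.2 * h p.1) = fun p => P p.2 * fourS h p.1 := by
  funext p
  simp only [fourSym, fourierRn_const_mul, fourS_apply]

lemma fourSym_add (hH : IsSymbol H) (hK : IsSymbol K) :
    fourSym (fun p => H p + K p) = fun p => fourSym H p + fourSym K p := by
  funext p
  obtain ⟨f, hf⟩ := hH.slice p.2
  obtain ⟨g, hg⟩ := hK.slice p.2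
  simp only [fourSym, hf, hg, fourierRn_add]

lemma fourSym (hH : IsSymbol H) : IsSymbol (fourSym H) := by
  induction hH with
  | gen P hP h => rw [fourSym_gen]; exact gen P hP _
  | add H K hH hK h1 h2 => rw [fourSym_add hH hK]; exact add _ _ h1 h2

lemma lineInt_gen (P : E n → ℂ) (h : 𝓢(E n, ℂ)) :
    lineInt (fun p => P p.2 * h p.1) = fun p => P p.2 * ∫ τ : ℝ, h (p.1 + τ • p.2) := by
  funext p
  simp only [lineInt, integral_const_mul]

lemma integrable_line (hH : IsSymbol H) (p : E n × E n) (hp : ‖p.2‖ = 1) :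
    Integrable fun τ : ℝ => H (p.1 + τ • p.2, p.2) := by
  obtain ⟨f, hf⟩ := hH.slice p.2
  simp only [hf]
  exact MomentumRay.integrable_line f p.1 p.2 hp

lemma lineInt_add (hH : IsSymbol H) (hK : IsSymbol K) (p : E n × E n) (hp : ‖p.2‖ = 1) :
    lineInt (fun p => H p + K p) p = lineInt H p + lineInt K p :=
  integral_add (hH.integrable_line p hp) (hK.integrable_line p hp)

lemma congr (hH : IsSymbol H) (h : ∀ p, H p = K p) : IsSymbol K := by
  rwa [← funext h]

lemma zero : IsSymbol fun _ : E n × E n => (0 : ℂ) :=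
  (gen 0 contDiff_zero_fun 0).congr fun p => by simp

lemma sum {ι : Type*} (s : Finset ι) {H : ι → E n × E n → ℂ} (hH : ∀ i ∈ s, IsSymbol (H i)) :
    IsSymbol fun p => ∑ i ∈ s, H i p := by
  classical
  induction s using Finset.induction_on with
  | empty => simpa using zero
  | insert a s ha ih =>
    simp only [Finset.sum_insert ha]
    exact add _ _ (hH a (Finset.mem_insert_self _ _))
      (ih fun i hi => hH i (Finset.mem_insert_of_mem hi))

lemma mul_snd (hH : IsSymbol H) {Q : E n → ℂ} (hQ : ContDiff ℝ ∞ Q) :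
    IsSymbol fun p => Q p.2 * H p := by
  induction hH with
  | gen P hP h => exact (gen _ (hQ.mul hP) h).congr fun p => by simp [mul_assoc]
  | add H K hH hK h1 h2 => exact (add _ _ h1 h2).congr fun p => (mul_add _ _ _).symm

lemma const_mul (hH : IsSymbol H) (c : ℂ) : IsSymbol fun p => c * H p :=
  hH.mul_snd contDiff_const

lemma coord_snd_mul (hH : IsSymbol H) (a : Fin n) :
    IsSymbol fun p => ((p.2 a : ℝ) : ℂ) * H p :=
  hH.mul_snd (Q := fun ξ => ((ξ a : ℝ) : ℂ)) (Complex.ofRealCLM.contDiff.comp (by fun_prop))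

lemma inner_single (z : E n) (a : Fin n) : ⟪z, EuclideanSpace.single a (1 : ℝ)⟫ = z a := by
  simp [EuclideanSpace.inner_single_right]

lemma coord_fst_mul (hH : IsSymbol H) (a : Fin n) :
    IsSymbol fun p => ((p.1 a : ℝ) : ℂ) * H p := by
  induction hH with
  | gen P hP h =>
    refine (gen P hP (mulInner (EuclideanSpace.single a 1) h)).congr fun p => ?_
    rw [mulInner_apply, inner_single]; ring
  | add H K hH hK h1 h2 => exact (add _ _ h1 h2).congr fun p => (mul_add _ _ _).symm

lemma fderiv_gen (P : E n → ℂ) (hP : ContDiff ℝ ∞ P) (h : 𝓢(E n, ℂ)) (p u : E n × E n) :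
    fderiv ℝ (fun p : E n × E n => P p.2 * h p.1) p u =
      P p.2 * fderiv ℝ h p.1 u.1 + fderiv ℝ P p.2 u.2 * h p.1 := by
  have h1 : HasFDerivAt (fun p : E n × E n => P p.2) _ p :=
    ((hP.differentiable (by simp)).differentiableAt.hasFDerivAt).comp p hasFDerivAt_snd
  have h2 : HasFDerivAt (fun p : E n × E n => h p.1) _ p := (h.hasFDerivAt p.1).comp p hasFDerivAt_fst
  have h3 : HasFDerivAt (fun p : E n × E n => P p.2 * h p.1) _ p := h1.mul h2
  rw [h3.fderiv]
  simp [mul_comm]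

lemma fderiv_add (hH : IsSymbol H) (hK : IsSymbol K) (p u : E n × E n) :
    fderiv ℝ (fun p => H p + K p) p u = fderiv ℝ H p u + fderiv ℝ K p u := by
  rw [fderiv_fun_add hH.differentiable.differentiableAt hK.differentiable.differentiableAt]
  rfl

lemma fderiv_fst (hH : IsSymbol H) (a : E n) : IsSymbol fun p => fderiv ℝ H p (a, 0) := by
  induction hH with
  | gen P hP h =>
    refine (gen P hP (∂_{a} h)).congr fun p => ?_
    simp [fderiv_gen P hP, lineDeriv_apply]
  | add H K hH hK h1 h2 => exact (add _ _ h1 h2).congr fun p => (fderiv_add hH hK p _).symm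

lemma fderiv_snd (hH : IsSymbol H) (a : E n) : IsSymbol fun p => fderiv ℝ H p (0, a) := by
  induction hH with
  | gen P hP h =>
    refine (gen (fun ξ => fderiv ℝ P ξ a) ((hP.fderiv_right (m := ∞) (by simp)).clm_apply
      contDiff_const) h).congr fun p => ?_
    simp [fderiv_gen P hP]
  | add H K hH hK h1 h2 => exact (add _ _ h1 h2).congr fun p => (fderiv_add hH hK p _).symm

lemma eq_sum_single (u : E n) : u = ∑ a, u a • EuclideanSpace.single a (1 : ℝ) := by
  conv_lhs => rw [← (EuclideanSpace.basisFun (Fin n) ℝ).sum_repr u]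
  simp

/-- The direction may vary with the point as long as multiplication by each of its coordinates
preserves symbols; this covers all the polynomial vector fields used below. -/
lemma fderiv_apply (hH : IsSymbol H) (u v : E n × E n → E n)
    (hu : ∀ a K, IsSymbol K → IsSymbol fun p => ((u p a : ℝ) : ℂ) * K p)
    (hv : ∀ a K, IsSymbol K → IsSymbol fun p => ((v p a : ℝ) : ℂ) * K p) :
    IsSymbol fun p => fderiv ℝ H p (u p, v p) := by
  refine (add _ _ (sum Finset.univ fun a _ => hu a _ (hH.fderiv_fst (EuclideanSpace.single a 1)))
    (sum Finset.univ fun a _ => hv a _ (hH.fderiv_snd (EuclideanSpace.single a 1)))).congr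
    fun p => ?_
  have h1 : (u p, v p) = ContinuousLinearMap.inl ℝ (E n) (E n) (u p) +
      ContinuousLinearMap.inr ℝ (E n) (E n) (v p) := by simp
  rw [h1, map_add]
  conv_rhs => rw [eq_sum_single (u p), eq_sum_single (v p)]
  simp only [map_sum, map_smul, Complex.real_smul]
  simp

/-- The symbol of `Ξᵢ` applied to a ray transform. -/
def _root_.MomentumRay.xiSymbol (i : Fin n) (H : E n × E n → ℂ) (p : E n × E n) : ℂ :=
  fderiv ℝ H p (⟪p.1, p.2⟫ • (EuclideanSpace.single i (1 : ℝ) - p.2 i • p.2),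
    EuclideanSpace.single i (1 : ℝ) - p.2 i • p.2)

lemma inner_mul (hH : IsSymbol H) : IsSymbol fun p => ((⟪p.1, p.2⟫ : ℝ) : ℂ) * H p := by
  refine (sum Finset.univ fun a _ => (hH.coord_fst_mul a).coord_snd_mul a).congr fun p => ?_
  rw [PiLp.inner_apply]
  simp only [Complex.ofReal_sum, Finset.sum_mul, RCLike.inner_apply, conj_trivial]
  exact Finset.sum_congr rfl fun a _ => by push_cast; ring

lemma tangent_mul (hH : IsSymbol H) (i a : Fin n) :
    IsSymbol fun p => (((EuclideanSpace.single i (1 : ℝ) - p.2 i • p.2) a : ℝ) : ℂ) * H p := by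
  refine hH.mul_snd (Q := fun ξ => (((EuclideanSpace.single i (1 : ℝ) - ξ i • ξ) a : ℝ) : ℂ)) ?_
  have h1 : ContDiff ℝ ∞ fun ξ : E n => EuclideanSpace.single i (1 : ℝ) - ξ i • ξ := by fun_prop
  exact Complex.ofRealCLM.contDiff.comp ((EuclideanSpace.proj (𝕜 := ℝ) a).contDiff.comp h1)

lemma xiSym (hH : IsSymbol H) (i : Fin n) : IsSymbol (xiSymbol i H) := by
  refine hH.fderiv_apply _ _ (fun a K hK => ?_) fun a K hK => hK.tangent_mul i a
  refine (hK.tangent_mul i a).inner_mul.congr fun p => ?_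
  rw [PiLp.smul_apply, smul_eq_mul]; push_cast; ring

/-- The derivative of a symbol along `xiField`. -/
lemma fderiv_xiField (hH : IsSymbol H) (i : Fin n) :
    IsSymbol fun p => fderiv ℝ H p (xiField i p) := by
  refine hH.fderiv_apply _ _ (fun a K hK => ?_) fun a K hK => hK.tangent_mul i a
  refine ((hK.coord_snd_mul a).coord_fst_mul i).const_mul (-1) |>.congr fun p => ?_
  rw [PiLp.smul_apply, smul_eq_mul]; push_cast; ring

lemma xiSym_gen (i : Fin n) (P : E n → ℂ) (hP : ContDiff ℝ ∞ P) (h : 𝓢(E n, ℂ)) (p : E n × E n) :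
    xiSymbol i (fun p => P p.2 * h p.1) p =
      P p.2 * mulInner p.2 (∂_{EuclideanSpace.single i (1 : ℝ) - p.2 i • p.2} h) p.1 +
      fderiv ℝ P p.2 (EuclideanSpace.single i (1 : ℝ) - p.2 i • p.2) * h p.1 := by
  rw [xiSymbol, fderiv_gen P hP, mulInner_apply, lineDeriv_apply, map_smul, Complex.real_smul]

end IsSymbol

/-! ### Symbols restricted to `TSⁿ⁻¹` -/

section TSPoint

variable (q : TS n)

lemma TS.norm_snd : ‖q.1.2‖ = 1 := q.2.1

lemma TS.inner_eq_zero : ⟪q.1.1, q.1.2⟫ = 0 := q.2.2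

lemma TS.inner_tangent (i : Fin n) :
    ⟪q.1.2, EuclideanSpace.single i (1 : ℝ) - q.1.2 i • q.1.2⟫ = 0 := by
  rw [inner_sub_right, inner_smul_right, IsSymbol.inner_single, real_inner_self_eq_norm_sq, q.2.1]
  ring

lemma TS.inner_fst_tangent (i : Fin n) :
    ⟪q.1.1, EuclideanSpace.single i (1 : ℝ) - q.1.2 i • q.1.2⟫ = q.1.1 i := by
  rw [inner_sub_right, inner_smul_right, IsSymbol.inner_single, q.2.2]
  ring

end TSPoint

/-- Fourier slice theorem: for `y ⟂ ξ` the exponential is constant along `ξ`, so Fubini over `ξ^⊥ ×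
ℝ ξ` joins the two integrations. The normalizations for dimensions `n - 1` and `n` differ by
`(2π)^(1/2)`. -/
lemma fourierTS_ray {H : E n × E n → ℂ} (hH : IsSymbol H) (q : TS n) :
    fourierTS (ray H) q = (((2 * Real.pi) ^ (1 / 2 : ℝ) : ℝ) : ℂ) * fourSym H q.1 := by
  obtain ⟨h, hh⟩ := hH.slice q.1.2
  set ξ : Sph n := ⟨q.1.2, by simpa using q.2.1⟩ with hξ
  have hint : Integrable fun z : E n => Complex.exp (-Complex.I * ((⟪q.1.1, z⟫ : ℝ) : ℂ)) * h z := by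
    refine h.integrable.norm.mono' (by fun_prop) (ae_of_all _ fun x => ?_)
    rw [norm_mul, neg_mul, mul_comm Complex.I, ← neg_mul, ← Complex.ofReal_neg,
      Complex.norm_exp_ofReal_mul_I, one_mul]
  have h1 : ∫ x : (ℝ ∙ (ξ : E n))ᗮ, Complex.exp (-Complex.I * ((⟪q.1.1, (x : E n)⟫ : ℝ) : ℂ)) *
      ray H (TS.mk ξ x) ∂(perpMeasure ξ) =
      ∫ z : E n, Complex.exp (-Complex.I * ((⟪q.1.1, z⟫ : ℝ) : ℂ)) * h z := by
    rw [← integral_perpSplit ξ hint]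
    refine integral_congr_ae (ae_of_all _ fun x => ?_)
    simp only [ray, lineInt, TS.mk, hξ, hh]
    rw [← integral_const_mul]
    refine integral_congr_ae (ae_of_all _ fun τ => ?_)
    simp only [inner_add_right, inner_smul_right, q.inner_eq_zero, mul_zero, add_zero]
  have h2 : (((2 * Real.pi) ^ (-((n : ℝ) - 1) / 2) : ℝ) : ℂ) =
      (((2 * Real.pi) ^ (1 / 2 : ℝ) : ℝ) : ℂ) * (((2 * Real.pi) ^ (-(n : ℝ) / 2) : ℝ) : ℂ) := by
    rw [← Complex.ofReal_mul, ← Real.rpow_add (by positivity)]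
    congr 2; ring
  simp only [fourSym, fourierRn, hh]
  rw [← mul_assoc, ← h2, ← h1]
  rfl

/-- `Ξᵢ` may be computed with any differentiable extension. -/
lemma Xi_eq_fderiv {φ : TS n → ℂ} {Φ : E n × E n → ℂ} (hΦ : ∀ q : TS n, Φ q.1 = φ q) (i : Fin n)
    (q : TS n) (hd : DifferentiableAt ℝ Φ q.1) : Xi i φ q = fderiv ℝ Φ q.1 (xiField i q.1) := by
  set P : E n × E n → E n × E n := fun p => (p.1 - (⟪p.2, p.1⟫ / ‖p.2‖ ^ 2) • p.2, ‖p.2‖⁻¹ • p.2)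
  have hq0 : q.1.2 ≠ 0 := by
    intro h; have := q.norm_snd; rw [h] at this; simp at this
  have hPd : DifferentiableAt ℝ P q.1 := by
    have hn : DifferentiableAt ℝ (fun p : E n × E n => ‖p.2‖) q.1 :=
      (differentiableAt_snd).norm ℝ hq0
    have hn0 : ‖q.1.2‖ ≠ 0 := norm_ne_zero_iff.mpr hq0
    have hi : DifferentiableAt ℝ (fun p : E n × E n => ⟪p.2, p.1⟫) q.1 :=
      differentiableAt_snd.inner ℝ differentiableAt_fst
    have hc : DifferentiableAt ℝ (fun p : E n × E n => ⟪p.2, p.1⟫ / ‖p.2‖ ^ 2) q.1 :=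
      by
        simp only [div_eq_mul_inv]
        exact hi.fun_mul ((hn.fun_pow 2).fun_inv (pow_ne_zero 2 hn0))
    exact DifferentiableAt.prodMk (differentiableAt_fst.fun_sub (hc.fun_smul differentiableAt_snd))
      ((hn.fun_inv hn0).fun_smul differentiableAt_snd)
  have hPq : P q.1 = q.1 := by
    have h1 := q.norm_snd
    have h2 := q.inner_eq_zero
    rw [real_inner_comm] at h2
    simp [P, h1, h2]
  have hev : extendTS φ =ᶠ[𝓝 q.1] fun p => Φ (P p) := by
    have : ∀ᶠ p : E n × E n in 𝓝 q.1, p.2 ≠ 0 := continuousAt_snd.eventually_ne hq0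
    filter_upwards [this] with p hp
    rw [extendTS, dif_pos hp, ← hΦ]
    rfl
  rw [Xi, hev.fderiv_eq]
  set v : E n := EuclideanSpace.single i (1 : ℝ) - q.1.2 i • q.1.2
  have hcomp : HasFDerivAt (fun p => Φ (P p)) ((fderiv ℝ Φ q.1).comp (fderiv ℝ P q.1)) q.1 := by
    have hd' : HasFDerivAt Φ (fderiv ℝ Φ q.1) (P q.1) := by rw [hPq]; exact hd.hasFDerivAt
    exact hd'.comp q.1 hPd.hasFDerivAt
  rw [hcomp.fderiv, ContinuousLinearMap.comp_apply]
  congr 1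
  have hv1 := q.inner_tangent i
  have hv2 := q.inner_fst_tangent i
  have hx := q.inner_eq_zero
  have hξ := q.norm_snd
  have hline : HasDerivAt (fun ε : ℝ => q.1 + ε • xiField i q.1) (xiField i q.1) 0 := by
    simpa using ((hasDerivAt_id (0 : ℝ)).smul_const (xiField i q.1)).const_add q.1
  have h1 : HasDerivAt (fun ε : ℝ => P (q.1 + ε • xiField i q.1))
      (fderiv ℝ P q.1 (xiField i q.1)) 0 := by
    have hP0 : HasFDerivAt P (fderiv ℝ P q.1) (q.1 + (0 : ℝ) • xiField i q.1) := by
      rw [zero_smul, add_zero]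
      exact hPd.hasFDerivAt
    exact hP0.comp_hasDerivAt 0 hline
  -- Along the tangent line the two components stay orthogonal and `|ξ + ε v|² = 1 + ε² |v|²`. The
  -- retraction therefore alters the line only to second order in `ε`.
  have h2 : (fun ε : ℝ => P (q.1 + ε • xiField i q.1)) = fun ε : ℝ =>
      (q.1.1 + ε • (-(q.1.1 i) • q.1.2), (Real.sqrt (1 + ε ^ 2 * ‖v‖ ^ 2))⁻¹ • (q.1.2 + ε • v)) := by
    funext ε
    have e1 : ⟪q.1.2 + ε • v, q.1.1 + ε • (-(q.1.1 i) • q.1.2)⟫ = 0 := by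
      simp only [inner_add_left, inner_add_right, inner_smul_left, inner_smul_right, conj_trivial]
      rw [real_inner_comm q.1.1 q.1.2, real_inner_comm q.1.2 v, real_inner_comm q.1.1 v, hx, hv1, hv2,
        real_inner_self_eq_norm_sq, hξ]
      ring
    have e2 : ‖q.1.2 + ε • v‖ = Real.sqrt (1 + ε ^ 2 * ‖v‖ ^ 2) := by
      rw [← Real.sqrt_sq (norm_nonneg (q.1.2 + ε • v)), norm_add_sq_real, inner_smul_right, hv1,
        norm_smul, hξ, mul_pow, Real.norm_eq_abs, sq_abs]
      congr 1; ring
    have e3 : q.1 + ε • xiField i q.1 = (q.1.1 + ε • (-(q.1.1 i) • q.1.2), q.1.2 + ε • v) := rfl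
    rw [e3]
    simp only [P, e1, e2, zero_div, zero_smul, sub_zero]
  rw [h2] at h1
  refine h1.unique (HasDerivAt.prodMk ?_ ?_)
  · simpa using ((hasDerivAt_id (0 : ℝ)).smul_const (-(q.1.1 i) • q.1.2)).const_add q.1.1
  · have h3 : HasDerivAt (fun ε : ℝ => 1 + ε ^ 2 * ‖v‖ ^ 2) 0 0 := by
      simpa using ((hasDerivAt_pow 2 (0 : ℝ)).mul_const (‖v‖ ^ 2)).const_add 1
    have h4 : HasDerivAt (fun ε : ℝ => (Real.sqrt (1 + ε ^ 2 * ‖v‖ ^ 2))⁻¹) 0 0 := by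
      simpa using (h3.sqrt (by simp)).fun_inv (by simp)
    have h5 : HasDerivAt (fun ε : ℝ => q.1.2 + ε • v) v 0 := by
      simpa using ((hasDerivAt_id (0 : ℝ)).smul_const v).const_add q.1.2
    have h6 := h4.fun_smul h5
    simp only [zero_smul, add_zero, ne_eq, OfNat.ofNat_ne_zero, not_false_eq_true, zero_pow, zero_mul,
      Real.sqrt_one, inv_one, one_smul] at h6
    exact h6

end

/-! ### Ray transforms of symbols -/

section

open scoped LineDeriv FourierTransform ContDiff

namespace IsSymbol

variable {H K : E n × E n → ℂ}

lemma ray_add (hH : IsSymbol H) (hK : IsSymbol K) (q : TS n) :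
    ray (fun p => H p + K p) q = ray H q + ray K q :=
  lineInt_add hH hK q.1 q.norm_snd

lemma xiSymbol_add (hH : IsSymbol H) (hK : IsSymbol K) (i : Fin n) :
    xiSymbol i (fun p => H p + K p) = fun p => xiSymbol i H p + xiSymbol i K p := by
  funext p
  exact fderiv_add hH hK p _

/-- The extension is assembled along the induction, because additivity of `lineInt` is at hand only
for `|ξ| = 1`, whereas a derivative needs a neighbourhood. -/
lemma exists_extension (hH : IsSymbol H) : ∃ Φ : E n × E n → ℂ, (∀ q : TS n, Φ q.1 = ray H q) ∧
    ∀ q : TS n, DifferentiableAt ℝ Φ q.1 ∧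
      ∀ i, fderiv ℝ Φ q.1 (xiField i q.1) = ray (xiSymbol i H) q := by
  induction hH with
  | gen P hP h =>
    refine ⟨lineInt fun p => P p.2 * h p.1, fun q => rfl, fun q => ?_⟩
    rw [lineInt_gen]
    have h1 : HasFDerivAt (fun p : E n × E n => P p.2) _ q.1 :=
      ((hP.differentiable (by simp)).differentiableAt.hasFDerivAt).comp q.1 hasFDerivAt_snd
    have h2 := hasFDerivAt_line_integral h q.1 q.norm_snd
    have h3 : HasFDerivAt (fun p : E n × E n => P p.2 * ∫ τ : ℝ, h (p.1 + τ • p.2)) _ q.1 :=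
      h1.mul h2
    refine ⟨h3.differentiableAt, fun i => ?_⟩
    rw [h3.fderiv]
    simp only [ray, lineInt, xiSym_gen i P hP]
    rw [integral_add, integral_const_mul, integral_const_mul,
      ← integral_lineFDeriv_apply h q.1.1 q.1.2 _ (-(q.1.1 i)) q.norm_snd q.inner_eq_zero]
    · simp [xiField, mul_comm]
    · exact (MomentumRay.integrable_line _ _ _ q.norm_snd).const_mul _
    · exact (MomentumRay.integrable_line _ _ _ q.norm_snd).const_mul _
  | add H K hH hK h1 h2 =>
    obtain ⟨Φ, hΦ, hΦ'⟩ := h1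
    obtain ⟨Ψ, hΨ, hΨ'⟩ := h2
    refine ⟨fun p => Φ p + Ψ p,
      fun q => (congrArg₂ (· + ·) (hΦ q) (hΨ q)).trans (ray_add hH hK q).symm, fun q =>
      ⟨(hΦ' q).1.add (hΨ' q).1, fun i => ?_⟩⟩
    rw [fderiv_fun_add (hΦ' q).1 (hΨ' q).1, xiSymbol_add hH hK, ray_add (hH.xiSym i) (hK.xiSym i),
      ← (hΦ' q).2, ← (hΨ' q).2]
    rfl

lemma Xi_ray (hH : IsSymbol H) (i : Fin n) : Xi i (ray H) = ray (xiSymbol i H) := by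
  obtain ⟨Φ, hΦ, hΦ'⟩ := hH.exists_extension
  funext q
  rw [Xi_eq_fderiv hΦ i q (hΦ' q).1, (hΦ' q).2 i]

/-- With `v = eᵢ - ξᵢ ξ`, the operator `⟨z, ξ⟩ ∂_v` is transformed into `-⟨y, v⟩ ∂_ξ`, as `⟨ξ, v⟩ =
0`. On `TSⁿ⁻¹` one has `⟨y, v⟩ = yᵢ`, which is the first component of `xiField`. -/
lemma fourSym_xiSymbol (hH : IsSymbol H) (i : Fin n) (q : TS n) :
    MomentumRay.fourSym (xiSymbol i H) q.1 =
      fderiv ℝ (MomentumRay.fourSym H) q.1 (xiField i q.1) := by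
  induction hH with
  | gen P hP h =>
    set v := EuclideanSpace.single i (1 : ℝ) - q.1.2 i • q.1.2 with hv
    have h1 : MomentumRay.fourSym (xiSymbol i fun p => P p.2 * h p.1) q.1 =
        P q.1.2 * fourS (mulInner q.1.2 (∂_{v} h)) q.1.1 + fderiv ℝ P q.1.2 v * fourS h q.1.1 := by
      simp only [MomentumRay.fourSym, xiSym_gen i P hP]
      rw [fourS_apply, fourS_apply, ← fourierRn_const_mul, ← fourierRn_const_mul]
      exact fourierRn_add (P q.1.2 • mulInner q.1.2 (∂_{v} h)) (fderiv ℝ P q.1.2 v • h) q.1.1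
    rw [h1, fourSym_gen, fderiv_gen P hP, fourS_mulInner_lineDeriv, hv, q.inner_tangent,
      q.inner_fst_tangent]
    simp [xiField]
  | add H K hH hK h1 h2 =>
    rw [xiSymbol_add hH hK, fourSym_add hH hK, fderiv_add hH.fourSym hK.fourSym, ← h1, ← h2,
      fourSym_add (hH.xiSym i) (hK.xiSym i)]

/-- On the Fourier side, multiplication by `⟨z, a⟩` is `i` times the derivative along `a`. -/
lemma fourSym_inner_mul (hH : IsSymbol H) (a : E n → E n) (p : E n × E n) :
    MomentumRay.fourSym (fun p => ((⟪p.1, a p.2⟫ : ℝ) : ℂ) * H p) p =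
      Complex.I * fderiv ℝ (MomentumRay.fourSym H) p (a p.2, 0) := by
  induction hH with
  | gen P hP h =>
    rw [fourSym_gen, fderiv_gen P hP]
    have h1 : MomentumRay.fourSym (fun p : E n × E n => ((⟪p.1, a p.2⟫ : ℝ) : ℂ) * (P p.2 * h p.1)) p =
        P p.2 * fourS (mulInner (a p.2) h) p.1 := by
      rw [fourS_apply, ← fourierRn_const_mul]
      simp only [MomentumRay.fourSym, mulInner_apply]
      congr 1
      funext z; ring
    rw [h1, fourS_mulInner]
    simp; ring
  | add H K hH hK h1 h2 =>
    rw [fourSym_add hH hK, fderiv_add hH.fourSym hK.fourSym, mul_add, ← h1, ← h2]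
    obtain ⟨f, hf⟩ := hH.slice p.2
    obtain ⟨g, hg⟩ := hK.slice p.2
    simp only [MomentumRay.fourSym, hf, hg, mul_add]
    have e (g : 𝓢(E n, ℂ)) : (mulInner (a p.2) g : E n → ℂ) = fun z => (⟪z, a p.2⟫ : ℝ) * g z :=
      funext (mulInner_apply _ g)
    have h3 := fourierRn_add (mulInner (a p.2) f) (mulInner (a p.2) g) p.1
    rwa [e f, e g] at h3

/-- The symbol of the ray transform multiplied by `xᵢ`. -/
def _root_.MomentumRay.xSymbol (i : Fin n) (H : E n × E n → ℂ) (p : E n × E n) : ℂ :=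
  ((⟪p.1, EuclideanSpace.single i (1 : ℝ) - p.2 i • p.2⟫ : ℝ) : ℂ) * H p

lemma xSym (hH : IsSymbol H) (i : Fin n) : IsSymbol (xSymbol i H) := by
  refine (add _ _ (hH.coord_fst_mul i) ((hH.inner_mul.coord_snd_mul i).const_mul (-1))).congr
    fun p => ?_
  rw [xSymbol, inner_sub_right, inner_smul_right, inner_single]
  push_cast; ring

/-- The coordinate `xᵢ` equals `⟨x + τ ξ, eᵢ - ξᵢ ξ⟩` for every `τ`, hence may be moved under the
integral. -/
lemma mulX_ray (i : Fin n) : mulX i (ray H) = ray (xSymbol i H) := by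
  funext q
  simp only [mulX, ray, lineInt, xSymbol]
  rw [← integral_const_mul]
  refine integral_congr_ae (ae_of_all _ fun τ => ?_)
  simp only [inner_add_left, inner_smul_left, q.inner_fst_tangent, q.inner_tangent, mul_zero,
    add_zero]

lemma exists_bound (hH : IsSymbol H) (k : ℕ) : ∃ C : ℝ, 0 ≤ C ∧ ∀ p : E n × E n, ‖p.2‖ = 1 →
    (1 + ‖p.1‖) ^ k * ‖H p‖ ≤ C := by
  induction hH with
  | gen P hP h =>
    obtain ⟨M, hM⟩ := (isCompact_sphere (0 : E n) 1).exists_bound_of_continuousOn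
      hP.continuous.continuousOn
    set C := 2 ^ k * ((Finset.Iic (k, 0)).sup fun m => SchwartzMap.seminorm ℝ m.1 m.2) h
    have hC (z : E n) : (1 + ‖z‖) ^ k * ‖h z‖ ≤ C := by
      have := SchwartzMap.one_add_le_sup_seminorm_apply (𝕜 := ℝ) (m := (k, 0)) (k := k) (n := 0)
        le_rfl le_rfl h z
      simpa using this
    have hC0 : 0 ≤ C := le_trans (by positivity) (hC 0)
    refine ⟨|M| * C, by positivity, fun p hp => ?_⟩
    rw [norm_mul, mul_left_comm]
    exact mul_le_mul ((hM p.2 (by simpa using hp)).trans (le_abs_self M)) (hC p.1) (by positivity)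
      (abs_nonneg _)
  | add H K hH hK h1 h2 =>
    obtain ⟨C, hC0, hC⟩ := h1
    obtain ⟨D, hD0, hD⟩ := h2
    refine ⟨C + D, add_nonneg hC0 hD0, fun p hp => ?_⟩
    calc (1 + ‖p.1‖) ^ k * ‖H p + K p‖ ≤ (1 + ‖p.1‖) ^ k * (‖H p‖ + ‖K p‖) := by
          gcongr; exact norm_add_le _ _
      _ = (1 + ‖p.1‖) ^ k * ‖H p‖ + (1 + ‖p.1‖) ^ k * ‖K p‖ := mul_add _ _ _
      _ ≤ C + D := add_le_add (hC p hp) (hD p hp)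

end IsSymbol

/-- The symbol whose ray transform is `Iᵏf`. -/
def tensorSymbol (f : SchwartzTensor n) : ℕ → E n × E n → ℂ
  | 0 => fun p => ∑ i, ∑ j, ((p.2 i * p.2 j : ℝ) : ℂ) * f.comp i j p.1
  | k + 1 => fun p => ((⟪p.1, p.2⟫ : ℝ) : ℂ) * tensorSymbol f k p

lemma contDiff_coord_mul (i j : Fin n) : ContDiff ℝ ∞ fun ξ : E n => ((ξ i * ξ j : ℝ) : ℂ) :=
  Complex.ofRealCLM.contDiff.comp
    ((EuclideanSpace.proj (𝕜 := ℝ) i).contDiff.mul (EuclideanSpace.proj (𝕜 := ℝ) j).contDiff)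

lemma isSymbol_tensorSymbol (f : SchwartzTensor n) (k : ℕ) : IsSymbol (tensorSymbol f k) := by
  induction k with
  | zero =>
    exact IsSymbol.sum _ fun i _ => IsSymbol.sum _ fun j _ =>
      IsSymbol.gen _ (contDiff_coord_mul i j) _
  | succ k ih => exact ih.inner_mul

lemma tensorSymbol_eq (f : SchwartzTensor n) (k : ℕ) (p : E n × E n) : tensorSymbol f k p =
    (⟪p.1, p.2⟫ : ℝ) ^ k * ∑ i, ∑ j, ((p.2 i * p.2 j : ℝ) : ℂ) * f.comp i j p.1 := by
  induction k with
  | zero => simp [tensorSymbol]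
  | succ k ih => simp only [tensorSymbol, ih, pow_succ]; ring

lemma rayTransform_eq_ray (f : SchwartzTensor n) (k : ℕ) :
    rayTransform k f = ray (tensorSymbol f k) := by
  funext q
  unfold rayTransform ray lineInt
  refine integral_congr_ae (ae_of_all _ fun τ => ?_)
  simp only [tensorSymbol_eq]
  have h1 : ⟪q.1.1 + τ • q.1.2, q.1.2⟫ = τ := by
    rw [inner_add_left, q.inner_eq_zero, inner_smul_left, real_inner_self_eq_norm_sq, q.norm_snd]
    simp
  rw [h1]
  push_cast
  congr 1
  refine Finset.sum_congr rfl fun i _ => Finset.sum_congr rfl fun j _ => ?_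
  ring

/-- The quadratic form of the transformed field, as a function of `(y, ξ)`. -/
def quadSym (G : Fin n → Fin n → 𝓢(E n, ℂ)) (p : E n × E n) : ℂ :=
  ∑ i, ∑ j, ((p.2 i * p.2 j : ℝ) : ℂ) * G i j p.1

lemma fourSym_sum {ι : Type*} (s : Finset ι) {H : ι → E n × E n → ℂ}
    (hH : ∀ i ∈ s, IsSymbol (H i)) :
    fourSym (fun p => ∑ i ∈ s, H i p) = fun p => ∑ i ∈ s, fourSym (H i) p := by
  classical
  induction s using Finset.induction_on with
  | empty => funext p; simp [fourSym, fourierRn]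
  | insert a s ha ih =>
    simp only [Finset.sum_insert ha]
    rw [IsSymbol.fourSym_add (hH a (Finset.mem_insert_self _ _))
      (IsSymbol.sum s fun i hi => hH i (Finset.mem_insert_of_mem hi)),
      ih fun i hi => hH i (Finset.mem_insert_of_mem hi)]

lemma fourSym_tensorSymbol_zero (f : SchwartzTensor n) :
    fourSym (tensorSymbol f 0) = quadSym fun i j => fourS (f.comp i j) := by
  have h (i j : Fin n) : IsSymbol fun p : E n × E n => ((p.2 i * p.2 j : ℝ) : ℂ) * f.comp i j p.1 :=
    IsSymbol.gen _ (contDiff_coord_mul i j) _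
  simp only [tensorSymbol]
  rw [fourSym_sum _ fun i _ => IsSymbol.sum _ fun j _ => h i j]
  funext p
  refine Finset.sum_congr rfl fun i _ => ?_
  rw [fourSym_sum _ fun j _ => h i j]
  refine Finset.sum_congr rfl fun j _ => ?_
  exact congrFun (IsSymbol.fourSym_gen (fun ξ : E n => ((ξ i * ξ j : ℝ) : ℂ)) (f.comp i j)) p

lemma fourSym_tensorSymbol_succ (f : SchwartzTensor n) (k : ℕ) (p : E n × E n) :
    fourSym (tensorSymbol f (k + 1)) p =
      Complex.I * fderiv ℝ (fourSym (tensorSymbol f k)) p (p.2, 0) :=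
  (isSymbol_tensorSymbol f k).fourSym_inner_mul (fun ξ => ξ) p

end

/-! ### Second derivatives of quadratic symbols -/

section

open scoped LineDeriv FourierTransform ContDiff

/-- The derivative along the combination of the fields `xiField` with constant coefficients `c`. -/
def dirX (c : E n) (H : E n × E n → ℂ) (p : E n × E n) : ℂ :=
  fderiv ℝ H p (-⟪p.1, c⟫ • p.2, c - ⟪p.2, c⟫ • p.2)

/-- The derivative in the first variable along the second. -/
def dirY (H : E n × E n → ℂ) (p : E n × E n) : ℂ := fderiv ℝ H p (p.2, 0)

lemma dirX_eq_sum (c : E n) (H : E n × E n → ℂ) (p : E n × E n) :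
    dirX c H p = ∑ k, ((c k : ℝ) : ℂ) * fderiv ℝ H p (xiField k p) := by
  have h1 (z : E n) : ∑ k, c k * z k = ⟪z, c⟫ := by simp [PiLp.inner_apply]
  have h2 : ((-⟪p.1, c⟫ • p.2, c - ⟪p.2, c⟫ • p.2) : E n × E n) = ∑ k, c k • xiField k p := by
    refine Prod.ext ?_ ?_
    · rw [Prod.fst_sum, ← h1, ← Finset.sum_neg_distrib, Finset.sum_smul]
      simp [xiField, smul_smul]
    · rw [Prod.snd_sum]
      simp only [xiField, Prod.smul_snd, smul_sub, Finset.sum_sub_distrib, smul_smul]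
      rw [← IsSymbol.eq_sum_single c, ← Finset.sum_smul, h1]
  rw [dirX, h2, map_sum]
  simp [Complex.real_smul]

namespace IsSymbol

variable {H K : E n × E n → ℂ}

lemma dirX (hH : IsSymbol H) (c : E n) : IsSymbol (dirX c H) :=
  (sum Finset.univ fun k _ => (hH.fderiv_xiField k).const_mul (c k : ℝ)).congr
    fun p => (dirX_eq_sum c H p).symm

lemma dirY (hH : IsSymbol H) : IsSymbol (dirY H) :=
  hH.fderiv_apply (fun p => p.2) (fun _ => 0) (fun a _ hK => hK.coord_snd_mul a)
    fun a _ _ => zero.congr fun p => by simp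

lemma dirX_add (hH : IsSymbol H) (hK : IsSymbol K) (c : E n) :
    MomentumRay.dirX c (fun p => H p + K p) = fun p => MomentumRay.dirX c H p + MomentumRay.dirX c K p :=
  funext fun p => fderiv_add hH hK p _

lemma dirY_add (hH : IsSymbol H) (hK : IsSymbol K) :
    MomentumRay.dirY (fun p => H p + K p) = fun p => MomentumRay.dirY H p + MomentumRay.dirY K p :=
  funext fun p => fderiv_add hH hK p _

lemma map_sum_of_add {ι : Type*} (s : Finset ι) {H : ι → E n × E n → ℂ}
    (hH : ∀ i ∈ s, IsSymbol (H i)) (T : (E n × E n → ℂ) → ℂ)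
    (hT : ∀ H K, IsSymbol H → IsSymbol K → T (fun p => H p + K p) = T H + T K) :
    T (fun p => ∑ i ∈ s, H i p) = ∑ i ∈ s, T (H i) := by
  classical
  induction s using Finset.induction_on with
  | empty =>
    -- From `T 0 = T 0 + T 0` it follows that `T 0 = 0`; additivity is assumed on symbols only,
    -- where derivatives are additive.
    have := hT _ _ (zero (n := n)) zero
    simpa using this
  | insert a s ha ih =>
    simp only [Finset.sum_insert ha]
    rw [hT _ _ (hH a (Finset.mem_insert_self _ _))
      (IsSymbol.sum s fun i hi => hH i (Finset.mem_insert_of_mem hi)),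
      ih fun i hi => hH i (Finset.mem_insert_of_mem hi)]

lemma fderiv_eq_of_line (hH : IsSymbol H) {p W : E n × E n} {d : ℂ}
    (h : HasDerivAt (fun ε : ℝ => H (p + ε • W)) d 0) : fderiv ℝ H p W = d := by
  have hline : HasDerivAt (fun ε : ℝ => p + ε • W) W 0 := by
    simpa using ((hasDerivAt_id (0 : ℝ)).smul_const W).const_add p
  have h0 : HasFDerivAt H (fderiv ℝ H p) (p + (0 : ℝ) • W) := by
    rw [zero_smul, add_zero]
    exact hH.differentiable.differentiableAt.hasFDerivAt
  exact (h0.comp_hasDerivAt 0 hline).unique h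

end IsSymbol

lemma fderiv_coord_mul (i j : Fin n) (ξ v : E n) :
    fderiv ℝ (fun ξ : E n => ((ξ i * ξ j : ℝ) : ℂ)) ξ v = ((v i * ξ j + ξ i * v j : ℝ) : ℂ) := by
  have hi : HasFDerivAt (fun ξ : E n => ξ i) (EuclideanSpace.proj (𝕜 := ℝ) i) ξ :=
    (EuclideanSpace.proj (𝕜 := ℝ) i).hasFDerivAt
  have hj : HasFDerivAt (fun ξ : E n => ξ j) (EuclideanSpace.proj (𝕜 := ℝ) j) ξ :=
    (EuclideanSpace.proj (𝕜 := ℝ) j).hasFDerivAt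
  have h : HasFDerivAt (fun ξ : E n => ((ξ i * ξ j : ℝ) : ℂ)) _ ξ :=
    Complex.ofRealCLM.hasFDerivAt.comp ξ (hi.mul hj)
  rw [h.fderiv]
  simp
  ring

/-! ### First and second derivatives of a single term `ξᵢ ξⱼ g(y)` -/

section Generator

variable (i j : Fin n) (g : 𝓢(E n, ℂ))

/-- The generator `ξᵢ ξⱼ g(y)`. -/
def coordGen (p : E n × E n) : ℂ := ((p.2 i * p.2 j : ℝ) : ℂ) * g p.1

lemma isSymbol_coordGen : IsSymbol (coordGen i j g) := IsSymbol.gen _ (contDiff_coord_mul i j) g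

lemma dirY_coordGen (p : E n × E n) :
    dirY (coordGen i j g) p = ((p.2 i * p.2 j : ℝ) : ℂ) * fderiv ℝ g p.1 p.2 := by
  unfold dirY coordGen
  rw [IsSymbol.fderiv_gen _ (contDiff_coord_mul i j)]
  simp

lemma dirX_coordGen (c : E n) (p : E n × E n) :
    dirX c (coordGen i j g) p = -(⟪p.1, c⟫ : ℝ) * ((p.2 i * p.2 j : ℝ) : ℂ) * fderiv ℝ g p.1 p.2 +
      ((c i * p.2 j + p.2 i * c j - 2 * ⟪p.2, c⟫ * (p.2 i * p.2 j) : ℝ) : ℂ) * g p.1 := by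
  unfold dirX coordGen
  rw [IsSymbol.fderiv_gen _ (contDiff_coord_mul i j), fderiv_coord_mul, map_smul, Complex.real_smul]
  simp only [PiLp.sub_apply, PiLp.smul_apply, smul_eq_mul]
  push_cast; ring

variable (q : TS n)

lemma hasDerivAt_coord (ξ y : E n) (i : Fin n) :
    HasDerivAt (fun ε : ℝ => (ξ + ε • y) i) (y i) 0 := by
  simpa using ((hasDerivAt_id (0 : ℝ)).mul_const (y i)).const_add (ξ i)

lemma hasDerivAt_coord_mul (ξ y : E n) (i j : Fin n) :
    HasDerivAt (fun ε : ℝ => ((((ξ + ε • y) i * (ξ + ε • y) j : ℝ)) : ℂ))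
      ((y i * ξ j + ξ i * y j : ℝ) : ℂ) 0 := by
  have h := ((hasDerivAt_coord ξ y i).fun_mul (hasDerivAt_coord ξ y j)).ofReal_comp
  simpa using h

lemma hasDerivAt_schwartz_line (g : 𝓢(E n, ℂ)) (y u : E n) :
    HasDerivAt (fun ε : ℝ => g (y + ε • u)) (fderiv ℝ g y u) 0 := by
  have hline : HasDerivAt (fun ε : ℝ => y + ε • u) u 0 := by
    simpa using ((hasDerivAt_id (0 : ℝ)).smul_const u).const_add y
  have h0 : HasFDerivAt g (fderiv ℝ g y) (y + (0 : ℝ) • u) := by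
    rw [zero_smul, add_zero]
    exact g.hasFDerivAt y
  exact h0.comp_hasDerivAt 0 hline

/-- Derivative of `ε ↦ Dg(y + ε u)(ξ + ε v)` at `0`. -/
lemma hasDerivAt_fderiv_line (g : 𝓢(E n, ℂ)) (y u ξ v : E n) :
    HasDerivAt (fun ε : ℝ => fderiv ℝ g (y + ε • u) (ξ + ε • v))
      (fderiv ℝ (∂_{ξ} g : 𝓢(E n, ℂ)) y u + fderiv ℝ g y v) 0 := by
  -- Linearity in the direction splits the function into `∂_ξ g(y + ε u) + ε ∂_v g(y + ε u)`.
  have h1 := hasDerivAt_schwartz_line (∂_{ξ} g) y u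
  have h2 := (Complex.ofRealCLM.hasDerivAt (x := (0 : ℝ))).mul (hasDerivAt_schwartz_line (∂_{v} g) y u)
  have h3 := h1.add h2
  simp only [lineDeriv_apply] at h3
  convert! h3 using 1
  · funext ε
    simp
  · simp

lemma dirX_dirY_coordGen : dirX q.1.1 (dirY (coordGen i j g)) q.1 =
    ((q.1.1 i * q.1.2 j + q.1.2 i * q.1.1 j : ℝ) : ℂ) * fderiv ℝ g q.1.1 q.1.2 +
    ((q.1.2 i * q.1.2 j : ℝ) : ℂ) * (fderiv ℝ g q.1.1 q.1.1 -
      (‖q.1.1‖ ^ 2 : ℝ) * fderiv ℝ (∂_{q.1.2} g : 𝓢(E n, ℂ)) q.1.1 q.1.2) := by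
  have hq : ⟪q.1.2, q.1.1⟫ = 0 := by rw [real_inner_comm]; exact q.inner_eq_zero
  refine (isSymbol_coordGen i j g).dirY.fderiv_eq_of_line ?_
  rw [hq, zero_smul, sub_zero, real_inner_self_eq_norm_sq]
  have h := (hasDerivAt_coord_mul q.1.2 q.1.1 i j).mul
    (hasDerivAt_fderiv_line g q.1.1 (-‖q.1.1‖ ^ 2 • q.1.2) q.1.2 q.1.1)
  convert! h using 1
  · funext ε
    rw [dirY_coordGen]; rfl
  · rw [map_smul, Complex.real_smul]
    simp only [zero_smul, add_zero]
    push_cast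
    ring

lemma dirY_dirY_coordGen : dirY (dirY (coordGen i j g)) q.1 =
    ((q.1.2 i * q.1.2 j : ℝ) : ℂ) * fderiv ℝ (∂_{q.1.2} g : 𝓢(E n, ℂ)) q.1.1 q.1.2 := by
  refine (isSymbol_coordGen i j g).dirY.fderiv_eq_of_line ?_
  have h := (hasDerivAt_coord_mul q.1.2 0 i j).mul
    (hasDerivAt_fderiv_line g q.1.1 q.1.2 q.1.2 0)
  convert! h using 1
  · funext ε
    rw [dirY_coordGen]; rfl
  · simp

/-- The coefficient vector of both derivatives is frozen at `y`, so this is `∑ yₖ yₗ Ξₖ Ξₗ`. Along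
the line of differentiation `⟨·, y⟩` of the first variable stays equal to `|y|²`, which brings back
`dirX (dirY ·)`. -/
lemma dirX_dirX_coordGen : dirX q.1.1 (dirX q.1.1 (coordGen i j g)) q.1 =
    -(‖q.1.1‖ ^ 2 : ℝ) * dirX q.1.1 (dirY (coordGen i j g)) q.1 +
    ((2 * (q.1.1 i * q.1.1 j) - 2 * ‖q.1.1‖ ^ 2 * (q.1.2 i * q.1.2 j) : ℝ) : ℂ) * g q.1.1 -
    (‖q.1.1‖ ^ 2 : ℝ) * ((q.1.1 i * q.1.2 j + q.1.2 i * q.1.1 j : ℝ) : ℂ) *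
      fderiv ℝ g q.1.1 q.1.2 := by
  have hq : ⟪q.1.2, q.1.1⟫ = 0 := by rw [real_inner_comm]; exact q.inner_eq_zero
  refine ((isSymbol_coordGen i j g).dirX q.1.1).fderiv_eq_of_line ?_
  rw [hq, zero_smul, sub_zero, real_inner_self_eq_norm_sq]
  set u : E n := -‖q.1.1‖ ^ 2 • q.1.2 with hu
  have h1 := (hasDerivAt_coord_mul q.1.2 q.1.1 i j).mul
    (hasDerivAt_fderiv_line g q.1.1 u q.1.2 q.1.1)
  have h2 : HasDerivAt (fun ε : ℝ => ((q.1.1 i * (q.1.2 + ε • q.1.1) j +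
      (q.1.2 + ε • q.1.1) i * q.1.1 j - 2 * (ε * ‖q.1.1‖ ^ 2) *
      ((q.1.2 + ε • q.1.1) i * (q.1.2 + ε • q.1.1) j) : ℝ) : ℂ))
      ((q.1.1 i * q.1.1 j + q.1.1 i * q.1.1 j - 2 * ‖q.1.1‖ ^ 2 * (q.1.2 i * q.1.2 j) : ℝ) : ℂ) 0 := by
    refine HasDerivAt.ofReal_comp (f := fun ε : ℝ => q.1.1 i * (q.1.2 + ε • q.1.1) j +
      (q.1.2 + ε • q.1.1) i * q.1.1 j - 2 * (ε * ‖q.1.1‖ ^ 2) *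
      ((q.1.2 + ε • q.1.1) i * (q.1.2 + ε • q.1.1) j)) ?_
    have e1 := (hasDerivAt_coord q.1.2 q.1.1 j).const_mul (q.1.1 i)
    have e2 := (hasDerivAt_coord q.1.2 q.1.1 i).mul_const (q.1.1 j)
    have e3 := (((hasDerivAt_id (0 : ℝ)).mul_const (‖q.1.1‖ ^ 2)).const_mul 2).mul
      ((hasDerivAt_coord q.1.2 q.1.1 i).mul (hasDerivAt_coord q.1.2 q.1.1 j))
    convert! (e1.add e2).sub e3 using 1
    simp
  have h3 := (h1.const_mul (-(‖q.1.1‖ ^ 2 : ℝ) : ℂ)).add (h2.mul (hasDerivAt_schwartz_line g q.1.1 u))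
  rw [dirX_dirY_coordGen]
  convert! h3 using 1
  · funext ε
    rw [dirX_coordGen]
    have e1 : ⟪q.1.1 + ε • u, q.1.1⟫ = ‖q.1.1‖ ^ 2 := by
      rw [inner_add_left, hu, inner_smul_left, inner_smul_left, hq, real_inner_self_eq_norm_sq]
      simp
    have e2 : ⟪q.1.2 + ε • q.1.1, q.1.1⟫ = ε * ‖q.1.1‖ ^ 2 := by
      rw [inner_add_left, inner_smul_left, hq, real_inner_self_eq_norm_sq]
      simp
    simp only [Prod.fst_add, Prod.snd_add, Prod.smul_fst, Prod.smul_snd, e1, e2, Pi.add_apply,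
      Pi.mul_apply]
    ring
  · rw [hu, map_smul, map_smul, Complex.real_smul, Complex.real_smul]
    simp
    ring

end Generator

end

/-! ### Recovering a tensor field from its data -/

section

section Recon

/-- The two directions `(-|y|² ξ, y)` and `|y|² (ξ, 0)` add up to `(0, y)`, so only the
`ξ`-derivative of `ξᵢ ξⱼ` survives. -/
lemma coordGen_recon_one (i j : Fin n) (g : 𝓢(E n, ℂ)) (q : TS n) :
    dirX q.1.1 (coordGen i j g) q.1 + (‖q.1.1‖ ^ 2 : ℝ) * dirY (coordGen i j g) q.1 =
      ((q.1.1 i * q.1.2 j + q.1.2 i * q.1.1 j : ℝ) : ℂ) * g q.1.1 := by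
  have hq : ⟪q.1.2, q.1.1⟫ = 0 := by rw [real_inner_comm]; exact q.inner_eq_zero
  rw [dirX_coordGen, dirY_coordGen, hq, real_inner_self_eq_norm_sq]
  push_cast; ring

/-- This is the second-order analogue: the formal square of the previous operator yields the second
`ξ`-derivative along `y`. The terms with the derivative along `(y, 0)` and with the generator itself
compensate for the variation of the fields. -/
lemma coordGen_recon_two (i j : Fin n) (g : 𝓢(E n, ℂ)) (q : TS n) :
    dirX q.1.1 (dirX q.1.1 (coordGen i j g)) q.1 +
      2 * (‖q.1.1‖ ^ 2 : ℝ) * dirX q.1.1 (dirY (coordGen i j g)) q.1 +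
      (‖q.1.1‖ ^ 4 : ℝ) * dirY (dirY (coordGen i j g)) q.1 -
      (‖q.1.1‖ ^ 2 : ℝ) * fderiv ℝ (coordGen i j g) q.1 (q.1.1, 0) +
      2 * (‖q.1.1‖ ^ 2 : ℝ) * coordGen i j g q.1 =
      2 * ((q.1.1 i * q.1.1 j : ℝ) : ℂ) * g q.1.1 := by
  rw [dirX_dirX_coordGen, dirX_dirY_coordGen, dirY_dirY_coordGen]
  unfold coordGen
  rw [IsSymbol.fderiv_gen _ (contDiff_coord_mul i j), map_zero]
  push_cast; ring

variable (G : Fin n → Fin n → 𝓢(E n, ℂ))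

lemma isSymbol_quadSym : IsSymbol (quadSym G) :=
  IsSymbol.sum _ fun i _ => IsSymbol.sum _ fun j _ => isSymbol_coordGen i j (G i j)

lemma map_quadSym (T : (E n × E n → ℂ) → ℂ)
    (hT : ∀ H K, IsSymbol H → IsSymbol K → T (fun p => H p + K p) = T H + T K) :
    T (quadSym G) = ∑ i, ∑ j, T (coordGen i j (G i j)) := by
  have h1 := IsSymbol.map_sum_of_add (n := n) Finset.univ
    (fun i _ => IsSymbol.sum Finset.univ fun j _ => isSymbol_coordGen i j (G i j)) T hT
  refine h1.trans (Finset.sum_congr rfl fun i _ => ?_)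
  exact IsSymbol.map_sum_of_add Finset.univ (fun j _ => isSymbol_coordGen i j (G i j)) T hT

lemma quadSym_recon_one (hG : ∀ i j, G i j = G j i) (q : TS n) :
    dirX q.1.1 (quadSym G) q.1 + (‖q.1.1‖ ^ 2 : ℝ) * dirY (quadSym G) q.1 =
      2 * bil (fun i j => G i j q.1.1) q.1.1 q.1.2 := by
  rw [map_quadSym G (fun H => dirX q.1.1 H q.1 + (‖q.1.1‖ ^ 2 : ℝ) * dirY H q.1)]
  · simp_rw [coordGen_recon_one]
    rw [two_mul]
    conv_rhs => rw [bil_comm (fun i j => by rw [hG i j])]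
    conv_rhs => enter [2]; rw [bil_comm (fun i j => by rw [hG i j])]
    simp only [bil, ← Finset.sum_add_distrib]
    refine Finset.sum_congr rfl fun i _ => Finset.sum_congr rfl fun j _ => ?_
    push_cast; ring
  · intro H K hH hK
    rw [IsSymbol.dirX_add hH hK, IsSymbol.dirY_add hH hK]
    ring

lemma quadSym_recon_two (q : TS n) :
    dirX q.1.1 (dirX q.1.1 (quadSym G)) q.1 +
      2 * (‖q.1.1‖ ^ 2 : ℝ) * dirX q.1.1 (dirY (quadSym G)) q.1 +
      (‖q.1.1‖ ^ 4 : ℝ) * dirY (dirY (quadSym G)) q.1 -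
      (‖q.1.1‖ ^ 2 : ℝ) * fderiv ℝ (quadSym G) q.1 (q.1.1, 0) +
      2 * (‖q.1.1‖ ^ 2 : ℝ) * quadSym G q.1 =
      2 * bil (fun i j => G i j q.1.1) q.1.1 q.1.1 := by
  rw [map_quadSym G (fun H => dirX q.1.1 (dirX q.1.1 H) q.1 +
      2 * (‖q.1.1‖ ^ 2 : ℝ) * dirX q.1.1 (dirY H) q.1 +
      (‖q.1.1‖ ^ 4 : ℝ) * dirY (dirY H) q.1 -
      (‖q.1.1‖ ^ 2 : ℝ) * fderiv ℝ H q.1 (q.1.1, 0) +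
      2 * (‖q.1.1‖ ^ 2 : ℝ) * H q.1)]
  · simp_rw [coordGen_recon_two]
    simp only [bil, Finset.mul_sum, mul_assoc]
  · intro H K hH hK
    rw [IsSymbol.dirX_add hH hK, IsSymbol.dirY_add hH hK,
      IsSymbol.dirX_add (hH.dirX _) (hK.dirX _), IsSymbol.dirY_add hH.dirY hK.dirY,
      IsSymbol.dirX_add hH.dirY hK.dirY, IsSymbol.fderiv_add hH hK]
    ring

end Recon

variable {H : E n × E n → ℂ}

lemma dirX_dirX_eq_sum (hH : IsSymbol H) (c : E n) (p : E n × E n) :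
    dirX c (dirX c H) p = ∑ k, ∑ l, ((c k : ℝ) : ℂ) * ((c l : ℝ) : ℂ) *
      fderiv ℝ (fun p => fderiv ℝ H p (xiField l p)) p (xiField k p) := by
  rw [dirX_eq_sum]
  refine Finset.sum_congr rfl fun k _ => ?_
  rw [funext (dirX_eq_sum c H)]
  have h1 := IsSymbol.map_sum_of_add Finset.univ
    (fun l _ => (hH.fderiv_xiField l).const_mul ((c l : ℝ) : ℂ))
    (fun K => fderiv ℝ K p (xiField k p)) (fun H K hH hK => IsSymbol.fderiv_add hH hK p _)
  rw [h1, Finset.mul_sum]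
  refine Finset.sum_congr rfl fun l _ => ?_
  rw [fderiv_const_mul (hH.fderiv_xiField l).differentiable.differentiableAt, mul_assoc]
  rfl

/-- As `y ⟂ ξ`, `y = ∑ yₖ (eₖ - ξₖ ξ)`; these directions are the ones seen by the data `xₖ I⁰f`. -/
lemma fderiv_fst_eq_sum (H : E n × E n → ℂ) (q : TS n) :
    fderiv ℝ H q.1 (q.1.1, 0) = ∑ k, ((q.1.1 k : ℝ) : ℂ) *
      fderiv ℝ H q.1 (EuclideanSpace.single k (1 : ℝ) - q.1.2 k • q.1.2, 0) := by
  have h1 : ∑ k, q.1.1 k * q.1.2 k = 0 := by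
    have := q.inner_eq_zero
    rw [PiLp.inner_apply] at this
    simpa [mul_comm] using this
  have h2 : ((q.1.1, 0) : E n × E n) =
      ∑ k, q.1.1 k • ((EuclideanSpace.single k (1 : ℝ) - q.1.2 k • q.1.2, 0) : E n × E n) := by
    refine Prod.ext ?_ ?_
    · rw [Prod.fst_sum]
      simp only [Prod.smul_fst, smul_sub, Finset.sum_sub_distrib, smul_smul]
      rw [← IsSymbol.eq_sum_single, ← Finset.sum_smul, h1]
      simp
    · rw [Prod.snd_sum]; simp
  conv_lhs => rw [h2]
  rw [map_sum]
  refine Finset.sum_congr rfl fun k _ => ?_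
  rw [map_smul, Complex.real_smul]

lemma abs_coord_le (y : E n) (k : Fin n) : |y k| ≤ ‖y‖ := by
  rw [← Real.norm_eq_abs]; exact PiLp.norm_apply_le y k

lemma norm_sum_coord_mul_le (y : E n) (b : Fin n → ℂ) :
    ‖∑ k, ((y k : ℝ) : ℂ) * b k‖ ≤ ‖y‖ * ∑ k, ‖b k‖ := by
  rw [Finset.mul_sum]
  refine (norm_sum_le _ _).trans (Finset.sum_le_sum fun k _ => ?_)
  rw [norm_mul, Complex.norm_real]
  gcongr
  exact abs_coord_le y k

/-- The symbol of `Z`. -/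
def zSymbol (H : E n × E n → ℂ) (p : E n × E n) : ℂ :=
  ∑ i : Fin n, ((p.1 i / ‖p.1‖ : ℝ) : ℂ) * fderiv ℝ H p (xiField i p)

lemma dirX_eq_zSymbol (p : E n × E n) (hp : p.1 ≠ 0) :
    dirX p.1 H p = (‖p.1‖ : ℝ) * zSymbol H p := by
  have h0 : (‖p.1‖ : ℂ) ≠ 0 := by exact_mod_cast norm_ne_zero_iff.mpr hp
  rw [dirX_eq_sum, zSymbol, Finset.mul_sum]
  refine Finset.sum_congr rfl fun k _ => ?_
  push_cast
  field_simp

/-- The sum of squares, at a point of `TSⁿ⁻¹`, of the data on the Fourier side. -/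
def dataDensity (H : E n × E n → ℂ) (p : E n × E n) : ℝ :=
  ‖H p‖ ^ 2 + ∑ k, ‖fderiv ℝ H p (xiField k p)‖ ^ 2 +
    ∑ k, ∑ l, ‖fderiv ℝ (fun p => fderiv ℝ H p (xiField l p)) p (xiField k p)‖ ^ 2 +
    ‖p.1‖ ^ 2 * (‖dirY H p‖ ^ 2 + ‖zSymbol (dirY H) p‖ ^ 2 +
      ∑ k, ‖fderiv ℝ H p (EuclideanSpace.single k (1 : ℝ) - p.2 k • p.2, 0)‖ ^ 2) +
    ‖p.1‖ ^ 4 * ‖dirY (dirY H) p‖ ^ 2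

lemma sq_sum_le_card (b : Fin n → ℝ) : (∑ k, b k) ^ 2 ≤ n * ∑ k, b k ^ 2 := by
  simpa using sq_sum_le_card_mul_sum_sq (s := Finset.univ) (f := b)

/-- The elementary inequality that turns the bounds of a frame component by the data into a bound
of the squares. -/
lemma frame_bound {A B F r b x c d z w Tb Tx Tc N : ℝ} (hA : 0 ≤ A) (hB : 0 ≤ B)
    (hTb : 0 ≤ Tb) (hTx : 0 ≤ Tx) (hTc : 0 ≤ Tc) (hN : 1 ≤ N)
    (n2 : 2 * A ≤ b + r * d) (n3 : 2 * B ≤ c + 2 * r * z + r ^ 2 * w + r * x + 2 * F)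
    (s1 : b ^ 2 ≤ N * Tb) (s2 : x ^ 2 ≤ N * Tx) (s3 : c ^ 2 ≤ N * Tc) :
    B ^ 2 + A ^ 2 + F ^ 2 ≤ 10 * N * (F ^ 2 + Tb + Tc + r ^ 2 * (d ^ 2 + z ^ 2 + Tx) +
      r ^ 4 * w ^ 2) := by
  have q2 : 4 * A ^ 2 ≤ 2 * b ^ 2 + 2 * (r ^ 2 * d ^ 2) := by
    have := pow_le_pow_left₀ (by positivity) n2 2
    nlinarith [sq_nonneg (b - r * d)]
  -- After squaring and dividing by `4`, the largest coefficient on the right is `6`, that of `F²`;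
  -- the constant `10` leaves room.
  have five (a b c d e : ℝ) :
      (a + b + c + d + e) ^ 2 ≤ 5 * (a ^ 2 + b ^ 2 + c ^ 2 + d ^ 2 + e ^ 2) := by
    nlinarith [sq_nonneg (a - b), sq_nonneg (a - c), sq_nonneg (a - d), sq_nonneg (a - e),
      sq_nonneg (b - c), sq_nonneg (b - d), sq_nonneg (b - e), sq_nonneg (c - d),
      sq_nonneg (c - e), sq_nonneg (d - e)]
  have q3 := (pow_le_pow_left₀ (by positivity) n3 2).trans (five _ _ _ _ _)
  simp only [mul_pow] at q3
  have hp (u : ℝ) (hu : 0 ≤ u) : u ≤ N * u := le_mul_of_one_le_left hu hN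
  have m1 := hp (F ^ 2) (by positivity)
  have m2 := hp (r ^ 2 * d ^ 2) (by positivity)
  have m3 := hp (r ^ 2 * z ^ 2) (by positivity)
  have m4 := hp ((r ^ 2) ^ 2 * w ^ 2) (by positivity)
  have m5 : r ^ 2 * x ^ 2 ≤ N * (r ^ 2 * Tx) := by
    calc r ^ 2 * x ^ 2 ≤ r ^ 2 * (N * Tx) := by gcongr
      _ = _ := by ring
  have m6 : 0 ≤ N * Tb := by positivity
  have m7 : 0 ≤ N * Tc := by positivity
  have m8 : 0 ≤ N * (r ^ 2 * Tx) := by positivity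
  have m9 : 0 ≤ N * (r ^ 2 * d ^ 2) := by positivity
  have m10 : 0 ≤ N * (r ^ 2 * z ^ 2) := by positivity
  have m11 : 0 ≤ N * ((r ^ 2) ^ 2 * w ^ 2) := by positivity
  have m12 : 0 ≤ N * F ^ 2 := by positivity
  have expand : 10 * N * (F ^ 2 + Tb + Tc + r ^ 2 * (d ^ 2 + z ^ 2 + Tx) + r ^ 4 * w ^ 2) =
      10 * (N * F ^ 2) + 10 * (N * Tb) + 10 * (N * Tc) + 10 * (N * (r ^ 2 * d ^ 2)) +
      10 * (N * (r ^ 2 * z ^ 2)) + 10 * (N * (r ^ 2 * Tx)) +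
      10 * (N * ((r ^ 2) ^ 2 * w ^ 2)) := by ring
  rw [expand]
  linarith

set_option maxHeartbeats 1000000 in
-- The two reconstruction identities are divided by `|y|` and `|y|²`, using `|yₖ| ≤ |y|` to absorb
-- the coefficients. Cauchy–Schwarz on at most `n²` summands produces `n²`.
lemma framePart_le_dataDensity (hn : 1 ≤ n) (G : Fin n → Fin n → 𝓢(E n, ℂ))
    (hG : ∀ i j, G i j = G j i) (q : TS n) (hq : q.1.1 ≠ 0) :
    framePart (fun i j => G i j q.1.1) (‖q.1.1‖⁻¹ • q.1.1) q.1.2 ≤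
      10 * n ^ 2 * dataDensity (quadSym G) q.1 := by
  set r := ‖q.1.1‖ with hr
  have hr0 : 0 < r := norm_pos_iff.mpr hq
  set M : Fin n → Fin n → ℂ := fun i j => G i j q.1.1
  have hM : ∀ i j, M i j = M j i := fun i j => by simp only [M]; rw [hG i j]
  set Φ := quadSym G with hΦ
  set b : Fin n → ℂ := fun k => fderiv ℝ Φ q.1 (xiField k q.1) with hb
  set c : Fin n → Fin n → ℂ := fun k l =>
    fderiv ℝ (fun p => fderiv ℝ Φ p (xiField l p)) q.1 (xiField k q.1) with hc
  set x : Fin n → ℂ := fun k =>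
    fderiv ℝ Φ q.1 (EuclideanSpace.single k (1 : ℝ) - q.1.2 k • q.1.2, 0) with hx
  have hsym : IsSymbol Φ := isSymbol_quadSym G
  have e1 : bil M q.1.2 q.1.2 = Φ q.1 := rfl
  have e2 := quadSym_recon_one G hG q
  have e3 := quadSym_recon_two G q
  rw [← hΦ, dirX_eq_sum] at e2
  rw [← hΦ, dirX_dirX_eq_sum hsym, dirX_eq_zSymbol _ hq, fderiv_fst_eq_sum, ← e1] at e3
  rw [← hr] at e2 e3
  have hnorm (a : ℝ) (ha : 0 ≤ a) (z : ℂ) : ‖(a : ℂ) * z‖ = a * ‖z‖ := by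
    rw [norm_mul, Complex.norm_real, Real.norm_of_nonneg ha]
  have n2 : 2 * ‖bil M (r⁻¹ • q.1.1) q.1.2‖ ≤ (∑ k, ‖b k‖) + r * ‖dirY Φ q.1‖ := by
    rw [bil_smul_left, hnorm _ (by positivity)]
    have h1 : 2 * ‖bil M q.1.1 q.1.2‖ ≤ r * (∑ k, ‖b k‖) + r ^ 2 * ‖dirY Φ q.1‖ := by
      calc 2 * ‖bil M q.1.1 q.1.2‖ = ‖2 * bil M q.1.1 q.1.2‖ := by simp
        _ ≤ _ := by
          rw [← e2]
          refine (norm_add_le _ _).trans (add_le_add (norm_sum_coord_mul_le _ _) (le_of_eq ?_))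
          rw [hnorm _ (by positivity)]
    calc 2 * (r⁻¹ * ‖bil M q.1.1 q.1.2‖) = r⁻¹ * (2 * ‖bil M q.1.1 q.1.2‖) := by ring
      _ ≤ r⁻¹ * (r * (∑ k, ‖b k‖) + r ^ 2 * ‖dirY Φ q.1‖) := by gcongr
      _ = _ := by field_simp
  have n3 : 2 * ‖bil M (r⁻¹ • q.1.1) (r⁻¹ • q.1.1)‖ ≤ (∑ k, ∑ l, ‖c k l‖) +
      2 * r * ‖zSymbol (dirY Φ) q.1‖ + r ^ 2 * ‖dirY (dirY Φ) q.1‖ + r * (∑ k, ‖x k‖) +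
      2 * ‖Φ q.1‖ := by
    rw [bil_smul_left, bil_comm hM, bil_smul_left, hnorm _ (by positivity), hnorm _ (by positivity)]
    have h1 : 2 * ‖bil M q.1.1 q.1.1‖ ≤ r ^ 2 * (∑ k, ∑ l, ‖c k l‖) +
        2 * r ^ 2 * (r * ‖zSymbol (dirY Φ) q.1‖) + r ^ 4 * ‖dirY (dirY Φ) q.1‖ +
        r ^ 2 * (r * ∑ k, ‖x k‖) + 2 * r ^ 2 * ‖Φ q.1‖ := by
      calc 2 * ‖bil M q.1.1 q.1.1‖ = ‖2 * bil M q.1.1 q.1.1‖ := by simp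
        _ ≤ _ := by
          rw [← e3]
          refine (norm_add_le _ _).trans (add_le_add ((norm_sub_le _ _).trans (add_le_add
            ((norm_add_le _ _).trans (add_le_add ((norm_add_le _ _).trans (add_le_add ?_ ?_)) ?_))
            ?_)) ?_)
          · simp_rw [mul_assoc, ← Finset.mul_sum]
            refine (norm_sum_coord_mul_le _ _).trans ?_
            rw [← hr, pow_two, mul_assoc]
            gcongr
            rw [Finset.mul_sum]
            exact Finset.sum_le_sum fun k _ => norm_sum_coord_mul_le _ _
          · rw [mul_assoc, norm_mul, hnorm _ (by positivity), hnorm _ (by positivity)]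
            simp [mul_assoc]
          · rw [hnorm _ (by positivity)]
          · rw [hnorm _ (by positivity)]
            gcongr
            exact norm_sum_coord_mul_le _ _
          · rw [mul_assoc, norm_mul, hnorm _ (by positivity), e1]
            simp [mul_assoc]
    calc 2 * (r⁻¹ * (r⁻¹ * ‖bil M q.1.1 q.1.1‖)) = r⁻¹ * r⁻¹ * (2 * ‖bil M q.1.1 q.1.1‖) := by ring
      _ ≤ r⁻¹ * r⁻¹ * (r ^ 2 * (∑ k, ∑ l, ‖c k l‖) +
        2 * r ^ 2 * (r * ‖zSymbol (dirY Φ) q.1‖) + r ^ 4 * ‖dirY (dirY Φ) q.1‖ +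
        r ^ 2 * (r * ∑ k, ‖x k‖) + 2 * r ^ 2 * ‖Φ q.1‖) := by gcongr
      _ = _ := by field_simp
  have hN : (1 : ℝ) ≤ n := by exact_mod_cast hn
  have hN2 : (n : ℝ) ≤ n ^ 2 := by nlinarith
  have s1 : (∑ k, ‖b k‖) ^ 2 ≤ n ^ 2 * ∑ k, ‖b k‖ ^ 2 :=
    (sq_sum_le_card _).trans (by gcongr)
  have s2 : (∑ k, ‖x k‖) ^ 2 ≤ n ^ 2 * ∑ k, ‖x k‖ ^ 2 :=
    (sq_sum_le_card _).trans (by gcongr)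
  have s3 : (∑ k, ∑ l, ‖c k l‖) ^ 2 ≤ n ^ 2 * ∑ k, ∑ l, ‖c k l‖ ^ 2 := by
    refine (sq_sum_le_card _).trans ?_
    rw [pow_two (n : ℝ), mul_assoc]
    gcongr
    rw [Finset.mul_sum]
    exact Finset.sum_le_sum fun k _ => sq_sum_le_card _
  have p1 : 0 ≤ ∑ k, ‖b k‖ ^ 2 := Finset.sum_nonneg fun _ _ => sq_nonneg _
  have p2 : 0 ≤ ∑ k, ‖x k‖ ^ 2 := Finset.sum_nonneg fun _ _ => sq_nonneg _
  have p3 : 0 ≤ ∑ k, ∑ l, ‖c k l‖ ^ 2 :=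
    Finset.sum_nonneg fun _ _ => Finset.sum_nonneg fun _ _ => sq_nonneg _
  exact frame_bound (norm_nonneg _) (norm_nonneg _) p1 p2 p3 (hN.trans hN2) n2 n3 s1 s2 s3

end

/-! ### The data on the Fourier side -/

section

/-- The integral over `TSⁿ⁻¹` of a function on `ℝⁿ × ℝⁿ`. -/
def tsInt (h : E n × E n → ℝ≥0∞) : ℝ≥0∞ :=
  ∫⁻ ξ : Sph n, ∫⁻ y : (ℝ ∙ (ξ : E n))ᗮ, h (y, ξ) ∂(perpMeasure ξ) ∂(sphereMeasure n)

lemma tsInt_eq_perpInt {h : E n × E n → ℝ≥0∞} (hh : Measurable h) :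
    tsInt h = ∫⁻ ξ : Sph n, perpInt h ξ ∂(sphereMeasure n) :=
  lintegral_congr fun ξ => lintegral_perp_eq_perpInt hh ξ

lemma measurable_slice {h : E n × E n → ℝ≥0∞} (hh : Measurable h) (ξ : Sph n) :
    Measurable fun y : (ℝ ∙ (ξ : E n))ᗮ => h (y, ξ) :=
  hh.comp (measurable_subtype_coe.prodMk measurable_const)

lemma measurable_perpInt_sphere {h : E n × E n → ℝ≥0∞} (hh : Measurable h) :
    Measurable fun ξ : Sph n => perpInt h ξ :=
  (measurable_perpInt hh).comp measurable_subtype_coe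

lemma tsInt_add {h k : E n × E n → ℝ≥0∞} (hh : Measurable h) (hk : Measurable k) :
    tsInt (fun p => h p + k p) = tsInt h + tsInt k := by
  have h1 : tsInt (fun p => h p + k p) =
      ∫⁻ ξ : Sph n, (perpInt h ξ + perpInt k ξ) ∂(sphereMeasure n) := by
    refine lintegral_congr fun ξ => ?_
    rw [lintegral_add_left (measurable_slice hh ξ), lintegral_perp_eq_perpInt hh,
      lintegral_perp_eq_perpInt hk]
  rw [h1, lintegral_add_left (measurable_perpInt_sphere hh), tsInt_eq_perpInt hh,
    tsInt_eq_perpInt hk]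

lemma tsInt_zero : tsInt (fun _ : E n × E n => 0) = 0 := by simp [tsInt]

lemma tsInt_sum {ι : Type*} (s : Finset ι) {h : ι → E n × E n → ℝ≥0∞}
    (hh : ∀ i, Measurable (h i)) : tsInt (fun p => ∑ i ∈ s, h i p) = ∑ i ∈ s, tsInt (h i) := by
  classical
  induction s using Finset.induction_on with
  | empty => simp [tsInt_zero]
  | insert a s ha ih =>
    simp only [Finset.sum_insert ha]
    rw [tsInt_add (hh a) (Finset.measurable_fun_sum _ fun i _ => hh i), ih]

lemma tsInt_const_mul (c : ℝ≥0∞) {h : E n × E n → ℝ≥0∞} (hh : Measurable h) :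
    tsInt (fun p => c * h p) = c * tsInt h := by
  have h1 : tsInt (fun p => c * h p) = ∫⁻ ξ : Sph n, c * perpInt h ξ ∂(sphereMeasure n) := by
    refine lintegral_congr fun ξ => ?_
    rw [lintegral_const_mul _ (measurable_slice hh ξ), lintegral_perp_eq_perpInt hh]
  rw [h1, lintegral_const_mul _ (measurable_perpInt_sphere hh), tsInt_eq_perpInt hh]

/-- For `n ≥ 2` the origin is a null set of `ξ^⊥`, so comparisons are needed only where division by
`|y|` makes sense. -/
lemma tsInt_mono (hn : 2 ≤ n) {h k : E n × E n → ℝ≥0∞}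
    (hhk : ∀ q : TS n, q.1.1 ≠ 0 → h q.1 ≤ k q.1) : tsInt h ≤ tsInt k := by
  refine lintegral_mono fun ξ => lintegral_mono_ae ?_
  have : Nontrivial (ℝ ∙ (ξ : E n))ᗮ := nontrivial_perp hn ξ
  have h0 : ∀ᵐ y ∂(perpMeasure ξ), y ≠ 0 := by
    simp only [ae_iff, not_not, Set.ofPred_eq_eq_singleton]
    unfold perpMeasure
    exact measure_singleton _
  filter_upwards [h0] with y hy
  exact hhk (TS.mk ξ y) (by simpa [TS.mk] using hy)

lemma tsInt_congr (hn : 2 ≤ n) {h k : E n × E n → ℝ≥0∞}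
    (hhk : ∀ q : TS n, q.1.1 ≠ 0 → h q.1 = k q.1) : tsInt h = tsInt k :=
  le_antisymm (tsInt_mono hn fun q hq => (hhk q hq).le) (tsInt_mono hn fun q hq => (hhk q hq).ge)

/-- The weighted square norm of a function on `TSⁿ⁻¹` that is, up to a constant, the restriction of
a function on `ℝⁿ × ℝⁿ`. -/
lemma weightedSqTS_eq_tsInt (s t : ℝ) {v : TS n → ℂ} {V : E n × E n → ℂ} (hV : Measurable V)
    (h : ∀ q, ‖v q‖ = (2 * Real.pi) ^ (1 / 2 : ℝ) * ‖V q.1‖) :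
    weightedSqTS s t v = tsInt fun p => weight s t ‖p.1‖ * ‖V p‖ₑ ^ 2 := by
  have hw : Measurable fun p : E n × E n => weight s t ‖p.1‖ := by
    unfold weight; fun_prop
  have hm : Measurable fun p : E n × E n => weight s t ‖p.1‖ * ‖V p‖ₑ ^ 2 := by fun_prop
  have h1 (q : TS n) : ‖v q‖ₑ ^ 2 = ENNReal.ofReal (2 * Real.pi) * ‖V q.1‖ₑ ^ 2 := by
    -- The slice constant squares to `2π`, which the prefactor `(2π)⁻¹` of the norm on `TSⁿ⁻¹`
    -- cancels.
    rw [enorm_sq_eq_ofReal, enorm_sq_eq_ofReal, h, ← ENNReal.ofReal_mul (by positivity), mul_pow,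
      ← Real.rpow_natCast, ← Real.rpow_mul (by positivity)]
    norm_num
  have h2 : (∫⁻ ξ : Sph n, ∫⁻ y : (ℝ ∙ (ξ : E n))ᗮ,
      weight s t ‖(y : E n)‖ * ‖v (TS.mk ξ y)‖ₑ ^ 2 ∂(perpMeasure ξ) ∂(sphereMeasure n)) =
      tsInt fun p => ENNReal.ofReal (2 * Real.pi) * (weight s t ‖p.1‖ * ‖V p‖ₑ ^ 2) := by
    refine lintegral_congr fun ξ => lintegral_congr fun y => ?_
    rw [h1, mul_left_comm]; rfl
  unfold weightedSqTS
  rw [h2, tsInt_const_mul _ hm, ← mul_assoc, ← ENNReal.ofReal_mul (by positivity),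
    inv_mul_cancel₀ (by positivity), ENNReal.ofReal_one, one_mul]

/-- Raising both orders by `k` leaves `s - t` unchanged and multiplies the weight by `r^(2k)`. This
brings all data terms to the common orders `s + 1/2`, `t + 1/2`. -/
lemma weight_add (s t a : ℝ) (k : ℕ) {r : ℝ} (hr : 0 < r) :
    weight (s + (a + k)) (t + (a + k)) r = weight (s + a) (t + a) r * ENNReal.ofReal r ^ (2 * k) := by
  unfold weight
  rw [← ENNReal.ofReal_pow hr.le, ← ENNReal.ofReal_mul (by positivity)]
  congr 1
  have h1 : r ^ (2 * (t + (a + k))) = r ^ (2 * (t + a)) * r ^ (2 * k) := by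
    rw [← Real.rpow_natCast, ← Real.rpow_add hr]; push_cast; ring_nf
  have h2 : s + (a + k) - (t + (a + k)) = s - t := by ring
  have h3 : s + a - (t + a) = s - t := by ring
  rw [h1, h2, h3]; ring

/-- The density of the data on the Fourier side. -/
def eData (H : E n × E n → ℂ) (p : E n × E n) : ℝ≥0∞ :=
  ENNReal.ofReal ‖p.1‖ ^ 4 * ‖dirY (dirY H) p‖ₑ ^ 2
    + ∑ i, ENNReal.ofReal ‖p.1‖ ^ 2 * ‖fderiv ℝ (dirY H) p (xiField i p)‖ₑ ^ 2
    + ENNReal.ofReal ‖p.1‖ ^ 2 * ‖dirY H p‖ₑ ^ 2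
    + ENNReal.ofReal ‖p.1‖ ^ 2 * ‖zSymbol (dirY H) p‖ₑ ^ 2
    + ∑ i, ENNReal.ofReal ‖p.1‖ ^ 2 *
        ‖fderiv ℝ H p (EuclideanSpace.single i (1 : ℝ) - p.2 i • p.2, 0)‖ₑ ^ 2
    + ∑ i, ∑ j, ‖fderiv ℝ (fun p => fderiv ℝ H p (xiField j p)) p (xiField i p)‖ₑ ^ 2
    + ‖H p‖ₑ ^ 2
    + ∑ i, ‖fderiv ℝ H p (xiField i p)‖ₑ ^ 2

lemma ofReal_dataDensity_le (H : E n × E n → ℂ) (p : E n × E n) :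
    ENNReal.ofReal (dataDensity H p) ≤ eData H p := by
  have h1 : ENNReal.ofReal (dataDensity H p) = ‖H p‖ₑ ^ 2 +
      ∑ k, ‖fderiv ℝ H p (xiField k p)‖ₑ ^ 2 +
      ∑ k, ∑ l, ‖fderiv ℝ (fun p => fderiv ℝ H p (xiField l p)) p (xiField k p)‖ₑ ^ 2 +
      ENNReal.ofReal ‖p.1‖ ^ 2 * (‖dirY H p‖ₑ ^ 2 + ‖zSymbol (dirY H) p‖ₑ ^ 2 +
      ∑ k, ‖fderiv ℝ H p (EuclideanSpace.single k (1 : ℝ) - p.2 k • p.2, 0)‖ₑ ^ 2) +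
      ENNReal.ofReal ‖p.1‖ ^ 4 * ‖dirY (dirY H) p‖ₑ ^ 2 := by
    have hs {b : Fin n → ℂ} : ENNReal.ofReal (∑ k, ‖b k‖ ^ 2) = ∑ k, ‖b k‖ₑ ^ 2 := by
      rw [ENNReal.ofReal_sum_of_nonneg fun _ _ => sq_nonneg _]
      simp only [enorm_sq_eq_ofReal]
    have hss {b : Fin n → Fin n → ℂ} :
        ENNReal.ofReal (∑ k, ∑ l, ‖b k l‖ ^ 2) = ∑ k, ∑ l, ‖b k l‖ₑ ^ 2 := by
      rw [ENNReal.ofReal_sum_of_nonneg fun _ _ => Finset.sum_nonneg fun _ _ => sq_nonneg _]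
      simp only [hs]
    unfold dataDensity
    rw [ENNReal.ofReal_add (by positivity) (by positivity),
      ENNReal.ofReal_add (by positivity) (by positivity),
      ENNReal.ofReal_add (by positivity) (by positivity),
      ENNReal.ofReal_add (by positivity) (by positivity),
      ENNReal.ofReal_mul (by positivity), ENNReal.ofReal_mul (by positivity),
      ENNReal.ofReal_add (by positivity) (by positivity),
      ENNReal.ofReal_add (by positivity) (by positivity), hs, hs, hss]
    simp only [enorm_sq_eq_ofReal, ENNReal.ofReal_pow (norm_nonneg _)]
  rw [h1]
  unfold eData
  simp only [← Finset.mul_sum]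
  -- The surplus is the contribution of `Ξᵢ(I¹f)`: the reconstruction uses only its radial
  -- combination, which is the `Z` term.
  refine le_iff_exists_add.mpr ⟨ENNReal.ofReal ‖p.1‖ ^ 2 *
    ∑ i, ‖fderiv ℝ (dirY H) p (xiField i p)‖ₑ ^ 2, ?_⟩
  ring

lemma tsInt_mul_sum {ι : Type*} [Fintype ι] {w A₁ A₃ A₄ A₇ : E n × E n → ℝ≥0∞}
    {A₂ A₅ A₈ : ι → E n × E n → ℝ≥0∞} {A₆ : ι → ι → E n × E n → ℝ≥0∞} (hw : Measurable w)
    (h₁ : Measurable A₁) (h₂ : ∀ i, Measurable (A₂ i)) (h₃ : Measurable A₃) (h₄ : Measurable A₄)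
    (h₅ : ∀ i, Measurable (A₅ i)) (h₆ : ∀ i j, Measurable (A₆ i j)) (h₇ : Measurable A₇)
    (h₈ : ∀ i, Measurable (A₈ i)) :
    (tsInt fun p => w p * (A₁ p + ∑ i, A₂ i p + A₃ p + A₄ p + ∑ i, A₅ i p + ∑ i, ∑ j, A₆ i j p +
      A₇ p + ∑ i, A₈ i p)) =
    (tsInt fun p => w p * A₁ p) + ∑ i, (tsInt fun p => w p * A₂ i p) + (tsInt fun p => w p * A₃ p) +
      (tsInt fun p => w p * A₄ p) + ∑ i, (tsInt fun p => w p * A₅ i p) +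
      ∑ i, ∑ j, (tsInt fun p => w p * A₆ i j p) + (tsInt fun p => w p * A₇ p) +
      ∑ i, (tsInt fun p => w p * A₈ i p) := by
  simp only [mul_add, Finset.mul_sum]
  rw [tsInt_add (by fun_prop) (by fun_prop), tsInt_add (by fun_prop) (by fun_prop),
    tsInt_add (by fun_prop) (by fun_prop), tsInt_add (by fun_prop) (by fun_prop),
    tsInt_add (by fun_prop) (by fun_prop), tsInt_add (by fun_prop) (by fun_prop),
    tsInt_add (by fun_prop) (by fun_prop), tsInt_sum _ (by fun_prop), tsInt_sum _ (by fun_prop),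
    tsInt_sum _ (by fun_prop), tsInt_sum _ (by fun_prop)]
  congr 3
  refine Finset.sum_congr rfl fun i _ => ?_
  rw [tsInt_sum _ (by fun_prop)]

/-! ### Identification of the data terms on the Fourier side -/

section Data

variable (f : SchwartzTensor n)

/-- The Fourier transform of `I⁰f`, as a function on `ℝⁿ × ℝⁿ`. -/
def dataSymbol : E n × E n → ℂ := quadSym fun i j => fourS (f.comp i j)

lemma isSymbol_dataSymbol : IsSymbol (dataSymbol f) := isSymbol_quadSym _

lemma fourSym_zero : fourSym (tensorSymbol f 0) = dataSymbol f := fourSym_tensorSymbol_zero f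

lemma fourSym_one : fourSym (tensorSymbol f 1) = fun p => Complex.I * dirY (dataSymbol f) p := by
  funext p
  rw [fourSym_tensorSymbol_succ, fourSym_zero]; rfl

lemma fourSym_two : fourSym (tensorSymbol f 2) = fun p => -dirY (dirY (dataSymbol f)) p := by
  funext p
  rw [fourSym_tensorSymbol_succ, fourSym_one,
    fderiv_const_mul (isSymbol_dataSymbol f).dirY.differentiable.differentiableAt]
  change Complex.I * (Complex.I * dirY (dirY (dataSymbol f)) p) = _
  rw [← mul_assoc, Complex.I_mul_I, neg_one_mul]

lemma norm_two_pi : ‖(((2 * Real.pi) ^ (1 / 2 : ℝ) : ℝ) : ℂ)‖ = (2 * Real.pi) ^ (1 / 2 : ℝ) := by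
  rw [Complex.norm_real, Real.norm_of_nonneg (by positivity)]

lemma normSqTS_ray (s t : ℝ) {H V : E n × E n → ℂ} (hH : IsSymbol H) (hV : Measurable V)
    (h : ∀ q : TS n, ‖fourSym H q.1‖ = ‖V q.1‖) :
    normSqTS s t (ray H) = tsInt fun p => weight s t ‖p.1‖ * ‖V p‖ₑ ^ 2 := by
  refine weightedSqTS_eq_tsInt s t hV fun q => ?_
  rw [fourierTS_ray hH, norm_mul, norm_two_pi, h]

lemma IsSymbol.measurable {H : E n × E n → ℂ} (hH : IsSymbol H) : Measurable H :=
  hH.contDiff.continuous.measurable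

lemma IsSymbol.fderiv_tangent {H : E n × E n → ℂ} (hH : IsSymbol H) (i : Fin n) :
    IsSymbol fun p => fderiv ℝ H p (EuclideanSpace.single i (1 : ℝ) - p.2 i • p.2, 0) :=
  hH.fderiv_apply _ (fun _ => 0) (fun a _ hK => hK.tangent_mul i a)
    fun a _ _ => zero.congr fun p => by simp

lemma measurable_zSymbol {H : E n × E n → ℂ} (hH : IsSymbol H) : Measurable (zSymbol H) := by
  have h1 (i : Fin n) : Measurable fun p : E n × E n => ((p.1 i / ‖p.1‖ : ℝ) : ℂ) := by
    have : Measurable fun p : E n × E n => p.1 i :=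
      (EuclideanSpace.proj (𝕜 := ℝ) i).continuous.measurable.comp measurable_fst
    fun_prop
  exact Finset.measurable_fun_sum _ fun i _ => (h1 i).mul (hH.fderiv_xiField i).measurable

/-- The inner identity holds only on `TSⁿ⁻¹`, so it cannot be differentiated in the ambient space.
`Xi` depends only on values on `TSⁿ⁻¹` and allows the exchange of extensions. -/
lemma fourSym_xiSymbol_xiSymbol {H : E n × E n → ℂ} (hH : IsSymbol H) (i j : Fin n) (q : TS n) :
    fourSym (xiSymbol i (xiSymbol j H)) q.1 =
      fderiv ℝ (fun p => fderiv ℝ (fourSym H) p (xiField j p)) q.1 (xiField i q.1) := by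
  rw [(hH.xiSym j).fourSym_xiSymbol,
    ← Xi_eq_fderiv (φ := fun q => fderiv ℝ (fourSym H) q.1 (xiField j q.1))
      (fun q => rfl) i q (hH.fourSym.fderiv_xiField j).differentiable.differentiableAt,
    ← Xi_eq_fderiv (fun q => hH.fourSym_xiSymbol j q) i q
      (hH.xiSym j).fourSym.differentiable.differentiableAt]

lemma fourierZ_ray {H : E n × E n → ℂ} (hH : IsSymbol H) (q : TS n) :
    fourierZ (ray H) q = (((2 * Real.pi) ^ (1 / 2 : ℝ) : ℝ) : ℂ) * zSymbol (fourSym H) q.1 := by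
  unfold fourierZ zSymbol
  rw [Finset.mul_sum]
  refine Finset.sum_congr rfl fun i _ => ?_
  rw [Xi_eq_fderiv (fun q => (fourierTS_ray hH q).symm) i q
    (hH.fourSym.differentiable.differentiableAt.const_mul _),
    fderiv_const_mul hH.fourSym.differentiable.differentiableAt, mul_left_comm]
  rfl

lemma zSymbol_const_mul {H : E n × E n → ℂ} (hH : IsSymbol H) (c : ℂ) (p : E n × E n) :
    zSymbol (fun p => c * H p) p = c * zSymbol H p := by
  unfold zSymbol
  rw [Finset.mul_sum]
  refine Finset.sum_congr rfl fun i _ => ?_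
  rw [fderiv_const_mul hH.differentiable.differentiableAt, mul_left_comm]
  rfl

lemma tsInt_weight_add (hn : 2 ≤ n) (s t a : ℝ) (k : ℕ) (V : E n × E n → ℂ) :
    (tsInt fun p => weight (s + (a + k)) (t + (a + k)) ‖p.1‖ * ‖V p‖ₑ ^ 2) =
      tsInt fun p => weight (s + a) (t + a) ‖p.1‖ *
        (ENNReal.ofReal ‖p.1‖ ^ (2 * k) * ‖V p‖ₑ ^ 2) := by
  refine tsInt_congr hn fun q hq => ?_
  rw [weight_add _ _ _ _ (norm_pos_iff.mpr hq), mul_assoc]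

lemma dataNormSq_eq_tsInt (hn : 2 ≤ n) (s t : ℝ) : dataNormSq s t f =
    tsInt fun p => weight (s + 1 / 2) (t + 1 / 2) ‖p.1‖ * eData (dataSymbol f) p := by
  set Φ := dataSymbol f with hΦ
  have hs : IsSymbol Φ := isSymbol_dataSymbol f
  have h5 : (5 / 2 : ℝ) = 1 / 2 + (2 : ℕ) := by norm_num
  have h3 : (3 / 2 : ℝ) = 1 / 2 + (1 : ℕ) := by norm_num
  have hT (k : ℕ) : IsSymbol (tensorSymbol f k) := isSymbol_tensorSymbol f k
  have e1 : normSqTS (s + 5 / 2) (t + 5 / 2) (rayTransform 2 f) =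
      tsInt fun p => weight (s + 1 / 2) (t + 1 / 2) ‖p.1‖ *
        (ENNReal.ofReal ‖p.1‖ ^ 4 * ‖dirY (dirY Φ) p‖ₑ ^ 2) := by
    rw [rayTransform_eq_ray, normSqTS_ray _ _ (hT 2) hs.dirY.dirY.measurable
      fun q => by rw [fourSym_two, norm_neg], h5, tsInt_weight_add hn]
  have e2 (i : Fin n) : normSqTS (s + 3 / 2) (t + 3 / 2) (Xi i (rayTransform 1 f)) =
      tsInt fun p => weight (s + 1 / 2) (t + 1 / 2) ‖p.1‖ *
        (ENNReal.ofReal ‖p.1‖ ^ 2 * ‖fderiv ℝ (dirY Φ) p (xiField i p)‖ₑ ^ 2) := by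
    rw [rayTransform_eq_ray, (hT 1).Xi_ray, normSqTS_ray _ _ ((hT 1).xiSym i)
      (hs.dirY.fderiv_xiField i).measurable fun q => ?_, h3, tsInt_weight_add hn]
    rw [(hT 1).fourSym_xiSymbol, fourSym_one, fderiv_const_mul hs.dirY.differentiable.differentiableAt]
    simp
  have e3 : normSqTS (s + 3 / 2) (t + 3 / 2) (rayTransform 1 f) =
      tsInt fun p => weight (s + 1 / 2) (t + 1 / 2) ‖p.1‖ *
        (ENNReal.ofReal ‖p.1‖ ^ 2 * ‖dirY Φ p‖ₑ ^ 2) := by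
    rw [rayTransform_eq_ray, normSqTS_ray _ _ (hT 1) hs.dirY.measurable
      fun q => by rw [fourSym_one, norm_mul, Complex.norm_I, one_mul], h3, tsInt_weight_add hn]
  have e4 : normSqZ (s + 3 / 2) (t + 3 / 2) (rayTransform 1 f) =
      tsInt fun p => weight (s + 1 / 2) (t + 1 / 2) ‖p.1‖ *
        (ENNReal.ofReal ‖p.1‖ ^ 2 * ‖zSymbol (dirY Φ) p‖ₑ ^ 2) := by
    rw [rayTransform_eq_ray, normSqZ, weightedSqTS_eq_tsInt _ _ (measurable_zSymbol hs.dirY)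
      fun q => ?_, h3, tsInt_weight_add hn]
    rw [fourierZ_ray (hT 1), norm_mul, norm_two_pi, fourSym_one, zSymbol_const_mul hs.dirY, norm_mul,
      Complex.norm_I, one_mul]
  have e5 (i : Fin n) : normSqTS (s + 3 / 2) (t + 3 / 2) (mulX i (rayTransform 0 f)) =
      tsInt fun p => weight (s + 1 / 2) (t + 1 / 2) ‖p.1‖ * (ENNReal.ofReal ‖p.1‖ ^ 2 *
        ‖fderiv ℝ Φ p (EuclideanSpace.single i (1 : ℝ) - p.2 i • p.2, 0)‖ₑ ^ 2) := by
    rw [rayTransform_eq_ray, IsSymbol.mulX_ray, normSqTS_ray _ _ ((hT 0).xSym i)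
      (hs.fderiv_tangent i).measurable fun q => ?_, h3, tsInt_weight_add hn]
    unfold xSymbol
    rw [(hT 0).fourSym_inner_mul fun ξ => EuclideanSpace.single i (1 : ℝ) - ξ i • ξ, fourSym_zero,
      norm_mul, Complex.norm_I, one_mul]
  have e6 (i j : Fin n) : normSqTS (s + 1 / 2) (t + 1 / 2) (Xi i (Xi j (rayTransform 0 f))) =
      tsInt fun p => weight (s + 1 / 2) (t + 1 / 2) ‖p.1‖ *
        ‖fderiv ℝ (fun p => fderiv ℝ Φ p (xiField j p)) p (xiField i p)‖ₑ ^ 2 := by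
    rw [rayTransform_eq_ray, (hT 0).Xi_ray, ((hT 0).xiSym j).Xi_ray,
      normSqTS_ray _ _ (((hT 0).xiSym j).xiSym i)
      ((hs.fderiv_xiField j).fderiv_xiField i).measurable fun q => ?_]
    rw [fourSym_xiSymbol_xiSymbol (hT 0), fourSym_zero]
  have e7 : normSqTS (s + 1 / 2) (t + 1 / 2) (rayTransform 0 f) =
      tsInt fun p => weight (s + 1 / 2) (t + 1 / 2) ‖p.1‖ * ‖Φ p‖ₑ ^ 2 := by
    rw [rayTransform_eq_ray, normSqTS_ray _ _ (hT 0) hs.measurable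
      fun q => by rw [fourSym_zero]]
  have e8 (i : Fin n) : normSqTS (s + 1 / 2) (t + 1 / 2) (Xi i (rayTransform 0 f)) =
      tsInt fun p => weight (s + 1 / 2) (t + 1 / 2) ‖p.1‖ *
        ‖fderiv ℝ Φ p (xiField i p)‖ₑ ^ 2 := by
    rw [rayTransform_eq_ray, (hT 0).Xi_ray, normSqTS_ray _ _ ((hT 0).xiSym i)
      (hs.fderiv_xiField i).measurable fun q => ?_]
    rw [(hT 0).fourSym_xiSymbol, fourSym_zero]
  have hw : Measurable fun p : E n × E n => weight (s + 1 / 2) (t + 1 / 2) ‖p.1‖ := by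
    unfold weight; fun_prop
  have hr (k : ℕ) : Measurable fun p : E n × E n => ENNReal.ofReal ‖p.1‖ ^ k := by fun_prop
  unfold dataNormSq eData
  simp only [e1, e2, e3, e4, e5, e6, e7, e8]
  exact (tsInt_mul_sum hw ((hr 4).mul (hs.dirY.dirY.measurable.enorm.pow_const 2))
    (fun i => (hr 2).mul ((hs.dirY.fderiv_xiField i).measurable.enorm.pow_const 2))
    ((hr 2).mul (hs.dirY.measurable.enorm.pow_const 2))
    ((hr 2).mul ((measurable_zSymbol hs.dirY).enorm.pow_const 2))
    (fun i => (hr 2).mul ((hs.fderiv_tangent i).measurable.enorm.pow_const 2))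
    (fun i j => ((hs.fderiv_xiField j).fderiv_xiField i).measurable.enorm.pow_const 2)
    (hs.measurable.enorm.pow_const 2)
    fun i => (hs.fderiv_xiField i).measurable.enorm.pow_const 2).symm

end Data

end

/-! ### The estimate on Schwartz fields -/

section

lemma measurable_weight (s t : ℝ) : Measurable (weight s t) := by
  unfold weight; fun_prop

lemma frameDensity_le_eData (hn : 2 ≤ n) (f : SchwartzTensor n) (q : TS n) (hq : q.1.1 ≠ 0) :
    frameDensity (fun i j => fourS (f.comp i j)) q.1 ≤
      ENNReal.ofReal (10 * n ^ 2) * eData (dataSymbol f) q.1 := by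
  have h := framePart_le_dataDensity (by omega) (fun i j => fourS (f.comp i j))
    (fun i j => by rw [f.symm i j]) q hq
  refine (ENNReal.ofReal_le_ofReal h).trans ?_
  rw [ENNReal.ofReal_mul (by positivity)]
  gcongr
  exact ofReal_dataDensity_le _ _

lemma measurable_eData {H : E n × E n → ℂ} (hs : IsSymbol H) : Measurable (eData H) := by
  have hr (k : ℕ) : Measurable fun p : E n × E n => ENNReal.ofReal ‖p.1‖ ^ k := by fun_prop
  have m1 := (hr 4).mul (hs.dirY.dirY.measurable.enorm.pow_const 2)
  have m2 (i : Fin n) := (hr 2).mul ((hs.dirY.fderiv_xiField i).measurable.enorm.pow_const 2)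
  have m3 := (hr 2).mul (hs.dirY.measurable.enorm.pow_const 2)
  have m4 := (hr 2).mul ((measurable_zSymbol hs.dirY).enorm.pow_const 2)
  have m5 (i : Fin n) := (hr 2).mul ((hs.fderiv_tangent i).measurable.enorm.pow_const 2)
  have m6 (i j : Fin n) :=
    ((hs.fderiv_xiField j).fderiv_xiField i).measurable.enorm.pow_const 2
  have m7 := hs.measurable.enorm.pow_const 2
  have m8 (i : Fin n) := (hs.fderiv_xiField i).measurable.enorm.pow_const 2
  exact ((((((m1.add (Finset.measurable_fun_sum _ fun i _ => m2 i)).add m3).add m4).add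
    (Finset.measurable_fun_sum _ fun i _ => m5 i)).add
    (Finset.measurable_fun_sum _ fun i _ => Finset.measurable_fun_sum _ fun j _ => m6 i j)).add
    m7).add (Finset.measurable_fun_sum _ fun i _ => m8 i)

/-- The stability estimate on Schwartz fields. -/
lemma exists_normSq_le (hn : 2 ≤ n) : ∃ b : ℝ≥0, ∀ (s t : ℝ) (f : SchwartzTensor n),
    f.normSq s t ≤ b * dataNormSq s t f := by
  obtain ⟨C, hC⟩ := lintegral_tensor_le hn
  refine ⟨C * (10 * n ^ 2), fun s t f => ?_⟩
  have hm (i j : Fin n) : Measurable (fourS (f.comp i j)) := (fourS (f.comp i j)).continuous.measurable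
  have h1 : f.normSq s t = ∫⁻ y, weight s t ‖y‖ * ∑ i, ∑ j, ‖fourS (f.comp i j) y‖ₑ ^ 2 := by
    have hmm (i j : Fin n) :
        Measurable fun y : E n => weight s t ‖y‖ * ‖fourS (f.comp i j) y‖ₑ ^ 2 :=
      ((measurable_weight s t).comp measurable_norm).mul ((hm i j).enorm.pow_const 2)
    simp only [Finset.mul_sum]
    rw [lintegral_finsetSum _ fun i _ => Finset.measurable_fun_sum _ fun j _ => hmm i j]
    refine Finset.sum_congr rfl fun i _ => ?_
    rw [lintegral_finsetSum _ fun j _ => hmm i j]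
    refine Finset.sum_congr rfl fun j _ => ?_
    simp only [normSq, weightedSq, fourS_apply]
  rw [h1, dataNormSq_eq_tsInt f hn]
  refine (hC (fun i j => fourS (f.comp i j)) hm (fun i j => by rw [f.symm i j]) _
    (measurable_weight s t)).trans ?_
  rw [ENNReal.coe_mul, mul_assoc]
  gcongr
  have hw : Measurable fun p : E n × E n => weight (s + 1 / 2) (t + 1 / 2) ‖p.1‖ :=
    (measurable_weight _ _).comp (by fun_prop)
  rw [← tsInt_const_mul (h := fun p => weight (s + 1 / 2) (t + 1 / 2) ‖p.1‖ *
    eData (dataSymbol f) p) _ (hw.mul (measurable_eData (isSymbol_dataSymbol f)))]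
  refine tsInt_mono (h := fun p => weight s t ‖p.1‖ * ENNReal.ofReal ‖p.1‖ *
    frameDensity (fun i j => fourS (f.comp i j)) p) hn fun q hq => ?_
  have hr : 0 < ‖q.1.1‖ := norm_pos_iff.mpr hq
  -- The factor `|y|` from comparing the two radial densities is exactly the half-order shift.
  have h2 : weight (s + 1 / 2) (t + 1 / 2) ‖q.1.1‖ =
      weight s t ‖q.1.1‖ * ENNReal.ofReal ‖q.1.1‖ := by
    unfold weight
    rw [← ENNReal.ofReal_mul (by positivity), show 2 * (t + 1 / 2) = 2 * t + 1 by ring,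
      Real.rpow_add hr, Real.rpow_one, show s + 1 / 2 - (t + 1 / 2) = s - t by ring]
    congr 1; ring
  have h3 : ((10 * (n : ℝ≥0) ^ 2 : ℝ≥0) : ℝ≥0∞) = ENNReal.ofReal (10 * n ^ 2) := by
    rw [← ENNReal.ofReal_coe_nnreal]; push_cast; rfl
  rw [h2, h3, mul_left_comm]
  gcongr
  exact frameDensity_le_eData hn f q hq

/-! ### Finiteness of the data -/

/-- Rapid decay in the first variable, uniformly for unit vectors in the second. -/
def RapidDecay (A : E n × E n → ℝ≥0∞) : Prop :=
  ∀ k : ℕ, ∃ C : ℝ≥0, ∀ p : E n × E n, ‖p.2‖ = 1 → ENNReal.ofReal (1 + ‖p.1‖) ^ k * A p ≤ C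

namespace RapidDecay

variable {A B : E n × E n → ℝ≥0∞}

lemma add (hA : RapidDecay A) (hB : RapidDecay B) : RapidDecay fun p => A p + B p := by
  intro k
  obtain ⟨C, hC⟩ := hA k
  obtain ⟨D, hD⟩ := hB k
  refine ⟨C + D, fun p hp => ?_⟩
  rw [mul_add, ENNReal.coe_add]
  exact add_le_add (hC p hp) (hD p hp)

lemma sum {ι : Type*} (s : Finset ι) {A : ι → E n × E n → ℝ≥0∞} (hA : ∀ i, RapidDecay (A i)) :
    RapidDecay fun p => ∑ i ∈ s, A i p := by
  classical
  induction s using Finset.induction_on with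
  | empty => exact fun k => ⟨0, fun p _ => by simp⟩
  | insert a s ha ih =>
    simp only [Finset.sum_insert ha]
    exact (hA a).add ih

lemma norm_pow_mul (hA : RapidDecay A) (m : ℕ) :
    RapidDecay fun p => ENNReal.ofReal ‖p.1‖ ^ m * A p := by
  intro k
  obtain ⟨C, hC⟩ := hA (k + m)
  refine ⟨C, fun p hp => le_trans ?_ (hC p hp)⟩
  change ENNReal.ofReal (1 + ‖p.1‖) ^ k * (ENNReal.ofReal ‖p.1‖ ^ m * A p) ≤ _
  rw [pow_add, mul_assoc]
  gcongr
  linarith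

lemma of_le (hA : RapidDecay A) (c : ℝ≥0) (h : ∀ p, B p ≤ c * A p) : RapidDecay B := by
  intro k
  obtain ⟨C, hC⟩ := hA k
  refine ⟨c * C, fun p hp => ?_⟩
  rw [ENNReal.coe_mul]
  calc _ ≤ ENNReal.ofReal (1 + ‖p.1‖) ^ k * (c * A p) := by gcongr; exact h p
    _ = c * (ENNReal.ofReal (1 + ‖p.1‖) ^ k * A p) := by ring
    _ ≤ _ := by gcongr; exact hC p hp

end RapidDecay

lemma IsSymbol.rapidDecay {H : E n × E n → ℂ} (hH : IsSymbol H) :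
    RapidDecay fun p => ‖H p‖ₑ ^ 2 := by
  intro k
  obtain ⟨C, hC0, hC⟩ := hH.exists_bound k
  refine ⟨(C ^ 2).toNNReal, fun p hp => ?_⟩
  change ENNReal.ofReal (1 + ‖p.1‖) ^ k * ‖H p‖ₑ ^ 2 ≤ _
  rw [enorm_sq_eq_ofReal, ← ENNReal.ofReal_pow (by positivity), ← ENNReal.ofReal_mul (by positivity)]
  refine ENNReal.ofReal_le_ofReal ?_
  calc (1 + ‖p.1‖) ^ k * ‖H p‖ ^ 2 ≤ ((1 + ‖p.1‖) ^ k) ^ 2 * ‖H p‖ ^ 2 := by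
        gcongr
        exact le_self_pow₀ (one_le_pow₀ (by linarith [norm_nonneg p.1])) (by norm_num)
    _ = ((1 + ‖p.1‖) ^ k * ‖H p‖) ^ 2 := by ring
    _ ≤ C ^ 2 := by gcongr; exact hC p hp

lemma enorm_zSymbol_sq_le (H : E n × E n → ℂ) (p : E n × E n) :
    ‖zSymbol H p‖ₑ ^ 2 ≤ (n : ℝ≥0) * ∑ k, ‖fderiv ℝ H p (xiField k p)‖ₑ ^ 2 := by
  have h1 : ‖zSymbol H p‖ ≤ ∑ k, ‖fderiv ℝ H p (xiField k p)‖ := by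
    refine (norm_sum_le _ _).trans (Finset.sum_le_sum fun k _ => ?_)
    rw [norm_mul, Complex.norm_real, norm_div, norm_norm]
    exact mul_le_of_le_one_left (norm_nonneg _)
      (div_le_one_of_le₀ (PiLp.norm_apply_le p.1 k) (norm_nonneg _))
  have h2 := (pow_le_pow_left₀ (norm_nonneg _) h1 2).trans (sq_sum_le_card _)
  simp only [enorm_sq_eq_ofReal]
  rw [← ENNReal.ofReal_sum_of_nonneg fun _ _ => sq_nonneg _, ← ENNReal.ofReal_coe_nnreal,
    ← ENNReal.ofReal_mul (by positivity)]
  exact ENNReal.ofReal_le_ofReal (by simpa using h2)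

lemma rapidDecay_eData {H : E n × E n → ℂ} (hs : IsSymbol H) : RapidDecay (eData H) := by
  have hz : RapidDecay fun p => ‖zSymbol (dirY H) p‖ₑ ^ 2 :=
    (RapidDecay.sum Finset.univ fun k => (hs.dirY.fderiv_xiField k).rapidDecay).of_le n
      (enorm_zSymbol_sq_le _)
  exact (((((((hs.dirY.dirY.rapidDecay.norm_pow_mul 4).add
    (.sum _ fun i => (hs.dirY.fderiv_xiField i).rapidDecay.norm_pow_mul 2)).add
    (hs.dirY.rapidDecay.norm_pow_mul 2)).add (hz.norm_pow_mul 2)).add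
    (.sum _ fun i => (hs.fderiv_tangent i).rapidDecay.norm_pow_mul 2)).add
    (.sum _ fun i => .sum _ fun j => ((hs.fderiv_xiField j).fderiv_xiField i).rapidDecay)).add
    hs.rapidDecay).add (.sum _ fun i => (hs.fderiv_xiField i).rapidDecay)

lemma exists_radial_lintegral_lt_top (hn : 2 ≤ n) (s t : ℝ) (ht : -(n : ℝ) / 2 < t) :
    ∃ k : ℕ, ∫⁻ r in Set.Ioi (0 : ℝ), ENNReal.ofReal (r ^ (n - 2)) *
      (weight (s + 1 / 2) (t + 1 / 2) r * (ENNReal.ofReal (1 + r) ^ k)⁻¹) < ∞ := by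
  -- This is the total power of `r` near `0`, from `r^(n-2)` and `r^(2(t+1/2))`; `a > -1` is the
  -- condition `t > -n/2`. The exponent `k` then pays for `(1 + r²)^(s-t)` and leaves a tail
  -- `r^(-2)`.
  set a : ℝ := 2 * t + n - 1 with ha
  have ha1 : -1 < a := by linarith
  set d := |s - t|
  have hd : 0 ≤ d := abs_nonneg _
  obtain ⟨k, hk⟩ := exists_nat_ge (2 * d + (a + 2))
  refine ⟨k, ?_⟩
  have hpt (r : ℝ) (hr : 0 < r) : ENNReal.ofReal (r ^ (n - 2)) *
      (weight (s + 1 / 2) (t + 1 / 2) r * (ENNReal.ofReal (1 + r) ^ k)⁻¹) ≤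
      ENNReal.ofReal (r ^ a * (1 + r) ^ (-(a + 2))) := by
    unfold weight
    rw [← ENNReal.ofReal_pow (by positivity), ← ENNReal.ofReal_inv_of_pos (by positivity),
      ← ENNReal.ofReal_mul (by positivity), ← ENNReal.ofReal_mul (by positivity)]
    refine ENNReal.ofReal_le_ofReal ?_
    have e1 : r ^ a = r ^ (n - 2) * r ^ (2 * (t + 1 / 2)) := by
      rw [← Real.rpow_natCast, ← Real.rpow_add hr, Nat.cast_sub hn]
      congr 1; push_cast; rw [ha]; ring
    have e2 : (1 + r ^ 2) ^ (s + 1 / 2 - (t + 1 / 2)) ≤ (1 + r) ^ (2 * d) := by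
      calc (1 + r ^ 2) ^ (s + 1 / 2 - (t + 1 / 2)) ≤ (1 + r ^ 2) ^ d :=
            Real.rpow_le_rpow_of_exponent_le (by nlinarith) (by
              rw [show s + 1 / 2 - (t + 1 / 2) = s - t by ring]; exact le_abs_self _)
        _ ≤ ((1 + r) ^ (2 : ℝ)) ^ d := by
            refine Real.rpow_le_rpow (by positivity) ?_ hd
            rw [Real.rpow_two]; nlinarith
        _ = _ := by rw [← Real.rpow_mul (by positivity)]
    have e3 : (1 + r) ^ (2 * d) * ((1 + r) ^ k)⁻¹ ≤ (1 + r) ^ (-(a + 2)) := by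
      rw [← Real.rpow_natCast, ← Real.rpow_neg (by positivity), ← Real.rpow_add (by positivity)]
      exact Real.rpow_le_rpow_of_exponent_le (by linarith) (by linarith)
    calc r ^ (n - 2) * (r ^ (2 * (t + 1 / 2)) * (1 + r ^ 2) ^ (s + 1 / 2 - (t + 1 / 2)) *
          ((1 + r) ^ k)⁻¹)
        = r ^ a * ((1 + r ^ 2) ^ (s + 1 / 2 - (t + 1 / 2)) * ((1 + r) ^ k)⁻¹) := by rw [e1]; ring
      _ ≤ r ^ a * ((1 + r) ^ (2 * d) * ((1 + r) ^ k)⁻¹) := by gcongr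
      _ ≤ _ := by gcongr
  refine (setLIntegral_mono' measurableSet_Ioi hpt).trans_lt ?_
  rw [← Set.Ioc_union_Ioi_eq_Ioi zero_le_one]
  refine (lintegral_union_le _ _ _).trans_lt (ENNReal.add_lt_top.mpr ⟨?_, ?_⟩)
  · have h1 : IntegrableOn (fun r : ℝ => r ^ a) (Set.Ioc 0 1) :=
      (intervalIntegrable_iff_integrableOn_Ioc_of_le zero_le_one).mp
        (intervalIntegral.intervalIntegrable_rpow' ha1)
    refine (setLIntegral_mono' measurableSet_Ioc fun r hr => ENNReal.ofReal_le_ofReal ?_).trans_lt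
      h1.lintegral_lt_top
    exact mul_le_of_le_one_right (Real.rpow_nonneg hr.1.le _)
      (Real.rpow_le_one_of_one_le_of_nonpos (by linarith [hr.1]) (by linarith))
  · have h1 : IntegrableOn (fun r : ℝ => r ^ (-2 : ℝ)) (Set.Ioi 1) :=
      integrableOn_Ioi_rpow_of_lt (by norm_num) one_pos
    refine (setLIntegral_mono' measurableSet_Ioi fun r hr => ENNReal.ofReal_le_ofReal ?_).trans_lt
      h1.lintegral_lt_top
    have hr0 : (0 : ℝ) < r := one_pos.trans hr
    have hle : (1 + r) ^ (-(a + 2)) ≤ r ^ (-(a + 2)) :=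
      Real.rpow_le_rpow_of_nonpos hr0 (by linarith) (by linarith)
    calc r ^ a * (1 + r) ^ (-(a + 2)) ≤ r ^ a * r ^ (-(a + 2)) := by
          gcongr
      _ = r ^ (-2 : ℝ) := by rw [← Real.rpow_add hr0]; congr 1; ring

lemma tsInt_norm_lt_top (hn : 2 ≤ n) {f : ℝ → ℝ≥0∞} (hf : Measurable f)
    (h : ∫⁻ r in Set.Ioi (0 : ℝ), ENNReal.ofReal (r ^ (n - 2)) * f r < ∞) :
    tsInt (fun p : E n × E n => f ‖p.1‖) < ∞ := by
  set k₀ : Fin n := ⟨0, by omega⟩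
  set k₁ : Fin n := ⟨1, by omega⟩
  have h01 : k₀ ≠ k₁ := by simp [k₀, k₁]
  set u : Sph n := ⟨EuclideanSpace.single k₀ 1, by simp⟩ with hu
  set w : Sph n := ⟨EuclideanSpace.single k₁ 1, by simp⟩ with hw
  have huw : ⟪(u : E n), (w : E n)⟫ = 0 := by
    simp [hu, hw, EuclideanSpace.inner_single_left, h01]
  have h1 := lintegral_sphere_perp hn (h := fun p : E n × E n => f ‖p.1‖) (hf.comp (by fun_prop))
    u w huw
  refine (h1.trans_lt ?_)
  have h2 : ∀ r ∈ Set.Ioi (0 : ℝ), ENNReal.ofReal (r ^ (n - 2)) *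
      rotAvg (fun p : E n × E n => f ‖p.1‖) (r • (u : E n)) w = ENNReal.ofReal (r ^ (n - 2)) * f r := by
    intro r hr
    have hr0 : 0 < r := hr
    simp only [rotAvg, Rot.norm_map, norm_smul, norm_eq_of_mem_sphere, mul_one, Real.norm_of_nonneg hr0.le]
    simp
  rw [setLIntegral_congr_fun measurableSet_Ioi h2]
  exact ENNReal.mul_lt_top (lt_top_iff_ne_top.mpr sphereMeasure_univ_ne_top)
    (ENNReal.mul_lt_top (lt_top_iff_ne_top.mpr (perpSphereMass_ne_top w)) h)

lemma dataNormSq_lt_top (hn : 2 ≤ n) {s t : ℝ} (ht : -(n : ℝ) / 2 < t) (f : SchwartzTensor n) :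
    dataNormSq s t f < ∞ := by
  obtain ⟨k, hk⟩ := exists_radial_lintegral_lt_top hn s t ht
  obtain ⟨C, hC⟩ := rapidDecay_eData (isSymbol_dataSymbol f) k
  set F : ℝ → ℝ≥0∞ := fun r => weight (s + 1 / 2) (t + 1 / 2) r * (ENNReal.ofReal (1 + r) ^ k)⁻¹
  have hF : Measurable F := (measurable_weight _ _).mul (by fun_prop)
  rw [dataNormSq_eq_tsInt f hn]
  calc _ ≤ tsInt fun p : E n × E n => C * F ‖p.1‖ := tsInt_mono hn fun q _ => by
        have h0 : ENNReal.ofReal (1 + ‖q.1.1‖) ^ k ≠ 0 := by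
          have : 0 < 1 + ‖q.1.1‖ := by positivity
          simp [this]
        have ht : ENNReal.ofReal (1 + ‖q.1.1‖) ^ k ≠ ∞ := by finiteness
        have h1 := hC q.1 q.norm_snd
        rw [mul_comm, ← ENNReal.le_div_iff_mul_le (.inl h0) (.inl ht), ENNReal.div_eq_inv_mul] at h1
        calc _ ≤ weight (s + 1 / 2) (t + 1 / 2) ‖q.1.1‖ *
              ((ENNReal.ofReal (1 + ‖q.1.1‖) ^ k)⁻¹ * C) := by gcongr
          _ = _ := by simp only [F]; ring
    _ = C * tsInt fun p : E n × E n => F ‖p.1‖ := tsInt_const_mul _ (hF.comp (by fun_prop))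
    _ < ∞ := ENNReal.mul_lt_top ENNReal.coe_lt_top (tsInt_norm_lt_top hn hF hk)

end

/-! ### The completed space -/

section

lemma enorm_sq_le_of_sub (v g : ℂ) {ε : ℝ} (hε : 0 < ε) :
    ‖v‖ₑ ^ 2 ≤ ENNReal.ofReal (1 + ε) * ‖g‖ₑ ^ 2 + ENNReal.ofReal (1 + ε⁻¹) * ‖g - v‖ₑ ^ 2 := by
  simp only [enorm_sq_eq_ofReal]
  rw [← ENNReal.ofReal_mul (by positivity), ← ENNReal.ofReal_mul (by positivity),
    ← ENNReal.ofReal_add (by positivity) (by positivity)]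
  refine ENNReal.ofReal_le_ofReal ?_
  have h1 : ‖v‖ ≤ ‖g‖ + ‖g - v‖ := by
    have := norm_sub_norm_le v g
    rw [norm_sub_rev v g] at this; linarith
  have h2 : ‖v‖ ^ 2 ≤ (‖g‖ + ‖g - v‖) ^ 2 := by gcongr
  have h3 : 0 ≤ ε⁻¹ * (ε * ‖g‖ - ‖g - v‖) ^ 2 := by positivity
  have h4 : ε⁻¹ * (ε * ‖g‖ - ‖g - v‖) ^ 2 =
      ε * ‖g‖ ^ 2 - 2 * ‖g‖ * ‖g - v‖ + ε⁻¹ * ‖g - v‖ ^ 2 := by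
    field_simp
    ring
  nlinarith

lemma enorm_sq_hat {s t : ℝ} (v : Lp ℂ 2 (sobolevMeasure n s t)) :
    ‖v‖ₑ ^ 2 = weightedSq s t v := by
  have hw : Measurable fun y : E n => weight s t ‖y‖ := (measurable_weight s t).comp measurable_norm
  rw [Lp.enorm_def, eLpNorm_eq_lintegral_rpow_enorm_toReal (by simp) (by simp)]
  simp only [ENNReal.toReal_ofNat, ENNReal.rpow_two]
  rw [← ENNReal.rpow_natCast, ← ENNReal.rpow_mul]
  norm_num
  have hlt : ∀ᵐ y : E n, weight s t ‖y‖ < ∞ := ae_of_all _ fun y => ENNReal.ofReal_lt_top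
  unfold sobolevMeasure
  rw [lintegral_withDensity_eq_lintegral_mul_non_measurable _ hw hlt]
  rfl

lemma weightedSq_le_of_sub (s t : ℝ) {v g : E n → ℂ} (hg : Measurable g) {ε : ℝ} (hε : 0 < ε) :
    weightedSq s t v ≤ ENNReal.ofReal (1 + ε) * weightedSq s t g +
      ENNReal.ofReal (1 + ε⁻¹) * weightedSq s t fun y => g y - v y := by
  have hw : Measurable fun y : E n => weight s t ‖y‖ := (measurable_weight s t).comp measurable_norm
  unfold weightedSq
  rw [← lintegral_const_mul' _ _ ENNReal.ofReal_ne_top, ← lintegral_const_mul' _ _ ENNReal.ofReal_ne_top,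
    ← lintegral_add_left (by fun_prop)]
  refine lintegral_mono fun y => ?_
  calc _ ≤ weight s t ‖y‖ * (ENNReal.ofReal (1 + ε) * ‖g y‖ₑ ^ 2 +
        ENNReal.ofReal (1 + ε⁻¹) * ‖g y - v y‖ₑ ^ 2) := by
        gcongr; exact enorm_sq_le_of_sub _ _ hε
    _ = _ := by ring

lemma SobolevTensor.normSq_le_of_sub {s t : ℝ} (f : SobolevTensor n s t) (g : SchwartzTensor n)
    {ε : ℝ} (hε : 0 < ε) : f.normSq ≤ ENNReal.ofReal (1 + ε) * g.normSq s t +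
      ENNReal.ofReal (1 + ε⁻¹) * ∑ i, ∑ j,
        weightedSq s t (fun y => fourierRn (g.comp i j) y - f.hat i j y) := by
  unfold SobolevTensor.normSq SchwartzTensor.normSq MomentumRay.normSq
  simp only [Finset.mul_sum, ← Finset.sum_add_distrib]
  refine Finset.sum_le_sum fun i _ => Finset.sum_le_sum fun j _ => ?_
  rw [enorm_sq_hat]
  refine weightedSq_le_of_sub s t ?_ hε
  rw [← funext (fourS_apply (g.comp i j))]
  exact (fourS (g.comp i j)).continuous.measurable

/-- The inequality `|v|² ≤ (1 + ε)|g|² + (1 + 1/ε)|g - v|²` is integrated. For fixed `ε` the last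
term tends to zero along the sequence, and then `ε → 0`. -/
lemma le_liminf_of_convergesTo {s t : ℝ} {f : SobolevTensor n s t} {g : ℕ → SchwartzTensor n}
    (hg : ConvergesTo g f) : f.normSq ≤ liminf (fun k => (g k).normSq s t) atTop := by
  set L := liminf (fun k => (g k).normSq s t) atTop
  have key (ε : ℝ) (hε : 0 < ε) : f.normSq ≤ ENNReal.ofReal (1 + ε) * L := by
    have h1 : Tendsto (fun k => ENNReal.ofReal (1 + ε⁻¹) * ∑ i, ∑ j,
        weightedSq s t (fun y => fourierRn ((g k).comp i j) y - f.hat i j y)) atTop (𝓝 0) := by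
      simpa using ENNReal.Tendsto.const_mul hg (.inr ENNReal.ofReal_ne_top)
    refine ENNReal.le_of_forall_pos_le_add fun δ hδ _ => ?_
    have h2 : ∀ᶠ k in atTop, f.normSq ≤ ENNReal.ofReal (1 + ε) * (g k).normSq s t + δ := by
      filter_upwards [h1.eventually_le_const (show (0 : ℝ≥0∞) < δ by exact_mod_cast hδ)] with k hk
      exact (f.normSq_le_of_sub (g k) hε).trans (by gcongr)
    have h3 : f.normSq - δ ≤ liminf (fun k => ENNReal.ofReal (1 + ε) * (g k).normSq s t) atTop :=
      le_liminf_of_le (by isBoundedDefault) (h2.mono fun k hk => tsub_le_iff_right.mpr hk)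
    rw [ENNReal.liminf_const_mul_of_ne_top ENNReal.ofReal_ne_top] at h3
    exact tsub_le_iff_right.mp h3
  have hlim : Tendsto (fun ε : ℝ => ENNReal.ofReal (1 + ε) * L) (𝓝[>] 0) (𝓝 (ENNReal.ofReal 1 * L)) := by
    -- The limit factor `1` is nonzero, so the product is continuous there even if `L = ∞`.
    refine ENNReal.Tendsto.mul_const ?_ (.inl (by simp))
    refine ENNReal.tendsto_ofReal ?_
    have : Tendsto (fun ε : ℝ => 1 + ε) (𝓝 0) (𝓝 (1 + 0)) :=
      tendsto_const_nhds.add tendsto_id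
    rw [add_zero] at this
    exact this.mono_left nhdsWithin_le_nhds
  rw [ENNReal.ofReal_one, one_mul] at hlim
  exact ge_of_tendsto hlim (eventually_mem_nhdsWithin.mono fun ε hε => key ε hε)

end

end MomentumRay

end

/-! ### The main theorem -/

theorem mainTheorem9 (n : ℕ) (hn : 2 ≤ n) :
    ∃ b : ℝ≥0, ∀ s t : ℝ, -(n : ℝ) / 2 < t →
      (∀ f : MomentumRay.SchwartzTensor n,
        MomentumRay.dataNormSq s t f < ∞ ∧
          f.normSq s t ≤ (b : ℝ≥0∞) * MomentumRay.dataNormSq s t f) ∧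
      (∀ f : MomentumRay.SobolevTensor n s t,
        f.normSq ≤ (b : ℝ≥0∞) * f.dataNormSq) := by
  obtain ⟨b, hb⟩ := MomentumRay.exists_normSq_le hn
  -- Adding `1` makes the constant nonzero, so that it can be moved inside an infimum that may equal
  -- `∞`.
  refine ⟨b + 1, fun s t ht => ?_⟩
  have hb' (f : MomentumRay.SchwartzTensor n) :
      f.normSq s t ≤ ((b + 1 : ℝ≥0) : ℝ≥0∞) * MomentumRay.dataNormSq s t f :=
    (hb s t f).trans (by gcongr; simp)
  refine ⟨fun f => ⟨MomentumRay.dataNormSq_lt_top hn ht f, hb' f⟩, fun f => ?_⟩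
  have h0 : ((b + 1 : ℝ≥0) : ℝ≥0∞) ≠ 0 := by simp
  unfold MomentumRay.SobolevTensor.dataNormSq
  rw [ENNReal.mul_iInf_of_ne h0 ENNReal.coe_ne_top]
  refine le_iInf fun g => ?_
  rw [ENNReal.mul_iInf_of_ne h0 ENNReal.coe_ne_top]
  refine le_iInf fun hg => ?_
  rw [← ENNReal.liminf_const_mul_of_ne_top ENNReal.coe_ne_top]
  exact (MomentumRay.le_liminf_of_convergesTo hg).trans
    (liminf_le_liminf (Eventually.of_forall fun k => hb' (g k)))
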